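/- **Setting.** For $c=(c_1,c_2,c_3)\in\mathbb R^3$ put $P_c(x)=c_1(1-x)+c_2(1+x)+c_3(1-x^2)$. A pair $U=(U_\theta,U_\phi)$ with $U_\theta\in C^1(-1,1)$, $U_\phi\in C^2(-1,1)$ *solves (NSE) with constants* $\hat c$ if on $(-1,1)$ $$(1-x^2)U_\theta'+2xU_\theta+\tfrac12U_\theta^2+\psi[U_\phi]=P_{\hat c},\qquad (1-x^2)U_\phi''+U_\theta U_\phi'=0,$$ where $\psi[u](x)=\int_0^x\int_0^l\int_0^t\frac{2u(s)u'(s)}{1-s^2}\,ds\,dt\,dl$. Let $\gamma^+(c)$ be the largest value $u(0)$ of a solution $u\in C^1(-1,1)$ of $(1-x^2)u'+2xu+\frac12u^2=P_c$ on $(-1,1)$, let $U^{c,\gamma}_\theta$ be the solution of this equation with value $\gamma$ at $0$, and let $U^{c,\gamma}=(U_\theta^{c,\gamma},0)$; $U_\theta^{c,\gamma}(\pm1)$ denote the limits at $\pm1$. Let $$\bar c_3(c_1,c_2)=-\tfrac12\big(\sqrt{1+c_1}+\sqrt{1+c_2}\big)\big(\sqrt{1+c_1}+\sqrt{1+c_2}+2\big).$$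 For $5\le k\le8$ let $J_k$ be the set of $c$ with $c_3=\bar c_3(c_1,c_2)$ and, respectively, $c_1,c_2>-1$ ($k=5$); $c_1=-1<c_2$ ($k=6$); $c_2=-1<c_1$ ($k=7$); $c_1=c_2=-1$ ($k=8$). For $l=1,2,3$ let $$I_{k,l}=\{(c,\gamma): c\in J_k,\ \gamma=\gamma^+(c),\ c_1<-\tfrac34,\ c_2<-\tfrac34\}.$$ Put $b_{c,\gamma}(x)=\int_0^x\frac{U^{c,\gamma}_\theta(s)}{1-s^2}ds$, $V^3_{c,\gamma}=\big(0,\int_0^xe^{-b_{c,\gamma}(t)}dt\big)$, $V^4_{c,\gamma}=(0,1)$, and $\varphi_{c,\gamma}[u]=(1-x^2)u'+(2x+U_\theta^{c,\gamma})u+\frac12u^2$. For $0<\epsilon<\frac12$ let $\mathbf X=\mathbf M_1\times\mathbf M_2$ with the norm $\|W\|_{\mathbf X}=\|W_\theta\|_{\mathbf M_1}+\|W_\phi\|_{\mathbf M_2}$. Here $\mathbf M_1$ consists of the $f\in C^3(-\frac12,\frac12)\cap C^1(-1,1)\cap C[-1,1]$ with $f(\pm1)=0$ and finite norm $$\|f\|_{\mathbf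 M_1}=\|(1-x^2)^{-1+2\epsilon}f\|_{L^\infty(-1,1)}+\|(1-x^2)^{2\epsilon}f'\|_{L^\infty(-1,1)}+\|f''\|_{L^\infty(-\frac12,\frac12)}+\|f'''\|_{L^\infty(-\frac12,\frac12)},$$ and $\mathbf M_2$ consists of the $f\in C^2(-1,1)$ with finite norm $$\|f\|_{\mathbf M_2}=\|(1-x^2)^{\epsilon}f\|_{L^\infty(-1,1)}+\|(1-x^2)^{1+\epsilon}f'\|_{L^\infty(-1,1)}+\|(1-x^2)^{2+\epsilon}f''\|_{L^\infty(-1,1)}.$$ Let $\mathbf X_3=\{W\in\mathbf X: W_\phi(0)=W_\phi'(0)=0\}$, and let $B_\delta(0)$ be the open ball of radius $\delta$ about $0$ in $\mathbb R^2$. **Theorem.** Let $K$ be a compact set contained in one of the sets $I_{k,l}$ with $5\le k\le 8$, $1\le l\le 3$. Let $0<\epsilon<\frac12$ be such that for every $(c,\gamma)\in K$, with $m=U_\theta^{c,\gamma}(-1)$ and $n=-U^{c,\gamma}_\theta(1)$: $\epsilon>\frac m4$ if $m<2$ and $\epsilon>\frac m2-1$ if $m\ge2$; $\epsilon>\frac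 n4$ if $n<2$ and $\epsilon>\frac n2-1$ if $n\ge 2$. Then there exist $\delta>0$ and $V\in C^\infty(K\times B_\delta(0),\mathbf X_3)$ (the restriction of a map that is $C^\infty$ on $O\times B_\delta(0)$ for some open $O\supseteq K$ in $\mathbb R^4$) such that for all $(c,\gamma)\in K$ $$V(c,\gamma,0)=0,\qquad \frac{\partial V}{\partial\beta_i}\Big|_{\beta=0}=0\quad(i=3,4),$$ where $\beta=(\beta_3,\beta_4)$, and such that for all $(c,\gamma)\in K$ and $\beta\in B_\delta(0)$ $$U=U^{c,\gamma}+\beta_3V^3_{c,\gamma}+\beta_4V^4_{c,\gamma}+V(c,\gamma,\beta)\tag{1}$$ solves (NSE) with the constants $$\hat c_1=c_1+\tfrac12\psi[\tilde U_\phi](-1),\quad \hat c_2=c_2+\tfrac12\psi[\tilde U_\phi](1),\quad \hat c_3=c_3-\tfrac12(\varphi_{c,\gamma}[\tilde U_\theta])''(0),\qquad \tilde U=U-U^{c,\gamma}.$$ Moreover, there is $\delta'>0$ such that if $(c,\gamma)\in K$, $U-U^{c,\gamma}\in\mathbf X$ with $\|U-U^{c,\gamma}\|_{\mathbf X}<\delta'$,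 and $U$ solves (NSE) with some constants $\hat c_1,\hat c_2,\hat c_3$, then (1) holds for some $\beta$ with $|\beta|<\delta$. -/

import Mathlib

open Set Filter Topology MeasureTheory Metric
open scoped ContDiff

noncomputable section

namespace HomNS

/-! ### Weighted sup-norms -/

/-- The weighted function `w f⁽ⁿ⁾` is bounded on `s`. -/
def WBdd (s : Set ℝ) (w : ℝ → ℝ) (n : ℕ) (f : ℝ → ℝ) : Prop :=
  BddAbove (range fun x : s => |w x * iteratedDeriv n f x|)

/-- The norm of `w f⁽ⁿ⁾` in `L^∞(s)`. It is used only for an open interval `s` and for `w` and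
`f⁽ⁿ⁾` continuous on `s`, where the essential supremum is the supremum. -/
def wnorm (s : Set ℝ) (w : ℝ → ℝ) (n : ℕ) (f : ℝ → ℝ) : ℝ :=
  ⨆ x : s, |w x * iteratedDeriv n f x|

lemma wnorm_nonneg (s : Set ℝ) (w : ℝ → ℝ) (n : ℕ) (f : ℝ → ℝ) : 0 ≤ wnorm s w n f :=
  Real.iSup_nonneg fun _ => abs_nonneg _

lemma WBdd.le {s : Set ℝ} {w : ℝ → ℝ} {n : ℕ} {f : ℝ → ℝ} (h : WBdd s w n f) {x : ℝ}
    (hx : x ∈ s) : |w x * iteratedDeriv n f x| ≤ wnorm s w n f :=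
  le_ciSup h ⟨x, hx⟩

lemma wadd_le {s : Set ℝ} {w : ℝ → ℝ} {n : ℕ} {f g : ℝ → ℝ}
    (hf : ∀ x ∈ s, ContDiffAt ℝ n f x) (hg : ∀ x ∈ s, ContDiffAt ℝ n g x)
    (bf : WBdd s w n f) (bg : WBdd s w n g) (x : s) :
    |w x * iteratedDeriv n (f + g) x| ≤ wnorm s w n f + wnorm s w n g := by
  rw [iteratedDeriv_add (hf x x.2) (hg x x.2), mul_add]
  exact (abs_add_le _ _).trans (add_le_add (bf.le x.2) (bg.le x.2))

lemma WBdd.add {s : Set ℝ} {w : ℝ → ℝ} {n : ℕ} {f g : ℝ → ℝ}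
    (hf : ∀ x ∈ s, ContDiffAt ℝ n f x) (hg : ∀ x ∈ s, ContDiffAt ℝ n g x)
    (bf : WBdd s w n f) (bg : WBdd s w n g) : WBdd s w n (f + g) :=
  ⟨_, forall_mem_range.2 (wadd_le hf hg bf bg)⟩

lemma wnorm_add_le {s : Set ℝ} {w : ℝ → ℝ} {n : ℕ} {f g : ℝ → ℝ}
    (hf : ∀ x ∈ s, ContDiffAt ℝ n f x) (hg : ∀ x ∈ s, ContDiffAt ℝ n g x)
    (bf : WBdd s w n f) (bg : WBdd s w n g) :
    wnorm s w n (f + g) ≤ wnorm s w n f + wnorm s w n g :=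
  Real.iSup_le (wadd_le hf hg bf bg) (add_nonneg (wnorm_nonneg _ _ _ _) (wnorm_nonneg _ _ _ _))

lemma wsmul_eq (s : Set ℝ) (w : ℝ → ℝ) (n : ℕ) (f : ℝ → ℝ) (a : ℝ) :
    (fun x : s => |w x * iteratedDeriv n (a • f) x|)
      = fun x : s => |a| * |w x * iteratedDeriv n f x| := by
  funext x
  rw [iteratedDeriv_const_smul_field, smul_eq_mul, ← abs_mul]
  congr 1
  ring

lemma WBdd.smul {s : Set ℝ} {w : ℝ → ℝ} {n : ℕ} {f : ℝ → ℝ} (a : ℝ) (bf : WBdd s w n f) :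
    WBdd s w n (a • f) := by
  unfold WBdd
  rw [wsmul_eq]
  exact ⟨|a| * wnorm s w n f, forall_mem_range.2 fun x =>
    mul_le_mul_of_nonneg_left (bf.le x.2) (abs_nonneg a)⟩

lemma wnorm_smul (s : Set ℝ) (w : ℝ → ℝ) (n : ℕ) (f : ℝ → ℝ) (a : ℝ) :
    wnorm s w n (a • f) = |a| * wnorm s w n f := by
  unfold wnorm
  rw [wsmul_eq, Real.mul_iSup_of_nonneg (abs_nonneg a)]

lemma WBdd.zero (s : Set ℝ) (w : ℝ → ℝ) (n : ℕ) : WBdd s w n 0 := by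
  refine ⟨0, forall_mem_range.2 fun x => ?_⟩
  have h : iteratedDeriv n (0 : ℝ → ℝ) x = 0 := by
    simp
  simp [h]

/-! ### The Banach spaces -/

/-- The interval `(-1, 1)`. -/
abbrev I1 : Set ℝ := Ioo (-1) 1

/-- The interval `(-1/2, 1/2)`. -/
abbrev Ih : Set ℝ := Ioo (-1 / 2) (1 / 2)

/-- The weight `(1 - x²)ʳ`. -/
def wt (r : ℝ) : ℝ → ℝ := fun x => (1 - x ^ 2) ^ r

/-- The constant weight `1`. -/
def wt1 : ℝ → ℝ := fun _ => 1

/-- Membership in `M₁(ε)`. A function on `[-1, 1]` vanishing at `±1` is represented by its extension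
by zero to the real line, so that equal elements are equal functions. -/
structure MemM1 (ε : ℝ) (f : ℝ → ℝ) : Prop where
  smooth_mid : ContDiffOn ℝ 3 f Ih
  smooth : ContDiffOn ℝ 1 f I1
  cont : ContinuousOn f (Icc (-1) 1)
  zero_off : ∀ x, x ∉ I1 → f x = 0
  bdd0 : WBdd I1 (wt (-1 + 2 * ε)) 0 f
  bdd1 : WBdd I1 (wt (2 * ε)) 1 f
  bdd2 : WBdd Ih wt1 2 f
  bdd3 : WBdd Ih wt1 3 f

/-- Membership in `M₂(ε)`. A function on `(-1, 1)` is represented by its extension by zero to the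
real line (no continuity at `±1` is meant). -/
structure MemM2 (ε : ℝ) (f : ℝ → ℝ) : Prop where
  smooth : ContDiffOn ℝ 2 f I1
  zero_off : ∀ x, x ∉ I1 → f x = 0
  bdd0 : WBdd I1 (wt ε) 0 f
  bdd1 : WBdd I1 (wt (1 + ε)) 1 f
  bdd2 : WBdd I1 (wt (2 + ε)) 2 f

namespace MemM1
variable {ε : ℝ} {f : ℝ → ℝ}

lemma cd0 (h : MemM1 ε f) : ∀ x ∈ I1, ContDiffAt ℝ (0 : ℕ) f x := fun _ hx =>
  (h.smooth.contDiffAt (isOpen_Ioo.mem_nhds hx)).of_le (by norm_num)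
lemma cd1 (h : MemM1 ε f) : ∀ x ∈ I1, ContDiffAt ℝ (1 : ℕ) f x := fun _ hx =>
  (h.smooth.contDiffAt (isOpen_Ioo.mem_nhds hx)).of_le (by norm_num)
lemma cd2 (h : MemM1 ε f) : ∀ x ∈ Ih, ContDiffAt ℝ (2 : ℕ) f x := fun _ hx =>
  (h.smooth_mid.contDiffAt (isOpen_Ioo.mem_nhds hx)).of_le (by norm_cast)
lemma cd3 (h : MemM1 ε f) : ∀ x ∈ Ih, ContDiffAt ℝ (3 : ℕ) f x := fun _ hx =>
  (h.smooth_mid.contDiffAt (isOpen_Ioo.mem_nhds hx)).of_le (by norm_cast)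

end MemM1

namespace MemM2
variable {ε : ℝ} {f : ℝ → ℝ}

lemma cd {m : ℕ} (hm : m ≤ 2) (h : MemM2 ε f) : ∀ x ∈ I1, ContDiffAt ℝ m f x := fun _ hx =>
  (h.smooth.contDiffAt (isOpen_Ioo.mem_nhds hx)).of_le (by exact_mod_cast hm)

end MemM2

/-- `M₁(ε)` as a vector space of functions. -/
def M1Sub (ε : ℝ) : Submodule ℝ (ℝ → ℝ) where
  carrier := {f | MemM1 ε f}
  zero_mem' := ⟨contDiffOn_const, contDiffOn_const, continuousOn_const, fun _ _ => rfl,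
    .zero _ _ _, .zero _ _ _, .zero _ _ _, .zero _ _ _⟩
  add_mem' := fun {f g} hf hg => ⟨hf.smooth_mid.add hg.smooth_mid, hf.smooth.add hg.smooth,
    hf.cont.add hg.cont, fun x hx => by simp [hf.zero_off x hx, hg.zero_off x hx],
    .add hf.cd0 hg.cd0 hf.bdd0 hg.bdd0, .add hf.cd1 hg.cd1 hf.bdd1 hg.bdd1,
    .add hf.cd2 hg.cd2 hf.bdd2 hg.bdd2, .add hf.cd3 hg.cd3 hf.bdd3 hg.bdd3⟩
  smul_mem' := fun a f hf => ⟨hf.smooth_mid.const_smul a, hf.smooth.const_smul a,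
    hf.cont.const_smul a, fun x hx => by simp [hf.zero_off x hx],
    hf.bdd0.smul a, hf.bdd1.smul a, hf.bdd2.smul a, hf.bdd3.smul a⟩

/-- `M₂(ε)` as a vector space of functions. -/
def M2Sub (ε : ℝ) : Submodule ℝ (ℝ → ℝ) where
  carrier := {f | MemM2 ε f}
  zero_mem' := ⟨contDiffOn_const, fun _ _ => rfl, .zero _ _ _, .zero _ _ _, .zero _ _ _⟩
  add_mem' := fun {f g} hf hg => ⟨hf.smooth.add hg.smooth,
    fun x hx => by simp [hf.zero_off x hx, hg.zero_off x hx],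
    .add (hf.cd (by norm_num)) (hg.cd (by norm_num)) hf.bdd0 hg.bdd0,
    .add (hf.cd (by norm_num)) (hg.cd (by norm_num)) hf.bdd1 hg.bdd1,
    .add (hf.cd le_rfl) (hg.cd le_rfl) hf.bdd2 hg.bdd2⟩
  smul_mem' := fun a f hf => ⟨hf.smooth.const_smul a, fun x hx => by simp [hf.zero_off x hx],
    hf.bdd0.smul a, hf.bdd1.smul a, hf.bdd2.smul a⟩

/-- The space `M₁(ε)`, a type of its own so that its only topology is that of its norm. -/
def M1 (ε : ℝ) : Type := M1Sub ε

/-- The space `M₂(ε)`, a type of its own so that its only topology is that of its norm. -/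
def M2 (ε : ℝ) : Type := M2Sub ε

instance (ε : ℝ) : AddCommGroup (M1 ε) := inferInstanceAs (AddCommGroup (M1Sub ε))
instance (ε : ℝ) : Module ℝ (M1 ε) := inferInstanceAs (Module ℝ (M1Sub ε))
instance (ε : ℝ) : AddCommGroup (M2 ε) := inferInstanceAs (AddCommGroup (M2Sub ε))
instance (ε : ℝ) : Module ℝ (M2 ε) := inferInstanceAs (Module ℝ (M2Sub ε))

/-- The function underlying an element of `M₁(ε)`. -/
def M1.fn {ε : ℝ} (f : M1 ε) : ℝ → ℝ := f.1

/-- The function underlying an element of `M₂(ε)`. -/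
def M2.fn {ε : ℝ} (f : M2 ε) : ℝ → ℝ := f.1

lemma M1.mem {ε : ℝ} (f : M1 ε) : MemM1 ε f.fn := f.2
lemma M2.mem {ε : ℝ} (f : M2 ε) : MemM2 ε f.fn := f.2
lemma M1.fn_add {ε : ℝ} (f g : M1 ε) : (f + g).fn = f.fn + g.fn := rfl
lemma M2.fn_add {ε : ℝ} (f g : M2 ε) : (f + g).fn = f.fn + g.fn := rfl
lemma M1.fn_smul {ε : ℝ} (a : ℝ) (f : M1 ε) : (a • f).fn = a • f.fn := rfl
lemma M2.fn_smul {ε : ℝ} (a : ℝ) (f : M2 ε) : (a • f).fn = a • f.fn := rfl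

instance (ε : ℝ) : Norm (M1 ε) where
  norm f := wnorm I1 (wt (-1 + 2 * ε)) 0 f.fn + wnorm I1 (wt (2 * ε)) 1 f.fn
    + wnorm Ih wt1 2 f.fn + wnorm Ih wt1 3 f.fn

instance (ε : ℝ) : Norm (M2 ε) where
  norm f := wnorm I1 (wt ε) 0 f.fn + wnorm I1 (wt (1 + ε)) 1 f.fn + wnorm I1 (wt (2 + ε)) 2 f.fn

lemma M1.norm_def {ε : ℝ} (f : M1 ε) : ‖f‖ = wnorm I1 (wt (-1 + 2 * ε)) 0 f.fn
    + wnorm I1 (wt (2 * ε)) 1 f.fn + wnorm Ih wt1 2 f.fn + wnorm Ih wt1 3 f.fn := rfl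

lemma M2.norm_def {ε : ℝ} (f : M2 ε) : ‖f‖ = wnorm I1 (wt ε) 0 f.fn
    + wnorm I1 (wt (1 + ε)) 1 f.fn + wnorm I1 (wt (2 + ε)) 2 f.fn := rfl

lemma eq_zero_of_wnorm {r : ℝ} {f : ℝ → ℝ} (hb : WBdd I1 (wt r) 0 f)
    (h0 : ∀ x, x ∉ I1 → f x = 0) (h : wnorm I1 (wt r) 0 f = 0) : f = 0 := by
  funext x
  by_cases hx : x ∈ I1
  · have h1 := hb.le hx
    rw [h] at h1
    have h2 : wt r x * iteratedDeriv 0 f x = 0 := abs_nonpos_iff.1 h1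
    rw [iteratedDeriv_zero] at h2
    have h3 : 0 < 1 - x ^ 2 := by nlinarith [hx.1, hx.2]
    exact (mul_eq_zero.1 h2).resolve_left (Real.rpow_pos_of_pos h3 r).ne'
  · exact h0 x hx

lemma M1.core (ε : ℝ) : NormedSpace.Core ℝ (M1 ε) where
  norm_nonneg f := by
    rw [M1.norm_def]
    have := wnorm_nonneg I1 (wt (-1 + 2 * ε)) 0 f.fn
    have := wnorm_nonneg I1 (wt (2 * ε)) 1 f.fn
    have := wnorm_nonneg Ih wt1 2 f.fn
    have := wnorm_nonneg Ih wt1 3 f.fn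
    positivity
  norm_smul a f := by
    simp only [M1.norm_def, M1.fn_smul, wnorm_smul, Real.norm_eq_abs]
    ring
  norm_triangle f g := by
    simp only [M1.norm_def, M1.fn_add]
    have hf := f.mem
    have hg := g.mem
    have := wnorm_add_le hf.cd0 hg.cd0 hf.bdd0 hg.bdd0
    have := wnorm_add_le hf.cd1 hg.cd1 hf.bdd1 hg.bdd1
    have := wnorm_add_le hf.cd2 hg.cd2 hf.bdd2 hg.bdd2
    have := wnorm_add_le hf.cd3 hg.cd3 hf.bdd3 hg.bdd3
    linarith
  norm_eq_zero_iff f := by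
    constructor
    · intro h
      rw [M1.norm_def] at h
      have h0 := wnorm_nonneg I1 (wt (-1 + 2 * ε)) 0 f.fn
      have := wnorm_nonneg I1 (wt (2 * ε)) 1 f.fn
      have := wnorm_nonneg Ih wt1 2 f.fn
      have := wnorm_nonneg Ih wt1 3 f.fn
      have h1 : f.fn = 0 := eq_zero_of_wnorm f.mem.bdd0 f.mem.zero_off (by linarith)
      exact Subtype.ext h1
    · rintro rfl
      have h : (0 : M1 ε).fn = (0 : ℝ) • (0 : ℝ → ℝ) := by simp; rfl
      simp only [M1.norm_def, h, wnorm_smul, abs_zero, zero_mul, add_zero]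

lemma M2.core (ε : ℝ) : NormedSpace.Core ℝ (M2 ε) where
  norm_nonneg f := by
    rw [M2.norm_def]
    have := wnorm_nonneg I1 (wt ε) 0 f.fn
    have := wnorm_nonneg I1 (wt (1 + ε)) 1 f.fn
    have := wnorm_nonneg I1 (wt (2 + ε)) 2 f.fn
    positivity
  norm_smul a f := by
    simp only [M2.norm_def, M2.fn_smul, wnorm_smul, Real.norm_eq_abs]
    ring
  norm_triangle f g := by
    simp only [M2.norm_def, M2.fn_add]
    have hf := f.mem
    have hg := g.mem
    have := wnorm_add_le (hf.cd (Nat.zero_le 2)) (hg.cd (Nat.zero_le 2)) hf.bdd0 hg.bdd0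
    have := wnorm_add_le (hf.cd one_le_two) (hg.cd one_le_two) hf.bdd1 hg.bdd1
    have := wnorm_add_le (hf.cd le_rfl) (hg.cd le_rfl) hf.bdd2 hg.bdd2
    linarith
  norm_eq_zero_iff f := by
    constructor
    · intro h
      rw [M2.norm_def] at h
      have h0 := wnorm_nonneg I1 (wt ε) 0 f.fn
      have := wnorm_nonneg I1 (wt (1 + ε)) 1 f.fn
      have := wnorm_nonneg I1 (wt (2 + ε)) 2 f.fn
      have h1 : f.fn = 0 := eq_zero_of_wnorm f.mem.bdd0 f.mem.zero_off (by linarith)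
      exact Subtype.ext h1
    · rintro rfl
      have h : (0 : M2 ε).fn = (0 : ℝ) • (0 : ℝ → ℝ) := by simp; rfl
      simp only [M2.norm_def, h, wnorm_smul, abs_zero, zero_mul, add_zero]

instance (ε : ℝ) : NormedAddCommGroup (M1 ε) := NormedAddCommGroup.ofCore (M1.core ε)
instance (ε : ℝ) : NormedSpace ℝ (M1 ε) := NormedSpace.ofCore (M1.core ε)
instance (ε : ℝ) : NormedAddCommGroup (M2 ε) := NormedAddCommGroup.ofCore (M2.core ε)
instance (ε : ℝ) : NormedSpace ℝ (M2 ε) := NormedSpace.ofCore (M2.core ε)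

/-- The space `X = M₁(ε) × M₂(ε)` with the norm `‖W_θ‖ + ‖W_φ‖`. -/
abbrev X (ε : ℝ) : Type := WithLp 1 (M1 ε × M2 ε)

/-- The functional `l₃(W) = W_φ'(0)`. -/
def l3 (ε : ℝ) : X ε →ₗ[ℝ] ℝ where
  toFun W := deriv W.snd.fn 0
  map_add' W W' := by
    have h0 : (0 : ℝ) ∈ I1 := by norm_num
    have h1 := (W.snd.mem.cd one_le_two 0 h0).differentiableAt (by norm_num)
    have h2 := (W'.snd.mem.cd one_le_two 0 h0).differentiableAt (by norm_num)
    exact deriv_add h1 h2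
  map_smul' a W := by
    have h0 : (0 : ℝ) ∈ I1 := by norm_num
    have h1 := (W.snd.mem.cd one_le_two 0 h0).differentiableAt (by norm_num)
    exact deriv_const_smul a h1

/-- The functional `l₄(W) = W_φ(0)`. -/
def l4 (ε : ℝ) : X ε →ₗ[ℝ] ℝ where
  toFun W := W.snd.fn 0
  map_add' _ _ := rfl
  map_smul' _ _ := rfl

/-- The subspace `X₃ = ker l₃ ∩ ker l₄` of `X`. -/
def X3 (ε : ℝ) : Submodule ℝ (X ε) := LinearMap.ker (l3 ε) ⊓ LinearMap.ker (l4 ε)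

/-! ### The equations -/

/-- A pair `U = (U_θ, U_φ)` of real functions; only the values on `(-1, 1)` matter. -/
abbrev Pair : Type := (ℝ → ℝ) × (ℝ → ℝ)

/-- The pair of functions underlying an element of `X`. -/
def toPair {ε : ℝ} (W : X ε) : Pair := (W.fst.fn, W.snd.fn)

/-- Equality of pairs of functions on `(-1, 1)`. -/
def Agree (U U' : Pair) : Prop := EqOn U.1 U'.1 I1 ∧ EqOn U.2 U'.2 I1

/-- `P_c(x) = c₁(1 - x) + c₂(1 + x) + c₃(1 - x²)`. The components `c₁, c₂, c₃` of `c` are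
`c 0, c 1, c 2`. -/
def P (c : Fin 3 → ℝ) (x : ℝ) : ℝ := c 0 * (1 - x) + c 1 * (1 + x) + c 2 * (1 - x ^ 2)

/-- `ψ[u](x) = ∫₀ˣ ∫₀ˡ ∫₀ᵗ 2 u(s) u'(s) / (1 - s²) ds dt dl`. -/
def psi (u : ℝ → ℝ) (x : ℝ) : ℝ :=
  ∫ l in (0 : ℝ)..x, ∫ t in (0 : ℝ)..l, ∫ s in (0 : ℝ)..t, 2 * u s * deriv u s / (1 - s ^ 2)

/-- `U = (U_θ, U_φ)` is a classical solution on `(-1, 1)`, with constants `ĉ`, of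
`(1 - x²) U_θ' + 2x U_θ + U_θ² / 2 + ψ[U_φ] = P_ĉ`, `(1 - x²) U_φ'' + U_θ U_φ' = 0`. -/
structure SolvesNSE (U : Pair) (chat : Fin 3 → ℝ) : Prop where
  smooth_theta : ContDiffOn ℝ 1 U.1 I1
  smooth_phi : ContDiffOn ℝ 2 U.2 I1
  eq_theta : ∀ x ∈ I1,
    (1 - x ^ 2) * deriv U.1 x + 2 * x * U.1 x + (1 / 2) * U.1 x ^ 2 + psi U.2 x = P chat x
  eq_phi : ∀ x ∈ I1, (1 - x ^ 2) * iteratedDeriv 2 U.2 x + U.1 x * deriv U.2 x = 0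

/-! ### The axisymmetric no-swirl solutions -/

/-- A parameter `(c, γ)`, an element of `ℝ³ × ℝ`. -/
abbrev Param : Type := (Fin 3 → ℝ) × ℝ

/-- `u` is a solution on `(-1, 1)` of `(1 - x²) u' + 2x u + u² / 2 = P_c`. -/
structure IsNoSwirl (c : Fin 3 → ℝ) (u : ℝ → ℝ) : Prop where
  smooth : ContDiffOn ℝ 1 u I1
  eq : ∀ x ∈ I1, (1 - x ^ 2) * deriv u x + 2 * x * u x + (1 / 2) * u x ^ 2 = P c x

/-- `γ⁺(c)`, the largest value at `0` of a no-swirl solution with constants `c`. -/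
def gammaPlus (c : Fin 3 → ℝ) : ℝ := sSup {γ | ∃ u, IsNoSwirl c u ∧ u 0 = γ}

open Classical in
/-- `U_θ^{c,γ}`, the no-swirl solution with constants `c` whose value at `0` is `γ` (it is unique on
`(-1, 1)`, and only its values there are used; the value is `0` if there is no such solution). -/
def Ubar (p : Param) : ℝ → ℝ :=
  if h : ∃ u, IsNoSwirl p.1 u ∧ u 0 = p.2 then h.choose else 0

/-- `U^{c,γ} = (U_θ^{c,γ}, 0)`. -/
def Ucg (p : Param) : Pair := (Ubar p, 0)

/-- The boundary value `U_θ^{c,γ}(-1)`. -/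
def UbarLeft (p : Param) : ℝ := limUnder (𝓝[>] (-1 : ℝ)) (Ubar p)

/-- The boundary value `U_θ^{c,γ}(1)`. -/
def UbarRight (p : Param) : ℝ := limUnder (𝓝[<] (1 : ℝ)) (Ubar p)

/-- `c̄₃(c₁, c₂)`. -/
def c3bar (c₁ c₂ : ℝ) : ℝ :=
  -(1 / 2) * (√(1 + c₁) + √(1 + c₂)) * (√(1 + c₁) + √(1 + c₂) + 2)

/-- The parameter sets `J_k` for `5 ≤ k ≤ 8`, on which `c₃ = c̄₃(c₁, c₂)`. -/
def J : ℕ → Set (Fin 3 → ℝ)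
  | 5 => {c | -1 < c 0 ∧ -1 < c 1 ∧ c 2 = c3bar (c 0) (c 1)}
  | 6 => {c | c 0 = -1 ∧ -1 < c 1 ∧ c 2 = c3bar (c 0) (c 1)}
  | 7 => {c | -1 < c 0 ∧ c 1 = -1 ∧ c 2 = c3bar (c 0) (c 1)}
  | 8 => {c | c 0 = -1 ∧ c 1 = -1 ∧ c 2 = c3bar (c 0) (c 1)}
  | _ => ∅

/-- The parameter set `I_{k,1} = I_{k,2} = I_{k,3}` for `5 ≤ k ≤ 8`. -/
def Ik (k : ℕ) : Set Param :=
  {p | p.1 ∈ J k ∧ p.2 = gammaPlus p.1 ∧ p.1 0 < -(3 / 4) ∧ p.1 1 < -(3 / 4)}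

/-- The condition on the weight exponent `ε` of the spaces, for all parameters in `K`. -/
structure Admissible (K : Set Param) (ε : ℝ) : Prop where
  pos : 0 < ε
  lt_half : ε < 1 / 2
  left_lt : ∀ p ∈ K, UbarLeft p < 2 → UbarLeft p / 4 < ε
  left_ge : ∀ p ∈ K, 2 ≤ UbarLeft p → UbarLeft p / 2 - 1 < ε
  right_gt : ∀ p ∈ K, -2 < UbarRight p → -UbarRight p / 4 < ε
  right_le : ∀ p ∈ K, UbarRight p ≤ -2 → -UbarRight p / 2 - 1 < ε

/-! ### The ansatz -/

/-- `b_{c,γ}(x) = ∫₀ˣ U_θ^{c,γ}(s) / (1 - s²) ds`. -/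
def b (p : Param) (x : ℝ) : ℝ := ∫ s in (0 : ℝ)..x, Ubar p s / (1 - s ^ 2)

/-- `V³_{c,γ} = (0, ∫₀ˣ e^{-b_{c,γ}(t)} dt)`. -/
def V3 (p : Param) : Pair := (0, fun x => ∫ t in (0 : ℝ)..x, Real.exp (-b p t))

/-- `V⁴_{c,γ} = (0, 1)`. -/
def V4 : Pair := (0, 1)

/-- The parameter space of `β = (β₃, β₄)`, whose components are `β 0, β 1`. -/
abbrev Beta : Type := EuclideanSpace ℝ (Fin 2)

/-- `U^{c,γ} + β₃ V³_{c,γ} + β₄ V⁴_{c,γ} + W`. -/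
def ansatz {ε : ℝ} (p : Param) (β : Beta) (W : X ε) : Pair :=
  Ucg p + β 0 • V3 p + β 1 • V4 + toPair W

/-- `φ_{c,γ}[u](x) = (1 - x²) u' + (2x + U_θ^{c,γ}) u + u² / 2`. -/
def phi (p : Param) (u : ℝ → ℝ) (x : ℝ) : ℝ :=
  (1 - x ^ 2) * deriv u x + (2 * x + Ubar p x) * u x + (1 / 2) * u x ^ 2

/-- The constants `ĉ` attached to the deviation `U - U^{c,γ} = (w_θ, w_φ)`:
`ĉ₁ = c₁ + ψ[w_φ](-1) / 2`, `ĉ₂ = c₂ + ψ[w_φ](1) / 2`, `ĉ₃ = c₃ - φ_{c,γ}[w_θ]''(0) / 2`. -/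
def cHat (p : Param) (w : Pair) : Fin 3 → ℝ :=
  ![p.1 0 + (1 / 2) * psi w.2 (-1), p.1 1 + (1 / 2) * psi w.2 1,
    p.1 2 - (1 / 2) * iteratedDeriv 2 (phi p w.1) 0]

end HomNS

end

/-! On the sets `J_k` the extremal no-swirl solution is affine,
`U_θ^{c,γ} = q₁ (1 - x) - q₂ (1 + x)` with `q₁, q₂ ≥ 1`, and the linearized equations at it are
integrated by the Jacobi weights `(1 + x)^{±q₁} (1 - x)^{±q₂}`. The constants `ĉ₁, ĉ₂` are
determined by the boundary values at `±1`, where every other term of the `θ`-equation tends to `0`;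
modulo the multiples of `1 - x²`, which are absorbed by `ĉ₃`, the linearized `θ`-equation then has
exactly one solution in `M1`. The linearized `φ`-equation is solvable in `M2`, with kernel spanned
by `V³` and `V⁴`, so that the solution is determined by `G'(0) = β₃` and `G(0) = β₄`. Inverting the
linear part, the equations for the deviation `z` from the no-swirl solution become a fixed point
equation `z = N(q, β, z)`, with `N` quadratic and bounded. The implicit function theorem gives near
every parameter a unique branch of small solutions, smooth in `(q, β)`, and by compactness these
branches glue. Subtracting the linear part `β₃ V³ + β₄ V⁴` from the branch leaves `V`. Here `q` is
a smooth function of `(c₃, γ)`, also across `c₁ = -1` and `c₂ = -1`. -/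

noncomputable section

namespace HomNS

/-! ### Solution branches near a compact set -/

section Branch

variable {E Z : Type*} [NormedAddCommGroup E] [NormedSpace ℝ E] [NormedAddCommGroup Z]
  [NormedSpace ℝ Z]

/-- The smooth map `v` parametrizes over `U` the solutions `z` of norm less than `r` of a family of
equations `Sol e z`; over every `e ∈ U` there is exactly one. -/
structure IsBranchOn (Sol : E → Z → Prop) (r : ℝ) (U : Set E) (v : E → Z) : Prop where
  isOpen : IsOpen U
  contDiffOn : ContDiffOn ℝ ∞ v U
  norm_lt : ∀ e ∈ U, ‖v e‖ < r
  sol_iff : ∀ e ∈ U, ∀ z, ‖z‖ < r → (Sol e z ↔ z = v e)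

namespace IsBranchOn

variable {Sol : E → Z → Prop} {r r' : ℝ} {U U' : Set E} {v v' : E → Z}

lemma sol (h : IsBranchOn Sol r U v) {e : E} (he : e ∈ U) : Sol e (v e) :=
  (h.sol_iff e he _ (h.norm_lt e he)).2 rfl

lemma eq_zero (h : IsBranchOn Sol r U v) {e : E} (he : e ∈ U) (h0 : Sol e 0) : v e = 0 :=
  ((h.sol_iff e he 0 (by simpa only [norm_zero] using (norm_nonneg _).trans_lt (h.norm_lt e he))).1
    h0).symm

lemma mono (h : IsBranchOn Sol r U v) (hU' : IsOpen U') (hUU' : U' ⊆ U) :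
    IsBranchOn Sol r U' v where
  isOpen := hU'
  contDiffOn := h.contDiffOn.mono hUU'
  norm_lt e he := h.norm_lt e (hUU' he)
  sol_iff e he := h.sol_iff e (hUU' he)

lemma hasFDerivAt (h : IsBranchOn Sol r U v) {N : E × Z → Z} (hN : ∀ e z, Sol e z ↔ z = N (e, z))
    {s : E} (hs : s ∈ U) {D : E →L[ℝ] Z} (hD : HasFDerivAt N (D ∘L .fst ℝ E Z) (s, v s)) :
    HasFDerivAt v D s := by
  have hU := h.isOpen.mem_nhds hs
  have hv := ((h.contDiffOn.contDiffAt hU).differentiableAt (by simp)).hasFDerivAt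
  have hcomp : HasFDerivAt (fun e => N (e, v e)) D s :=
    (hD.comp s ((hasFDerivAt_id s).prodMk hv)).congr_fderiv (by ext; simp)
  exact hcomp.congr_of_eventuallyEq
    (eventuallyEq_of_mem hU fun e he => (hN e (v e)).1 (h.sol he))

lemma restrict (h : IsBranchOn Sol r U v) (hr : r' ≤ r) :
    IsBranchOn Sol r' {e ∈ U | ‖v e‖ < r'} v where
  isOpen := h.contDiffOn.continuousOn.norm.isOpen_inter_preimage h.isOpen isOpen_Iio
  contDiffOn := h.contDiffOn.mono fun _ he => he.1
  norm_lt _ he := he.2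
  sol_iff e he z hz := h.sol_iff e he.1 z (hz.trans_le hr)

open Classical in
lemma union (h : IsBranchOn Sol r U v) (h' : IsBranchOn Sol r U' v') :
    IsBranchOn Sol r (U ∪ U') (U.piecewise v v') := by
  have hU' : EqOn (U.piecewise v v') v' U' := fun e he' => by
    by_cases he : e ∈ U
    · rw [piecewise_eq_of_mem _ _ _ he]
      exact (h'.sol_iff e he' _ (h.norm_lt e he)).1 (h.sol he)
    · exact piecewise_eq_of_notMem _ _ _ he
  have hcases : ∀ e ∈ U ∪ U', ∃ A a, e ∈ A ∧ IsBranchOn Sol r A a ∧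
      EqOn (U.piecewise v v') a A := by
    rintro e (he | he)
    exacts [⟨U, v, he, h, piecewise_eqOn _ _ _⟩, ⟨U', v', he, h', hU'⟩]
  refine ⟨h.isOpen.union h'.isOpen, fun e he => ?_, fun e he => ?_, fun e he z hz => ?_⟩ <;>
    obtain ⟨A, a, heA, ha, heq⟩ := hcases e he
  · have hA := ha.isOpen.mem_nhds heA
    exact ((ha.contDiffOn.contDiffAt hA).congr_of_eventuallyEq
      (eventuallyEq_of_mem hA heq)).contDiffWithinAt
  · rw [heq heA]
    exact ha.norm_lt e heA
  · rw [heq heA]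
    exact ha.sol_iff e heA z hz

end IsBranchOn

/-- Local branches through the zero solution glue: by uniqueness they agree on overlaps once their
radii have been made equal. -/
lemma exists_isBranchOn_of_isCompact {S : Set E} (hS : IsCompact S) {Sol : E → Z → Prop}
    (h0 : ∀ s ∈ S, Sol s 0)
    (hloc : ∀ s ∈ S, ∃ r > 0, ∃ U v, s ∈ U ∧ IsBranchOn Sol r U v) :
    ∃ r > 0, ∃ O v, S ⊆ O ∧ IsBranchOn Sol r O v := by
  suffices ∃ r > 0, ∃ O v, S ∩ S ⊆ O ∧ IsBranchOn Sol r O v by rwa [inter_self] at this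
  refine hS.induction_on (p := fun t => ∃ r > 0, ∃ O v, S ∩ t ⊆ O ∧ IsBranchOn Sol r O v)
    ⟨1, one_pos, ∅, 0, by simp, isOpen_empty, contDiffOn_const, by simp, by simp⟩ ?_ ?_ ?_
  · rintro t t' htt' ⟨r, hr, O, v, htO, hv⟩
    exact ⟨r, hr, O, v, (inter_subset_inter_right S htt').trans htO, hv⟩
  · rintro t t' ⟨r, hr, O, v, htO, hv⟩ ⟨r', hr', O', v', htO', hv'⟩
    have hmin : 0 < min r r' := lt_min hr hr'
    refine ⟨_, hmin, _, _, ?_,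
      (hv.restrict (min_le_left r r')).union (hv'.restrict (min_le_right r r'))⟩
    rintro e ⟨heS, het | het⟩
    · refine Or.inl ⟨htO ⟨heS, het⟩, ?_⟩
      rwa [hv.eq_zero (htO ⟨heS, het⟩) (h0 e heS), norm_zero]
    · refine Or.inr ⟨htO' ⟨heS, het⟩, ?_⟩
      rwa [hv'.eq_zero (htO' ⟨heS, het⟩) (h0 e heS), norm_zero]
  · intro s hs
    obtain ⟨r, hr, U, v, hsU, hv⟩ := hloc s hs
    exact ⟨U, mem_nhdsWithin_of_mem_nhds (hv.isOpen.mem_nhds hsU), r, hr, U, v,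
      inter_subset_right, hv⟩

/-- The implicit function theorem for a fixed point equation `z = N (e, z)`. -/
lemma exists_isBranchOn_fixedPoint [CompleteSpace E] [CompleteSpace Z] {s : E} {N : E × Z → Z}
    (hN : ContDiff ℝ ω N) (h0 : N (s, 0) = 0) (h1 : fderiv ℝ N (s, 0) ∘L .inr ℝ E Z = 0) :
    ∃ r > 0, ∃ U v, s ∈ U ∧ IsBranchOn (fun e z => z = N (e, z)) r U v := by
  set F : E × Z → Z := fun p => p.2 - N p with hF
  have hFs : F (s, 0) = 0 := by simp [hF, h0]
  have hFc : ContDiffAt ℝ ω F (s, 0) := (contDiff_snd.sub hN).contDiffAt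
  have hF' : fderiv ℝ F (s, 0) ∘L .inr ℝ E Z = .id ℝ Z := by
    have : fderiv ℝ F (s, 0) = .snd ℝ E Z - fderiv ℝ N (s, 0) :=
      (hasFDerivAt_snd.sub (hN.differentiable (by simp) (s, 0)).hasFDerivAt).fderiv
    rw [this, ContinuousLinearMap.sub_comp, h1, sub_zero]
    rfl
  have hinv : (fderiv ℝ F (s, 0) ∘L .inr ℝ E Z).IsInvertible :=
    hF' ▸ ⟨ContinuousLinearEquiv.refl ℝ Z, rfl⟩
  have hω : (ω : ℕ∞ω) ≠ 0 := by simp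
  set v := hFc.implicitFunction hω hinv
  have hvs : v s = 0 := hFc.implicitFunction_apply_self hω hinv
  have hvc : ContDiffAt ℝ ω v s := hFc.contDiffAt_implicitFunction hω hinv
  have hiff := hFc.eventually_apply_eq_iff_implicitFunction hω hinv
  rw [hFs, nhds_prod_eq] at hiff
  obtain ⟨A, hA, B, hB, hAB⟩ := eventually_prod_iff.1 hiff
  obtain ⟨r, hr, hrB⟩ := Metric.eventually_nhds_iff.1 hB
  have hvr : ∀ᶠ e in 𝓝 s, ‖v e‖ < r :=
    hvc.continuousAt.norm.eventually_lt_const (by simpa only [hvs, norm_zero])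
  obtain ⟨U, hU, hUo, hsU⟩ :=
    _root_.eventually_nhds_iff.1 (hA.and ((hvc.eventually (by simp)).and hvr))
  refine ⟨r, hr, U, v, hsU, hUo, fun e he => ?_, fun e he => (hU e he).2.2, fun e he z hz => ?_⟩
  · exact ((hU e he).2.1.of_le le_top).contDiffWithinAt
  · have hz' := hAB (hU e he).1 (hrB (y := z) (by simpa using hz))
    rwa [sub_eq_zero, eq_comm (b := z)] at hz'

end Branch

/-- A bilinear relation that is total, single-valued and bounded is the graph of a continuous
bilinear map. -/
lemma exists_bilinear_of_relation {A B C : Type*} [NormedAddCommGroup A] [NormedSpace ℝ A]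
    [NormedAddCommGroup B] [NormedSpace ℝ B] [NormedAddCommGroup C] [NormedSpace ℝ C]
    (R : A → B → C → Prop) (K : ℝ) (hex : ∀ a b, ∃ c, R a b c ∧ ‖c‖ ≤ K * ‖a‖ * ‖b‖)
    (huniq : ∀ {a b c c'}, R a b c → R a b c' → c = c')
    (hadd₁ : ∀ {a a' b c c'}, R a b c → R a' b c' → R (a + a') b (c + c'))
    (hsmul₁ : ∀ (t : ℝ) {a b c}, R a b c → R (t • a) b (t • c))
    (hadd₂ : ∀ {a b b' c c'}, R a b c → R a b' c' → R a (b + b') (c + c'))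
    (hsmul₂ : ∀ (t : ℝ) {a b c}, R a b c → R a (t • b) (t • c)) :
    ∃ T : A →L[ℝ] B →L[ℝ] C, ∀ a b c, R a b c ↔ c = T a b := by
  choose f hf hb using hex
  refine ⟨LinearMap.mkContinuous₂ (LinearMap.mk₂ ℝ f
    (fun a a' b => huniq (hf _ _) (hadd₁ (hf a b) (hf a' b)))
    (fun t a b => huniq (hf _ _) (hsmul₁ t (hf a b)))
    (fun a b b' => huniq (hf _ _) (hadd₂ (hf a b) (hf a b')))
    (fun t a b => huniq (hf _ _) (hsmul₂ t (hf a b)))) K hb, fun a b c => ⟨fun h => ?_, ?_⟩⟩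
  · exact huniq h (hf a b)
  · rintro rfl
    exact hf a b

/-! ### Derivatives on open sets -/

section OpenSets

variable {s : Set ℝ} {f g : ℝ → ℝ} {n k : ℕ}

lemma hasDerivAt_iteratedDeriv (hs : IsOpen s) (hf : ContDiffOn ℝ n f s) (hk : k < n) {x : ℝ}
    (hx : x ∈ s) : HasDerivAt (iteratedDeriv k f) (iteratedDeriv (k + 1) f x) x := by
  rw [iteratedDeriv_succ]
  refine DifferentiableAt.hasDerivAt ?_
  have h1 := (hf.differentiableOn_iteratedDerivWithin (m := k) (by exact_mod_cast hk)
    hs.uniqueDiffOn).differentiableAt (hs.mem_nhds hx)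
  refine h1.congr_of_eventuallyEq ?_
  filter_upwards [hs.mem_nhds hx] with y hy
  exact (iteratedDerivWithin_of_isOpen hs hy).symm

lemma continuousOn_iteratedDeriv (hs : IsOpen s) (hf : ContDiffOn ℝ n f s) (hk : k ≤ n) :
    ContinuousOn (iteratedDeriv k f) s :=
  (hf.continuousOn_iteratedDerivWithin (m := k) (by exact_mod_cast hk) hs.uniqueDiffOn).congr
    fun _ hx => (iteratedDerivWithin_of_isOpen hs hx).symm

lemma contDiffOn_succ_of_hasDerivAt (hs : IsOpen s) (h : ∀ x ∈ s, HasDerivAt f (g x) x)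
    (hg : ContDiffOn ℝ n g s) : ContDiffOn ℝ (n + 1 : ℕ) f s := by
  push_cast
  rw [contDiffOn_succ_iff_deriv_of_isOpen hs]
  exact ⟨fun x hx => (h x hx).differentiableAt.differentiableWithinAt, by simp,
    hg.congr fun x hx => (h x hx).deriv⟩

lemma iteratedDeriv_eqOn (hs : IsOpen s) (h : EqOn f g s) :
    EqOn (iteratedDeriv n f) (iteratedDeriv n g) s := fun _ hx =>
  Filter.EventuallyEq.iteratedDeriv_eq n (eventuallyEq_of_mem (hs.mem_nhds hx) h)

lemma iteratedDeriv_succ_eqOn {l : ℝ → ℝ} (hs : IsOpen s) (h : ∀ x ∈ s, HasDerivAt f (g x) x)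
    (hg : EqOn (iteratedDeriv n g) l s) : EqOn (iteratedDeriv (n + 1) f) l s := by
  rw [iteratedDeriv_succ']
  exact (iteratedDeriv_eqOn hs fun x hx => (h x hx).deriv).trans hg

end OpenSets

lemma isOpen_I1 : IsOpen I1 := isOpen_Ioo
lemma isOpen_Ih : IsOpen Ih := isOpen_Ioo
lemma zero_mem_I1 : (0 : ℝ) ∈ I1 := by norm_num
lemma zero_mem_Ih : (0 : ℝ) ∈ Ih := by norm_num
lemma Ih_subset_I1 : Ih ⊆ I1 := Ioo_subset_Ioo (by norm_num) (by norm_num)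

/-! ### Power weights -/

/-- The Jacobi weight `(1 + x)ˢ (1 - x)ʳ`, with independent exponents at the two endpoints. -/
def jacobi (s r : ℝ) (x : ℝ) : ℝ := (1 + x) ^ s * (1 - x) ^ r

section Weights

variable {x : ℝ}

lemma one_add_pos (hx : x ∈ I1) : 0 < 1 + x := by linarith [hx.1]
lemma one_sub_pos (hx : x ∈ I1) : 0 < 1 - x := by linarith [hx.2]
lemma one_sub_sq_pos (hx : x ∈ I1) : 0 < 1 - x ^ 2 := by nlinarith [hx.1, hx.2]

lemma jacobi_pos (s r : ℝ) (hx : x ∈ I1) : 0 < jacobi s r x :=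
  mul_pos (Real.rpow_pos_of_pos (one_add_pos hx) _) (Real.rpow_pos_of_pos (one_sub_pos hx) _)

lemma jacobi_add (s r s' r' : ℝ) (hx : x ∈ I1) :
    jacobi (s + s') (r + r') x = jacobi s r x * jacobi s' r' x := by
  unfold jacobi
  rw [Real.rpow_add (one_add_pos hx), Real.rpow_add (one_sub_pos hx)]
  ring

lemma jacobi_zero (x : ℝ) : jacobi 0 0 x = 1 := by simp [jacobi]

lemma jacobi_one (x : ℝ) : jacobi 1 1 x = 1 - x ^ 2 := by simp [jacobi]; ring

lemma jacobi_neg (s r : ℝ) (hx : x ∈ I1) : jacobi (-s) (-r) x = (jacobi s r x)⁻¹ := by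
  have := jacobi_add s r (-s) (-r) hx
  rw [add_neg_cancel, add_neg_cancel, jacobi_zero] at this
  exact eq_inv_of_mul_eq_one_right this.symm

lemma wt_eq_jacobi (r : ℝ) (hx : x ∈ I1) : wt r x = jacobi r r x := by
  have : 1 - x ^ 2 = (1 + x) * (1 - x) := by ring
  simp only [wt, jacobi]
  rw [this, Real.mul_rpow (one_add_pos hx).le (one_sub_pos hx).le]

lemma jacobi_reflect (s r : ℝ) (x : ℝ) : jacobi s r (-x) = jacobi r s x := by
  simp only [jacobi, sub_neg_eq_add, ← sub_eq_add_neg]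
  ring

lemma continuousOn_jacobi (s r : ℝ) : ContinuousOn (jacobi s r) I1 := by
  unfold jacobi
  refine ContinuousOn.mul ?_ ?_
  · exact ContinuousOn.rpow_const (by fun_prop) fun x hx => Or.inl (one_add_pos hx).ne'
  · exact ContinuousOn.rpow_const (by fun_prop) fun x hx => Or.inl (one_sub_pos hx).ne'

lemma hasDerivAt_jacobi (s r : ℝ) (hx : x ∈ I1) :
    HasDerivAt (jacobi s r) ((s * (1 - x) - r * (1 + x)) * jacobi (s - 1) (r - 1) x) x := by
  have h1 : HasDerivAt (fun y : ℝ => (1 + y) ^ s) (1 * s * (1 + x) ^ (s - 1)) x :=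
    ((hasDerivAt_id' x).const_add 1).rpow_const (Or.inl (one_add_pos hx).ne')
  have h2 : HasDerivAt (fun y : ℝ => (1 - y) ^ r) (-1 * r * (1 - x) ^ (r - 1)) x :=
    ((hasDerivAt_id' x).const_sub 1).rpow_const (Or.inl (one_sub_pos hx).ne')
  refine (h1.mul h2).congr_deriv ?_
  have e1 : (1 + x) ^ s = (1 + x) ^ (s - 1) * (1 + x) := by
    rw [← Real.rpow_add_one (one_add_pos hx).ne', sub_add_cancel]
  have e2 : (1 - x) ^ r = (1 - x) ^ (r - 1) * (1 - x) := by
    rw [← Real.rpow_add_one (one_sub_pos hx).ne', sub_add_cancel]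
  rw [e1, e2]
  simp only [jacobi]
  ring

lemma jacobi_le_jacobi {s r s' r' : ℝ} (hs : s' ≤ s) (hr : r' ≤ r) :
    ∃ K : ℝ, 0 < K ∧ ∀ x ∈ I1, jacobi s r x ≤ K * jacobi s' r' x := by
  refine ⟨2 ^ (s - s') * 2 ^ (r - r'), by positivity, fun x hx => ?_⟩
  have h := jacobi_add (s - s') (r - r') s' r' hx
  rw [sub_add_cancel, sub_add_cancel] at h
  rw [h]
  refine mul_le_mul_of_nonneg_right ?_ (jacobi_pos _ _ hx).le
  have := one_add_pos hx
  have := one_sub_pos hx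
  refine mul_le_mul (Real.rpow_le_rpow ?_ ?_ (by linarith)) (Real.rpow_le_rpow ?_ ?_ (by linarith))
    ?_ (by positivity) <;> first | positivity | linarith

end Weights

lemma continuousOn_wt (r : ℝ) : ContinuousOn (wt r) I1 :=
  (continuousOn_jacobi r r).congr fun _ hx => wt_eq_jacobi r hx

lemma wt_pos (r : ℝ) : ∀ x ∈ I1, 0 < wt r x := fun _ hx => by
  rw [wt_eq_jacobi r hx]; exact jacobi_pos r r hx

lemma wt_neg (r : ℝ) {x : ℝ} (hx : x ∈ I1) : wt (-r) x = (wt r x)⁻¹ := by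
  rw [wt_eq_jacobi _ hx, wt_eq_jacobi _ hx, jacobi_neg _ _ hx]

lemma wt_add (r s : ℝ) {x : ℝ} (hx : x ∈ I1) : wt (r + s) x = wt r x * wt s x := by
  rw [wt_eq_jacobi _ hx, wt_eq_jacobi _ hx, wt_eq_jacobi _ hx, jacobi_add _ _ _ _ hx]

lemma wt_one (x : ℝ) : wt 1 x = 1 - x ^ 2 := by simp [wt]

lemma wt_anti {r s : ℝ} (h : s ≤ r) {x : ℝ} (hx : x ∈ I1) : wt r x ≤ wt s x :=
  Real.rpow_le_rpow_of_exponent_ge (one_sub_sq_pos hx) (by nlinarith [sq_nonneg x]) h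

lemma abs_le_mul_wt_neg {r u C x : ℝ} (hx : x ∈ I1) : |wt r x * u| ≤ C ↔ |u| ≤ C * wt (-r) x := by
  rw [abs_mul, abs_of_pos (wt_pos r x hx), wt_neg r hx, ← div_eq_mul_inv,
    le_div_iff₀ (wt_pos r x hx), mul_comm]

lemma wt_mid (r : ℝ) {x : ℝ} (hx : x ∈ Ih) : wt r x ≤ 2 ^ |r| := by
  have h1 : 1 / 2 ≤ 1 - x ^ 2 := by nlinarith [hx.1, hx.2]
  have h2 : 1 - x ^ 2 ≤ 1 := by nlinarith [sq_nonneg x]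
  calc wt r x ≤ (1 - x ^ 2) ^ (-|r|) :=
        Real.rpow_le_rpow_of_exponent_ge (by linarith) h2 (neg_abs_le r)
    _ ≤ (1 / 2) ^ (-|r|) :=
        Real.rpow_le_rpow_of_nonpos (by norm_num) h1 (neg_nonpos.2 (abs_nonneg r))
    _ = 2 ^ |r| := by
        rw [one_div, Real.inv_rpow (by norm_num), Real.rpow_neg (by norm_num), inv_inv]

/-! ### Elements of the spaces -/

lemma WBdd.of_le {s : Set ℝ} {w : ℝ → ℝ} {n : ℕ} {f : ℝ → ℝ} {C : ℝ}
    (h : ∀ x ∈ s, |w x * iteratedDeriv n f x| ≤ C) : WBdd s w n f :=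
  ⟨C, forall_mem_range.2 fun x => h x x.2⟩

lemma wnorm_le {s : Set ℝ} {w : ℝ → ℝ} {n : ℕ} {f : ℝ → ℝ} {C : ℝ} (hC : 0 ≤ C)
    (h : ∀ x ∈ s, |w x * iteratedDeriv n f x| ≤ C) : wnorm s w n f ≤ C :=
  Real.iSup_le (fun x => h x x.2) hC

namespace M2
variable {ε : ℝ}

lemma abs_wt_mul_fn_le (G : M2 ε) {x : ℝ} (hx : x ∈ I1) : |wt ε x * G.fn x| ≤ ‖G‖ := by
  have := G.mem.bdd0.le hx
  rw [iteratedDeriv_zero] at this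
  rw [norm_def]
  linarith [wnorm_nonneg I1 (wt (1 + ε)) 1 G.fn, wnorm_nonneg I1 (wt (2 + ε)) 2 G.fn]

lemma abs_wt_mul_deriv_le (G : M2 ε) {x : ℝ} (hx : x ∈ I1) :
    |wt (1 + ε) x * deriv G.fn x| ≤ ‖G‖ := by
  have := G.mem.bdd1.le hx
  rw [iteratedDeriv_one] at this
  rw [norm_def]
  linarith [wnorm_nonneg I1 (wt ε) 0 G.fn, wnorm_nonneg I1 (wt (2 + ε)) 2 G.fn]

lemma abs_wt_mul_iteratedDeriv_two_le (G : M2 ε) {x : ℝ} (hx : x ∈ I1) :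
    |wt (2 + ε) x * iteratedDeriv 2 G.fn x| ≤ ‖G‖ := by
  have := G.mem.bdd2.le hx
  rw [norm_def]
  linarith [wnorm_nonneg I1 (wt ε) 0 G.fn, wnorm_nonneg I1 (wt (1 + ε)) 1 G.fn]

lemma hasDerivAt (G : M2 ε) {x : ℝ} (hx : x ∈ I1) : HasDerivAt G.fn (deriv G.fn x) x := by
  have := hasDerivAt_iteratedDeriv (n := 2) isOpen_I1 (by exact_mod_cast G.mem.smooth)
    Nat.zero_lt_two hx
  simpa [iteratedDeriv_one] using this

lemma hasDerivAt_deriv (G : M2 ε) {x : ℝ} (hx : x ∈ I1) :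
    HasDerivAt (deriv G.fn) (iteratedDeriv 2 G.fn x) x := by
  have := hasDerivAt_iteratedDeriv (n := 2) isOpen_I1 (by exact_mod_cast G.mem.smooth)
    Nat.one_lt_two hx
  simpa [iteratedDeriv_one] using this

lemma continuousOn_iteratedDeriv_two (G : M2 ε) : ContinuousOn (iteratedDeriv 2 G.fn) I1 :=
  continuousOn_iteratedDeriv (n := 2) isOpen_I1 (by exact_mod_cast G.mem.smooth) le_rfl

lemma continuousOn_deriv (G : M2 ε) : ContinuousOn (deriv G.fn) I1 := fun _ hx =>
  (G.hasDerivAt_deriv hx).continuousAt.continuousWithinAt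

lemma continuousOn (G : M2 ε) : ContinuousOn G.fn I1 := fun _ hx =>
  (G.hasDerivAt hx).continuousAt.continuousWithinAt

lemma ext_on {G H : M2 ε} (h : EqOn G.fn H.fn I1) : G = H := by
  refine Subtype.ext (funext fun x => ?_)
  by_cases hx : x ∈ I1
  · exact h hx
  · exact (G.mem.zero_off x hx).trans (H.mem.zero_off x hx).symm

lemma fn_sub (f g : M2 ε) : (f - g).fn = f.fn - g.fn := rfl

lemma deriv_sub (f g : M2 ε) {x : ℝ} (hx : x ∈ I1) :
    deriv (f - g).fn x = deriv f.fn x - deriv g.fn x :=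
  ((f.hasDerivAt hx).sub (g.hasDerivAt hx)).deriv

lemma iteratedDeriv_two_sub (f g : M2 ε) {x : ℝ} (hx : x ∈ I1) :
    iteratedDeriv 2 (f - g).fn x = iteratedDeriv 2 f.fn x - iteratedDeriv 2 g.fn x := by
  rw [fn_sub, iteratedDeriv_sub (f.mem.cd le_rfl x hx) (g.mem.cd le_rfl x hx)]

lemma norm_le {G : M2 ε} {C₀ C₁ C₂ : ℝ} (b₀ : ∀ x ∈ I1, |wt ε x * G.fn x| ≤ C₀)
    (b₁ : ∀ x ∈ I1, |wt (1 + ε) x * deriv G.fn x| ≤ C₁)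
    (b₂ : ∀ x ∈ I1, |wt (2 + ε) x * iteratedDeriv 2 G.fn x| ≤ C₂) : ‖G‖ ≤ C₀ + C₁ + C₂ :=
  add_le_add_three (wnorm_le ((abs_nonneg _).trans (b₀ 0 zero_mem_I1)) (by simpa using b₀))
    (wnorm_le ((abs_nonneg _).trans (b₁ 0 zero_mem_I1)) (by simpa using b₁))
    (wnorm_le ((abs_nonneg _).trans (b₂ 0 zero_mem_I1)) b₂)

lemma exists_of_hasDerivAt {g₀ g₁ g₂ : ℝ → ℝ} {C₀ C₁ C₂ : ℝ}
    (h₀ : ∀ x ∈ I1, HasDerivAt g₀ (g₁ x) x) (h₁ : ∀ x ∈ I1, HasDerivAt g₁ (g₂ x) x)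
    (h₂ : ContinuousOn g₂ I1) (b₀ : ∀ x ∈ I1, |wt ε x * g₀ x| ≤ C₀)
    (b₁ : ∀ x ∈ I1, |wt (1 + ε) x * g₁ x| ≤ C₁) (b₂ : ∀ x ∈ I1, |wt (2 + ε) x * g₂ x| ≤ C₂) :
    ∃ G : M2 ε, EqOn G.fn g₀ I1 ∧ EqOn (deriv G.fn) g₁ I1 ∧
      EqOn (iteratedDeriv 2 G.fn) g₂ I1 ∧ ‖G‖ ≤ C₀ + C₁ + C₂ := by
  set f : ℝ → ℝ := I1.indicator g₀
  have e₀ : EqOn f g₀ I1 := fun x hx => indicator_of_mem hx _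
  have hf : ∀ x ∈ I1, HasDerivAt f (g₁ x) x := fun x hx =>
    (h₀ x hx).congr_of_eventuallyEq (eventuallyEq_of_mem (isOpen_I1.mem_nhds hx) e₀)
  have e₁ : EqOn (iteratedDeriv 1 f) g₁ I1 :=
    iteratedDeriv_succ_eqOn isOpen_I1 hf (by simp [EqOn])
  have e₂ : EqOn (iteratedDeriv 2 f) g₂ I1 := iteratedDeriv_succ_eqOn isOpen_I1 hf
    (iteratedDeriv_succ_eqOn isOpen_I1 h₁ (by simp [EqOn]))
  have smooth : ContDiffOn ℝ 2 f I1 := by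
    have c₀ : ContDiffOn ℝ (0 : ℕ) g₂ I1 := by exact_mod_cast contDiffOn_zero.2 h₂
    exact_mod_cast contDiffOn_succ_of_hasDerivAt isOpen_I1 hf
      (contDiffOn_succ_of_hasDerivAt isOpen_I1 h₁ c₀)
  have e₁' : EqOn (deriv f) g₁ I1 := by rwa [iteratedDeriv_one] at e₁
  refine ⟨⟨f, smooth, fun x hx => indicator_of_notMem hx _,
    .of_le (C := C₀) fun x hx => ?_, .of_le (C := C₁) fun x hx => ?_,
    .of_le (C := C₂) fun x hx => ?_⟩, e₀, e₁', e₂,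
    norm_le (fun x hx => ?_) (fun x hx => ?_) (fun x hx => ?_)⟩
  · rw [iteratedDeriv_zero, e₀ hx]; exact b₀ x hx
  · rw [e₁ hx]; exact b₁ x hx
  · rw [e₂ hx]; exact b₂ x hx
  · exact (congrArg (|wt ε x * ·|) (e₀ hx)).trans_le (b₀ x hx)
  · exact (congrArg (|wt (1 + ε) x * ·|) (e₁' hx)).trans_le (b₁ x hx)
  · exact (congrArg (|wt (2 + ε) x * ·|) (e₂ hx)).trans_le (b₂ x hx)

end M2

/-- The power bound forces the limit `0` at `±1`. -/
lemma continuousOn_Icc_of_abs_le_wt {f : ℝ → ℝ} {C r : ℝ} (hr : 0 < r) (hf : ContinuousOn f I1)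
    (hoff : ∀ x, x ∉ I1 → f x = 0) (hb : ∀ x ∈ I1, |f x| ≤ C * wt r x) :
    ContinuousOn f (Icc (-1) 1) := by
  have hwt : Continuous (wt r) :=
    Continuous.rpow_const (by fun_prop) fun _ => Or.inr hr.le
  intro x hx
  by_cases hx' : x ∈ I1
  · exact (hf.continuousAt (isOpen_I1.mem_nhds hx')).continuousWithinAt
  have hend : ∀ y ∈ Icc (-1 : ℝ) 1, y ∉ I1 → wt r y = 0 := fun y hy hy' => by
    have : y = -1 ∨ y = 1 := by
      by_contra! h
      exact hy' ⟨hy.1.lt_of_ne' h.1, hy.2.lt_of_ne h.2⟩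
    rcases this with rfl | rfl <;> simp [wt, Real.zero_rpow hr.ne']
  have hb' : ∀ y ∈ Icc (-1 : ℝ) 1, ‖f y‖ ≤ C * wt r y := fun y hy => by
    by_cases hy' : y ∈ I1
    · exact hb y hy'
    · rw [hoff y hy', hend y hy hy', norm_zero, mul_zero]
  have hlim : Tendsto (fun y => C * wt r y) (𝓝[Icc (-1) 1] x) (𝓝 0) := by
    have := (hwt.continuousWithinAt (s := Icc (-1) 1) (x := x)).tendsto.const_mul C
    rwa [hend x hx hx', mul_zero] at this
  rw [ContinuousWithinAt, hoff x hx']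
  exact squeeze_zero_norm' (eventually_mem_nhdsWithin.mono hb') hlim

namespace M1
variable {ε : ℝ}

lemma abs_wt_mul_fn_le (f : M1 ε) {x : ℝ} (hx : x ∈ I1) :
    |wt (-1 + 2 * ε) x * f.fn x| ≤ ‖f‖ := by
  have := f.mem.bdd0.le hx
  rw [iteratedDeriv_zero] at this
  rw [norm_def]
  linarith [wnorm_nonneg I1 (wt (2 * ε)) 1 f.fn, wnorm_nonneg Ih wt1 2 f.fn,
    wnorm_nonneg Ih wt1 3 f.fn]

lemma abs_wt_mul_deriv_le (f : M1 ε) {x : ℝ} (hx : x ∈ I1) :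
    |wt (2 * ε) x * deriv f.fn x| ≤ ‖f‖ := by
  have := f.mem.bdd1.le hx
  rw [iteratedDeriv_one] at this
  rw [norm_def]
  linarith [wnorm_nonneg I1 (wt (-1 + 2 * ε)) 0 f.fn, wnorm_nonneg Ih wt1 2 f.fn,
    wnorm_nonneg Ih wt1 3 f.fn]

lemma abs_iteratedDeriv_two_le (f : M1 ε) {x : ℝ} (hx : x ∈ Ih) :
    |iteratedDeriv 2 f.fn x| ≤ ‖f‖ := by
  have := f.mem.bdd2.le hx
  rw [wt1, one_mul] at this
  rw [norm_def]
  linarith [wnorm_nonneg I1 (wt (-1 + 2 * ε)) 0 f.fn, wnorm_nonneg I1 (wt (2 * ε)) 1 f.fn,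
    wnorm_nonneg Ih wt1 3 f.fn]

lemma abs_iteratedDeriv_three_le (f : M1 ε) {x : ℝ} (hx : x ∈ Ih) :
    |iteratedDeriv 3 f.fn x| ≤ ‖f‖ := by
  have := f.mem.bdd3.le hx
  rw [wt1, one_mul] at this
  rw [norm_def]
  linarith [wnorm_nonneg I1 (wt (-1 + 2 * ε)) 0 f.fn, wnorm_nonneg I1 (wt (2 * ε)) 1 f.fn,
    wnorm_nonneg Ih wt1 2 f.fn]

lemma hasDerivAt (f : M1 ε) {x : ℝ} (hx : x ∈ I1) : HasDerivAt f.fn (deriv f.fn x) x := by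
  have := hasDerivAt_iteratedDeriv (n := 1) isOpen_I1 (by exact_mod_cast f.mem.smooth)
    Nat.zero_lt_one hx
  simpa [iteratedDeriv_one] using this

lemma hasDerivAt_deriv (f : M1 ε) {x : ℝ} (hx : x ∈ Ih) :
    HasDerivAt (deriv f.fn) (iteratedDeriv 2 f.fn x) x := by
  have := hasDerivAt_iteratedDeriv (n := 3) (k := 1) isOpen_Ih
    (by exact_mod_cast f.mem.smooth_mid) (by norm_num) hx
  simpa [iteratedDeriv_one] using this

lemma hasDerivAt_iteratedDeriv_two (f : M1 ε) {x : ℝ} (hx : x ∈ Ih) :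
    HasDerivAt (iteratedDeriv 2 f.fn) (iteratedDeriv 3 f.fn x) x :=
  hasDerivAt_iteratedDeriv (n := 3) (k := 2) isOpen_Ih
    (by exact_mod_cast f.mem.smooth_mid) (by norm_num) hx

lemma continuousOn_iteratedDeriv_three (f : M1 ε) : ContinuousOn (iteratedDeriv 3 f.fn) Ih :=
  continuousOn_iteratedDeriv (n := 3) isOpen_Ih (by exact_mod_cast f.mem.smooth_mid) le_rfl

lemma continuousOn_deriv (f : M1 ε) : ContinuousOn (deriv f.fn) I1 := by
  rw [← iteratedDeriv_one]
  exact continuousOn_iteratedDeriv (n := 1) isOpen_I1 (by exact_mod_cast f.mem.smooth) le_rfl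

lemma continuousOn (f : M1 ε) : ContinuousOn f.fn I1 := fun _ hx =>
  (f.hasDerivAt hx).continuousAt.continuousWithinAt

lemma ext_on {f g : M1 ε} (h : EqOn f.fn g.fn I1) : f = g := by
  refine Subtype.ext (funext fun x => ?_)
  by_cases hx : x ∈ I1
  · exact h hx
  · exact (f.mem.zero_off x hx).trans (g.mem.zero_off x hx).symm

lemma fn_sub (f g : M1 ε) : (f - g).fn = f.fn - g.fn := rfl

lemma deriv_sub (f g : M1 ε) {x : ℝ} (hx : x ∈ I1) :
    deriv (f - g).fn x = deriv f.fn x - deriv g.fn x :=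
  ((f.hasDerivAt hx).sub (g.hasDerivAt hx)).deriv

lemma iteratedDeriv_two_sub (f g : M1 ε) {x : ℝ} (hx : x ∈ Ih) :
    iteratedDeriv 2 (f - g).fn x = iteratedDeriv 2 f.fn x - iteratedDeriv 2 g.fn x := by
  rw [fn_sub, iteratedDeriv_sub (f.mem.cd2 x hx) (g.mem.cd2 x hx)]

lemma iteratedDeriv_three_sub (f g : M1 ε) {x : ℝ} (hx : x ∈ Ih) :
    iteratedDeriv 3 (f - g).fn x = iteratedDeriv 3 f.fn x - iteratedDeriv 3 g.fn x := by
  rw [fn_sub, iteratedDeriv_sub (f.mem.cd3 x hx) (g.mem.cd3 x hx)]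

lemma norm_le {f : M1 ε} {C₀ C₁ C₂ C₃ : ℝ}
    (b₀ : ∀ x ∈ I1, |wt (-1 + 2 * ε) x * f.fn x| ≤ C₀)
    (b₁ : ∀ x ∈ I1, |wt (2 * ε) x * deriv f.fn x| ≤ C₁)
    (b₂ : ∀ x ∈ Ih, |iteratedDeriv 2 f.fn x| ≤ C₂)
    (b₃ : ∀ x ∈ Ih, |iteratedDeriv 3 f.fn x| ≤ C₃) : ‖f‖ ≤ C₀ + C₁ + C₂ + C₃ :=
  add_le_add (add_le_add_three
    (wnorm_le ((abs_nonneg _).trans (b₀ 0 zero_mem_I1)) (by simpa using b₀))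
    (wnorm_le ((abs_nonneg _).trans (b₁ 0 zero_mem_I1)) (by simpa using b₁))
    (wnorm_le ((abs_nonneg _).trans (b₂ 0 zero_mem_Ih)) (by simpa [wt1] using b₂)))
    (wnorm_le ((abs_nonneg _).trans (b₃ 0 zero_mem_Ih)) (by simpa [wt1] using b₃))

lemma exists_fn_eq (hε : ε < 1 / 2) {f : ℝ → ℝ} {C₀ C₁ C₂ C₃ : ℝ} (smooth : ContDiffOn ℝ 1 f I1)
    (smooth_mid : ContDiffOn ℝ 3 f Ih) (zero_off : ∀ x, x ∉ I1 → f x = 0)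
    (b₀ : ∀ x ∈ I1, |wt (-1 + 2 * ε) x * f x| ≤ C₀)
    (b₁ : ∀ x ∈ I1, |wt (2 * ε) x * deriv f x| ≤ C₁)
    (b₂ : ∀ x ∈ Ih, |iteratedDeriv 2 f x| ≤ C₂) (b₃ : ∀ x ∈ Ih, |iteratedDeriv 3 f x| ≤ C₃) :
    ∃ g : M1 ε, g.fn = f ∧ ‖g‖ ≤ C₀ + C₁ + C₂ + C₃ := by
  have cont : ContinuousOn f (Icc (-1) 1) :=
    continuousOn_Icc_of_abs_le_wt (C := C₀) (r := -(-1 + 2 * ε)) (by linarith) smooth.continuousOn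
      zero_off fun x hx => (abs_le_mul_wt_neg hx).1 (b₀ x hx)
  exact ⟨⟨f, smooth_mid, smooth, cont, zero_off,
    .of_le (C := C₀) fun x hx => by rw [iteratedDeriv_zero]; exact b₀ x hx,
    .of_le (C := C₁) fun x hx => by rw [iteratedDeriv_one]; exact b₁ x hx,
    .of_le (C := C₂) fun x hx => by rw [wt1, one_mul]; exact b₂ x hx,
    .of_le (C := C₃) fun x hx => by rw [wt1, one_mul]; exact b₃ x hx⟩, rfl, norm_le b₀ b₁ b₂ b₃⟩

lemma exists_of_hasDerivAt (hε : ε < 1 / 2) {f₀ f₁ f₂ f₃ : ℝ → ℝ} {C₀ C₁ C₂ C₃ : ℝ}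
    (h₀ : ∀ x ∈ I1, HasDerivAt f₀ (f₁ x) x) (h₁ : ContinuousOn f₁ I1)
    (h₂ : ∀ x ∈ Ih, HasDerivAt f₁ (f₂ x) x) (h₃ : ∀ x ∈ Ih, HasDerivAt f₂ (f₃ x) x)
    (h₄ : ContinuousOn f₃ Ih) (b₀ : ∀ x ∈ I1, |wt (-1 + 2 * ε) x * f₀ x| ≤ C₀)
    (b₁ : ∀ x ∈ I1, |wt (2 * ε) x * f₁ x| ≤ C₁) (b₂ : ∀ x ∈ Ih, |f₂ x| ≤ C₂)
    (b₃ : ∀ x ∈ Ih, |f₃ x| ≤ C₃) :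
    ∃ f : M1 ε, EqOn f.fn f₀ I1 ∧ EqOn (deriv f.fn) f₁ I1 ∧
      EqOn (iteratedDeriv 2 f.fn) f₂ Ih ∧ EqOn (iteratedDeriv 3 f.fn) f₃ Ih ∧
      ‖f‖ ≤ C₀ + C₁ + C₂ + C₃ := by
  set f : ℝ → ℝ := I1.indicator f₀
  have e₀ : EqOn f f₀ I1 := fun x hx => indicator_of_mem hx _
  have hf : ∀ x ∈ I1, HasDerivAt f (f₁ x) x := fun x hx =>
    (h₀ x hx).congr_of_eventuallyEq (eventuallyEq_of_mem (isOpen_I1.mem_nhds hx) e₀)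
  have hf' : ∀ x ∈ Ih, HasDerivAt f (f₁ x) x := fun x hx => hf x (Ih_subset_I1 hx)
  have e₁ : EqOn (deriv f) f₁ I1 := fun x hx => (hf x hx).deriv
  have e₂ : EqOn (iteratedDeriv 2 f) f₂ Ih := iteratedDeriv_succ_eqOn isOpen_Ih hf'
    (iteratedDeriv_succ_eqOn isOpen_Ih h₂ (by simp [EqOn]))
  have e₃ : EqOn (iteratedDeriv 3 f) f₃ Ih := iteratedDeriv_succ_eqOn isOpen_Ih hf'
    (iteratedDeriv_succ_eqOn isOpen_Ih h₂ (iteratedDeriv_succ_eqOn isOpen_Ih h₃ (by simp [EqOn])))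
  have smooth : ContDiffOn ℝ 1 f I1 := by
    have c₀ : ContDiffOn ℝ (0 : ℕ) f₁ I1 := by exact_mod_cast contDiffOn_zero.2 h₁
    exact_mod_cast contDiffOn_succ_of_hasDerivAt isOpen_I1 hf c₀
  have smooth_mid : ContDiffOn ℝ 3 f Ih := by
    have c₀ : ContDiffOn ℝ (0 : ℕ) f₃ Ih := by exact_mod_cast contDiffOn_zero.2 h₄
    exact_mod_cast contDiffOn_succ_of_hasDerivAt isOpen_Ih hf'
      (contDiffOn_succ_of_hasDerivAt isOpen_Ih h₂ (contDiffOn_succ_of_hasDerivAt isOpen_Ih h₃ c₀))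
  obtain ⟨g, hg, g_le⟩ := exists_fn_eq hε smooth smooth_mid (fun x hx => indicator_of_notMem hx _)
    (fun x hx => by rw [e₀ hx]; exact b₀ x hx) (fun x hx => by rw [e₁ hx]; exact b₁ x hx)
    (fun x hx => by rw [e₂ hx]; exact b₂ x hx) (fun x hx => by rw [e₃ hx]; exact b₃ x hx)
  exact ⟨g, hg ▸ e₀, hg ▸ e₁, hg ▸ e₂, hg ▸ e₃, g_le⟩

end M1

/-! ### Completeness -/

/-- Uniform convergence on `s` with respect to the weight `w`. -/
def TendstoWeighted (s : Set ℝ) (w : ℝ → ℝ) (u : ℕ → ℝ → ℝ) (g : ℝ → ℝ) : Prop :=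
  ∀ η > 0, ∀ᶠ n in atTop, ∀ x ∈ s, |w x * (u n x - g x)| ≤ η

section WeightedConvergence

variable {s : Set ℝ} {w : ℝ → ℝ} {u : ℕ → ℝ → ℝ} {g : ℝ → ℝ}

lemma TendstoWeighted.tendstoLocallyUniformlyOn (h : TendstoWeighted s w u g)
    (hw : ContinuousOn w s) (hpos : ∀ x ∈ s, 0 < w x) :
    TendstoLocallyUniformlyOn u g atTop s := by
  rw [Metric.tendstoLocallyUniformlyOn_iff]
  intro η hη x hx
  have hwx := hpos x hx
  have hev : ∀ᶠ y in 𝓝[s] x, w x / 2 < w y :=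
    (hw x hx).eventually (eventually_gt_nhds (half_lt_self hwx))
  refine ⟨_, inter_mem hev self_mem_nhdsWithin, ?_⟩
  filter_upwards [h (w x / 2 * (η / 2)) (by positivity)] with n hn y ⟨hwy, hy⟩
  have hle : w x / 2 * |u n y - g y| ≤ w x / 2 * (η / 2) :=
    calc w x / 2 * |u n y - g y| ≤ w y * |u n y - g y| :=
          mul_le_mul_of_nonneg_right (le_of_lt hwy) (abs_nonneg _)
      _ = |w y * (u n y - g y)| := by rw [abs_mul, abs_of_pos (hpos y hy)]
      _ ≤ w x / 2 * (η / 2) := hn y hy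
  rw [dist_comm, Real.dist_eq]
  linarith [le_of_mul_le_mul_left hle (half_pos hwx)]

variable {E : Type*} [NormedAddCommGroup E] {D : E → ℝ → ℝ} {v : ℕ → E}

lemma exists_pointwise_limit (hpos : ∀ x ∈ s, 0 < w x)
    (hD : ∀ f g : E, ∀ x ∈ s, |w x * (D f x - D g x)| ≤ ‖f - g‖) (hv : CauchySeq v) {x : ℝ}
    (hx : x ∈ s) : ∃ l, Tendsto (fun n => D (v n) x) atTop (𝓝 l) := by
  have hL : LipschitzWith (Real.toNNReal (w x)⁻¹) fun f => D f x := .of_dist_le_mul fun f g => by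
    have := hD f g x hx
    rw [abs_mul, abs_of_pos (hpos x hx)] at this
    rw [Real.coe_toNNReal _ (inv_nonneg.2 (hpos x hx).le), Real.dist_eq, dist_eq_norm,
      inv_mul_eq_div, le_div_iff₀' (hpos x hx)]
    exact this
  exact cauchySeq_tendsto_of_complete (hL.uniformContinuous.comp_cauchySeq hv)

lemma exists_tendstoWeighted_of_cauchySeq (hpos : ∀ x ∈ s, 0 < w x)
    (hbound : ∀ f : E, ∀ x ∈ s, |w x * D f x| ≤ ‖f‖)
    (hsub : ∀ f g : E, ∀ x ∈ s, D (f - g) x = D f x - D g x) (hv : CauchySeq v) :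
    ∃ g, TendstoWeighted s w (fun n => D (v n)) g ∧ ∃ C, ∀ x ∈ s, |w x * g x| ≤ C := by
  have hD : ∀ f g : E, ∀ x ∈ s, |w x * (D f x - D g x)| ≤ ‖f - g‖ := fun f g x hx => by
    rw [← hsub f g x hx]; exact hbound _ x hx
  choose! g hg using fun x hx => exists_pointwise_limit hpos hD hv (x := x) hx
  refine ⟨g, fun η hη => ?_, ?_⟩
  · obtain ⟨N, hN⟩ := Metric.cauchySeq_iff.1 hv η hη
    filter_upwards [eventually_ge_atTop N] with n hn x hx
    refine le_of_tendsto (((hg x hx).const_sub (D (v n) x)).const_mul (w x)).abs ?_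
    filter_upwards [eventually_ge_atTop N] with m hm
    exact (hD _ _ x hx).trans ((dist_eq_norm (v n) (v m)).ge.trans (hN n hn m hm).le)
  · obtain ⟨C, hC⟩ := (isBounded_iff_forall_norm_le.1 hv.isBounded_range)
    refine ⟨C, fun x hx => le_of_tendsto ((hg x hx).const_mul (w x)).abs ?_⟩
    exact .of_forall fun n => (hbound _ x hx).trans (hC _ (mem_range_self n))

end WeightedConvergence

lemma hasDerivAt_of_tendstoWeighted {s : Set ℝ} {w₀ w₁ : ℝ → ℝ} {u₀ u₁ : ℕ → ℝ → ℝ}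
    {g₀ g₁ : ℝ → ℝ} (hs : IsOpen s) (hw₀ : ContinuousOn w₀ s) (hpos₀ : ∀ x ∈ s, 0 < w₀ x)
    (hw₁ : ContinuousOn w₁ s) (hpos₁ : ∀ x ∈ s, 0 < w₁ x) (h₀ : TendstoWeighted s w₀ u₀ g₀)
    (h₁ : TendstoWeighted s w₁ u₁ g₁) (hu : ∀ n, ∀ x ∈ s, HasDerivAt (u₀ n) (u₁ n x) x) :
    ∀ x ∈ s, HasDerivAt g₀ (g₁ x) x := fun _ hx =>
  hasDerivAt_of_tendstoLocallyUniformlyOn hs (h₁.tendstoLocallyUniformlyOn hw₁ hpos₁)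
    (.of_forall hu) (fun _ hy => (h₀.tendstoLocallyUniformlyOn hw₀ hpos₀).tendsto_at hy) hx

lemma TendstoWeighted.mono {s t : Set ℝ} {w : ℝ → ℝ} {u : ℕ → ℝ → ℝ} {g : ℝ → ℝ}
    (h : TendstoWeighted s w u g) (hts : t ⊆ s) : TendstoWeighted t w u g := fun η hη =>
  (h η hη).mono fun _ hn x hx => hn x (hts hx)

instance (ε : ℝ) : CompleteSpace (M2 ε) := by
  refine Metric.complete_of_cauchySeq_tendsto fun u hu => ?_
  obtain ⟨g₀, t₀, C₀, b₀⟩ := exists_tendstoWeighted_of_cauchySeq (wt_pos ε)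
    (fun f : M2 ε => fun _ => f.abs_wt_mul_fn_le) (fun _ _ _ _ => rfl) hu
  obtain ⟨g₁, t₁, C₁, b₁⟩ := exists_tendstoWeighted_of_cauchySeq (wt_pos (1 + ε))
    (fun f : M2 ε => fun _ => f.abs_wt_mul_deriv_le) (fun f g _ => f.deriv_sub g) hu
  obtain ⟨g₂, t₂, C₂, b₂⟩ := exists_tendstoWeighted_of_cauchySeq (wt_pos (2 + ε))
    (fun f : M2 ε => fun _ => f.abs_wt_mul_iteratedDeriv_two_le)
    (fun f g _ => f.iteratedDeriv_two_sub g) hu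
  have h₀ : ∀ x ∈ I1, HasDerivAt g₀ (g₁ x) x :=
    hasDerivAt_of_tendstoWeighted isOpen_I1 (continuousOn_wt _) (wt_pos _) (continuousOn_wt _)
      (wt_pos _) t₀ t₁ fun n _ => (u n).hasDerivAt
  have h₁ : ∀ x ∈ I1, HasDerivAt g₁ (g₂ x) x :=
    hasDerivAt_of_tendstoWeighted isOpen_I1 (continuousOn_wt _) (wt_pos _) (continuousOn_wt _)
      (wt_pos _) t₁ t₂ fun n _ => (u n).hasDerivAt_deriv
  have h₂ : ContinuousOn g₂ I1 :=
    (t₂.tendstoLocallyUniformlyOn (continuousOn_wt _) (wt_pos _)).continuousOn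
      (.of_forall fun n => (u n).continuousOn_iteratedDeriv_two)
  obtain ⟨G, e₀, e₁, e₂, -⟩ := M2.exists_of_hasDerivAt h₀ h₁ h₂ b₀ b₁ b₂
  refine ⟨G, Metric.tendsto_nhds.2 fun η hη => ?_⟩
  filter_upwards [t₀ (η / 4) (by positivity), t₁ (η / 4) (by positivity),
    t₂ (η / 4) (by positivity)] with n k₀ k₁ k₂
  have : ‖u n - G‖ ≤ η / 4 + η / 4 + η / 4 := M2.norm_le
    (fun x hx => by simpa only [M2.fn_sub, Pi.sub_apply, e₀ hx] using k₀ x hx)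
    (fun x hx => by simpa only [M2.deriv_sub _ _ hx, e₁ hx] using k₁ x hx)
    (fun x hx => by simpa only [M2.iteratedDeriv_two_sub _ _ hx, e₂ hx] using k₂ x hx)
  rw [dist_eq_norm]
  linarith

lemma TendstoWeighted.congr {s : Set ℝ} {w : ℝ → ℝ} {u : ℕ → ℝ → ℝ} {g g' : ℝ → ℝ}
    (h : TendstoWeighted s w u g) (hg : EqOn g g' s) : TendstoWeighted s w u g' := fun η hη =>
  (h η hη).mono fun _ hn x hx => hg hx ▸ hn x hx

lemma M1.tendsto_of_tendstoWeighted {ε : ℝ} {u : ℕ → M1 ε} {f : M1 ε}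
    (t₀ : TendstoWeighted I1 (wt (-1 + 2 * ε)) (fun n => (u n).fn) f.fn)
    (t₁ : TendstoWeighted I1 (wt (2 * ε)) (fun n => deriv (u n).fn) (deriv f.fn))
    (t₂ : TendstoWeighted Ih wt1 (fun n => iteratedDeriv 2 (u n).fn) (iteratedDeriv 2 f.fn))
    (t₃ : TendstoWeighted Ih wt1 (fun n => iteratedDeriv 3 (u n).fn) (iteratedDeriv 3 f.fn)) :
    Tendsto u atTop (𝓝 f) := by
  simp only [TendstoWeighted, wt1, one_mul] at t₂ t₃
  refine Metric.tendsto_nhds.2 fun η hη => ?_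
  filter_upwards [t₀ (η / 5) (by positivity), t₁ (η / 5) (by positivity),
    t₂ (η / 5) (by positivity), t₃ (η / 5) (by positivity)] with n k₀ k₁ k₂ k₃
  have : ‖u n - f‖ ≤ η / 5 + η / 5 + η / 5 + η / 5 := M1.norm_le k₀
    (fun x hx => by simpa only [M1.deriv_sub _ _ hx] using k₁ x hx)
    (fun x hx => by simpa only [M1.iteratedDeriv_two_sub _ _ hx] using k₂ x hx)
    (fun x hx => by simpa only [M1.iteratedDeriv_three_sub _ _ hx] using k₃ x hx)
  rw [dist_eq_norm]
  linarith

lemma M1.completeSpace {ε : ℝ} (hε : ε < 1 / 2) : CompleteSpace (M1 ε) := by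
  have hwt1 : ∀ x ∈ Ih, 0 < wt1 x := fun _ _ => one_pos
  have cwt1 : ContinuousOn wt1 Ih := continuousOn_const
  refine Metric.complete_of_cauchySeq_tendsto fun u hu => ?_
  obtain ⟨g₀, t₀, C₀, b₀⟩ := exists_tendstoWeighted_of_cauchySeq (wt_pos (-1 + 2 * ε))
    (fun f : M1 ε => fun _ => f.abs_wt_mul_fn_le) (fun _ _ _ _ => rfl) hu
  obtain ⟨g₁, t₁, C₁, b₁⟩ := exists_tendstoWeighted_of_cauchySeq (wt_pos (2 * ε))
    (fun f : M1 ε => fun _ => f.abs_wt_mul_deriv_le) (fun f g _ => f.deriv_sub g) hu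
  obtain ⟨g₂, t₂, C₂, b₂⟩ := exists_tendstoWeighted_of_cauchySeq hwt1
    (fun (f : M1 ε) _ hx => by simpa [wt1] using f.abs_iteratedDeriv_two_le hx)
    (fun f g _ => f.iteratedDeriv_two_sub g) hu
  obtain ⟨g₃, t₃, C₃, b₃⟩ := exists_tendstoWeighted_of_cauchySeq hwt1
    (fun (f : M1 ε) _ hx => by simpa [wt1] using f.abs_iteratedDeriv_three_le hx)
    (fun f g _ => f.iteratedDeriv_three_sub g) hu
  have h₀ : ∀ x ∈ I1, HasDerivAt g₀ (g₁ x) x :=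
    hasDerivAt_of_tendstoWeighted isOpen_I1 (continuousOn_wt _) (wt_pos _) (continuousOn_wt _)
      (wt_pos _) t₀ t₁ fun n _ => (u n).hasDerivAt
  have h₁ : ContinuousOn g₁ I1 :=
    (t₁.tendstoLocallyUniformlyOn (continuousOn_wt _) (wt_pos _)).continuousOn
      (.of_forall fun n => (u n).continuousOn_deriv)
  have h₂ : ∀ x ∈ Ih, HasDerivAt g₁ (g₂ x) x :=
    hasDerivAt_of_tendstoWeighted isOpen_Ih ((continuousOn_wt _).mono Ih_subset_I1)
      (fun x hx => wt_pos _ x (Ih_subset_I1 hx)) cwt1 hwt1 (t₁.mono Ih_subset_I1) t₂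
      fun n _ => (u n).hasDerivAt_deriv
  have h₃ : ∀ x ∈ Ih, HasDerivAt g₂ (g₃ x) x :=
    hasDerivAt_of_tendstoWeighted isOpen_Ih cwt1 hwt1 cwt1 hwt1 t₂ t₃
      fun n _ => (u n).hasDerivAt_iteratedDeriv_two
  have h₄ : ContinuousOn g₃ Ih := (t₃.tendstoLocallyUniformlyOn cwt1 hwt1).continuousOn
    (.of_forall fun n => (u n).continuousOn_iteratedDeriv_three)
  simp only [wt1, one_mul] at b₂ b₃
  obtain ⟨f, e₀, e₁, e₂, e₃, -⟩ := M1.exists_of_hasDerivAt hε h₀ h₁ h₂ h₃ h₄ b₀ b₁ b₂ b₃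
  exact ⟨f, M1.tendsto_of_tendstoWeighted (t₀.congr e₀.symm) (t₁.congr e₁.symm) (t₂.congr e₂.symm)
    (t₃.congr e₃.symm)⟩

/-! ### Integrals of functions bounded by Jacobi weights -/

section Integrals

variable {u : ℝ → ℝ}

lemma uIcc_subset_I1 {x y : ℝ} (hx : x ∈ I1) (hy : y ∈ I1) : uIcc x y ⊆ I1 :=
  ordConnected_Ioo.uIcc_subset hx hy

lemma intervalIntegrable_I1 (hu : ContinuousOn u I1) {x y : ℝ} (hx : x ∈ I1) (hy : y ∈ I1) :
    IntervalIntegrable u volume x y :=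
  (hu.mono (uIcc_subset_I1 hx hy)).intervalIntegrable

lemma hasDerivAt_integral (hu : ContinuousOn u I1) {a x : ℝ}
    (ha : IntervalIntegrable u volume a 0) (hx : x ∈ I1) :
    HasDerivAt (fun y => ∫ t in a..y, u t) (u x) x :=
  intervalIntegral.integral_hasDerivAt_right (ha.trans (intervalIntegrable_I1 hu zero_mem_I1 hx))
    (hu.stronglyMeasurableAtFilter isOpen_I1 x hx) (hu.continuousAt (isOpen_I1.mem_nhds hx))

lemma neg_mem_I1 {x : ℝ} (hx : x ∈ I1) : -x ∈ I1 := ⟨by linarith [hx.2], by linarith [hx.1]⟩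

lemma continuousOn_comp_neg (hu : ContinuousOn u I1) : ContinuousOn (fun t => u (-t)) I1 :=
  hu.comp continuousOn_neg fun _ hx => neg_mem_I1 hx

lemma nonneg_of_abs_le_jacobi {s r C : ℝ} (hb : ∀ t ∈ I1, |u t| ≤ C * jacobi s r t) : 0 ≤ C :=
  nonneg_of_mul_nonneg_left ((abs_nonneg _).trans (hb 0 zero_mem_I1)) (jacobi_pos s r zero_mem_I1)

lemma abs_comp_neg_le_jacobi {s r C : ℝ} (hb : ∀ t ∈ I1, |u t| ≤ C * jacobi s r t) :
    ∀ t ∈ I1, |u (-t)| ≤ C * jacobi r s t := fun t ht => by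
  rw [← jacobi_reflect]; exact hb _ (neg_mem_I1 ht)

section RightHalf

variable {x : ℝ}

lemma rpow_le_two_rpow_abs {y : ℝ} (h1 : 1 ≤ y) (h2 : y ≤ 2) (p : ℝ) : y ^ p ≤ 2 ^ |p| :=
  (Real.rpow_le_rpow_of_exponent_le h1 (le_abs_self p)).trans
    (Real.rpow_le_rpow (by linarith) h2 (abs_nonneg p))

lemma jacobi_le_rpow (s r : ℝ) (hx : x ∈ I1) (hx0 : 0 ≤ x) :
    jacobi s r x ≤ 2 ^ |s| * (1 - x) ^ r :=
  mul_le_mul_of_nonneg_right (rpow_le_two_rpow_abs (by linarith) (by linarith [hx.2]) s)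
    (Real.rpow_nonneg (one_sub_pos hx).le r)

lemma rpow_le_jacobi (s r : ℝ) (hx : x ∈ I1) (hx0 : 0 ≤ x) :
    (1 - x) ^ r ≤ 2 ^ |s| * jacobi s r x := by
  have h := rpow_le_two_rpow_abs (y := 1 + x) (by linarith) (by linarith [hx.2]) (-s)
  have hpos := Real.rpow_pos_of_pos (one_add_pos hx) s
  rw [abs_neg, Real.rpow_neg (one_add_pos hx).le, inv_le_iff_one_le_mul₀ hpos] at h
  rw [jacobi, ← mul_assoc]
  exact le_mul_of_one_le_left (Real.rpow_nonneg (one_sub_pos hx).le r) h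

lemma integral_zero_one_sub_rpow_le {r : ℝ} (hr : r < -1) (hx : x ∈ I1) (hx0 : 0 ≤ x) :
    ∫ t in (0 : ℝ)..x, (1 - t) ^ r ≤ (-(r + 1))⁻¹ * (1 - x) ^ (r + 1) := by
  have hx1 := one_sub_pos hx
  have hr1 : 0 < (-(r + 1))⁻¹ := inv_pos.2 (by linarith)
  have h0 : (0 : ℝ) ∉ uIcc (1 - x) (1 - 0) := by
    rw [uIcc_of_le (by linarith)]; exact fun h => hx1.not_ge h.1
  rw [intervalIntegral.integral_comp_sub_left (fun t : ℝ => t ^ r),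
    integral_rpow (Or.inr ⟨hr.ne, h0⟩), sub_zero, Real.one_rpow, ← neg_div_neg_eq, neg_sub,
    div_eq_inv_mul]
  exact mul_le_mul_of_nonneg_left (by linarith) hr1.le

lemma intervalIntegrable_one_sub_rpow {r : ℝ} (hr : -1 < r) (a b : ℝ) :
    IntervalIntegrable (fun t : ℝ => (1 - t) ^ r) volume a b := by
  simpa only [sub_sub_cancel] using
    (intervalIntegral.intervalIntegrable_rpow' (a := 1 - a) (b := 1 - b) hr).comp_sub_left 1

lemma integral_one_one_sub_rpow {r : ℝ} (hr : -1 < r) (x : ℝ) :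
    ∫ t in x..1, (1 - t) ^ r = (r + 1)⁻¹ * (1 - x) ^ (r + 1) := by
  rw [intervalIntegral.integral_comp_sub_left (fun t : ℝ => t ^ r), integral_rpow (Or.inl hr),
    sub_self, Real.zero_rpow (by linarith), sub_zero, div_eq_inv_mul]

lemma exists_abs_integral_zero_le_of_nonneg (s : ℝ) {r : ℝ} (hr : r < -1) :
    ∃ K : ℝ, 0 ≤ K ∧ ∀ (u : ℝ → ℝ) (C : ℝ), (∀ t ∈ I1, |u t| ≤ C * jacobi s r t) →
      ∀ x ∈ I1, 0 ≤ x → |∫ t in (0 : ℝ)..x, u t| ≤ C * K * jacobi (s + 1) (r + 1) x := by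
  have hr1 : 0 ≤ (-(r + 1))⁻¹ := inv_nonneg.2 (by linarith)
  refine ⟨2 ^ |s| * (-(r + 1))⁻¹ * 2 ^ |s + 1|, by positivity, fun u C hb x hx hx0 => ?_⟩
  have hC := nonneg_of_abs_le_jacobi hb
  have hmem : ∀ t ∈ Icc 0 x, t ∈ I1 := fun t ht => ⟨by linarith [ht.1], ht.2.trans_lt hx.2⟩
  have hint : IntervalIntegrable (fun t : ℝ => C * 2 ^ |s| * (1 - t) ^ r) volume 0 x := by
    refine (continuousOn_const.mul (ContinuousOn.rpow_const (by fun_prop) fun t ht =>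
      Or.inl ?_)).intervalIntegrable
    rw [uIcc_of_le hx0] at ht
    exact (one_sub_pos (hmem t ht)).ne'
  calc |∫ t in (0 : ℝ)..x, u t| ≤ ∫ t in (0 : ℝ)..x, C * 2 ^ |s| * (1 - t) ^ r := by
        rw [← Real.norm_eq_abs]
        refine intervalIntegral.norm_integral_le_of_norm_le hx0 (.of_forall fun t ht => ?_) hint
        have ht' := hmem t (Ioc_subset_Icc_self ht)
        rw [mul_assoc]
        exact (hb t ht').trans (mul_le_mul_of_nonneg_left (jacobi_le_rpow s r ht' ht.1.le) hC)
    _ = C * 2 ^ |s| * ∫ t in (0 : ℝ)..x, (1 - t) ^ r := intervalIntegral.integral_const_mul _ _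
    _ ≤ C * 2 ^ |s| * ((-(r + 1))⁻¹ * (2 ^ |s + 1| * jacobi (s + 1) (r + 1) x)) := by
        gcongr
        exact (integral_zero_one_sub_rpow_le hr hx hx0).trans
          (mul_le_mul_of_nonneg_left (rpow_le_jacobi _ _ hx hx0) hr1)
    _ = _ := by ring

lemma exists_abs_integral_one_le_of_nonneg (s : ℝ) {r : ℝ} (hr : -1 < r) :
    ∃ K : ℝ, 0 ≤ K ∧ ∀ (u : ℝ → ℝ) (C : ℝ), ContinuousOn u I1 →
      (∀ t ∈ I1, |u t| ≤ C * jacobi s r t) → IntervalIntegrable u volume 0 1 ∧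
      ∀ x ∈ I1, 0 ≤ x → |∫ t in x..1, u t| ≤ C * K * jacobi (s + 1) (r + 1) x := by
  have hr1 : 0 ≤ (r + 1)⁻¹ := inv_nonneg.2 (by linarith)
  refine ⟨2 ^ |s| * (r + 1)⁻¹ * 2 ^ |s + 1|, by positivity, fun u C hu hb => ?_⟩
  have hC := nonneg_of_abs_le_jacobi hb
  have hint (a b : ℝ) : IntervalIntegrable (fun t : ℝ => C * 2 ^ |s| * (1 - t) ^ r) volume a b :=
    (intervalIntegrable_one_sub_rpow hr a b).const_mul _
  have hle : ∀ t ∈ Ico (0 : ℝ) 1, ‖u t‖ ≤ C * 2 ^ |s| * (1 - t) ^ r := fun t ht => by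
    have ht' : t ∈ I1 := ⟨by linarith [ht.1], ht.2⟩
    rw [mul_assoc]
    exact (hb t ht').trans (mul_le_mul_of_nonneg_left (jacobi_le_rpow s r ht' ht.1) hC)
  refine ⟨?_, fun x hx hx0 => ?_⟩
  · rw [intervalIntegrable_iff_integrableOn_Ioo_of_le zero_le_one]
    refine ((intervalIntegrable_iff_integrableOn_Ioo_of_le zero_le_one).1 (hint 0 1)).mono'
      ((hu.mono (Ioo_subset_Ioo_left (by norm_num))).aestronglyMeasurable measurableSet_Ioo) ?_
    rw [ae_restrict_iff' measurableSet_Ioo]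
    exact .of_forall fun t ht => hle t (Ioo_subset_Ico_self ht)
  calc |∫ t in x..1, u t| ≤ ∫ t in x..1, C * 2 ^ |s| * (1 - t) ^ r := by
        rw [← Real.norm_eq_abs]
        refine intervalIntegral.norm_integral_le_of_norm_le hx.2.le ?_ (hint x 1)
        filter_upwards [compl_mem_ae_iff.2 (measure_singleton (1 : ℝ))] with t ht1 ht
        exact hle t ⟨hx0.trans ht.1.le, ht.2.lt_of_ne ht1⟩
    _ = C * 2 ^ |s| * ((r + 1)⁻¹ * (1 - x) ^ (r + 1)) := by
        rw [intervalIntegral.integral_const_mul, integral_one_one_sub_rpow hr]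
    _ ≤ C * 2 ^ |s| * ((r + 1)⁻¹ * (2 ^ |s + 1| * jacobi (s + 1) (r + 1) x)) := by
        gcongr
        exact rpow_le_jacobi _ _ hx hx0
    _ = _ := by ring

end RightHalf

lemma exists_abs_integral_zero_le {s r : ℝ} (hs : s < -1) (hr : r < -1) :
    ∃ K : ℝ, 0 ≤ K ∧ ∀ (u : ℝ → ℝ) (C : ℝ), (∀ t ∈ I1, |u t| ≤ C * jacobi s r t) →
      ∀ x ∈ I1, |∫ t in (0 : ℝ)..x, u t| ≤ C * K * jacobi (s + 1) (r + 1) x := by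
  obtain ⟨K, hK, h⟩ := exists_abs_integral_zero_le_of_nonneg s hr
  obtain ⟨K', -, h'⟩ := exists_abs_integral_zero_le_of_nonneg r hs
  refine ⟨max K K', le_max_of_le_left hK, fun u C hb x hx => ?_⟩
  have hC := nonneg_of_abs_le_jacobi hb
  have hpos := jacobi_pos (s + 1) (r + 1) hx
  rcases le_total 0 x with hx0 | hx0
  · exact (h u C hb x hx hx0).trans (by gcongr; exact le_max_left _ _)
  · have := h' (fun t => u (-t)) C (abs_comp_neg_le_jacobi hb) (-x) (neg_mem_I1 hx) (by linarith)
    rw [intervalIntegral.integral_comp_neg, neg_neg, neg_zero, intervalIntegral.integral_symm,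
      abs_neg, jacobi_reflect] at this
    exact this.trans (by gcongr; exact le_max_right _ _)

lemma exists_abs_integral_endpoint_le {s r : ℝ} (hs : -1 < s) (hr : -1 < r) :
    ∃ K : ℝ, 0 ≤ K ∧ ∀ (u : ℝ → ℝ) (C : ℝ), ContinuousOn u I1 →
      (∀ t ∈ I1, |u t| ≤ C * jacobi s r t) →
      IntervalIntegrable u volume (-1) 0 ∧ IntervalIntegrable u volume 0 1 ∧
      (∀ x ∈ I1, x ≤ 0 → |∫ t in (-1 : ℝ)..x, u t| ≤ C * K * jacobi (s + 1) (r + 1) x) ∧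
      ∀ x ∈ I1, 0 ≤ x → |∫ t in x..1, u t| ≤ C * K * jacobi (s + 1) (r + 1) x := by
  obtain ⟨K, hK, h⟩ := exists_abs_integral_one_le_of_nonneg s hr
  obtain ⟨K', -, h'⟩ := exists_abs_integral_one_le_of_nonneg r hs
  refine ⟨max K K', le_max_of_le_left hK, fun u C hu hb => ?_⟩
  have hC := nonneg_of_abs_le_jacobi hb
  obtain ⟨right_int, right_le⟩ := h u C hu hb
  obtain ⟨left_int, left_le⟩ :=
    h' (fun t => u (-t)) C (continuousOn_comp_neg hu) (abs_comp_neg_le_jacobi hb)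
  refine ⟨?_, right_int, fun x hx hx0 => ?_, fun x hx hx0 => ?_⟩
  · simpa using ((IntervalIntegrable.iff_comp_neg (by simp)).1 left_int).symm
  · have hpos := jacobi_pos (s + 1) (r + 1) hx
    have := left_le (-x) (neg_mem_I1 hx) (by linarith)
    rw [intervalIntegral.integral_comp_neg, neg_neg, jacobi_reflect] at this
    exact this.trans (by gcongr; exact le_max_right _ _)
  · have hpos := jacobi_pos (s + 1) (r + 1) hx
    exact (right_le x hx hx0).trans (by gcongr; exact le_max_left _ _)

lemma exists_abs_integral_half_le {s r : ℝ} (hs : -1 < s) (hr : -1 < r) :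
    ∃ K : ℝ, 0 ≤ K ∧ ∀ (u : ℝ → ℝ) (C : ℝ), ContinuousOn u I1 →
      (∀ t ∈ I1, |u t| ≤ C * jacobi s r t) →
      |∫ t in (-1 : ℝ)..0, u t| ≤ C * K ∧ |∫ t in (0 : ℝ)..1, u t| ≤ C * K := by
  obtain ⟨K, hK, h⟩ := exists_abs_integral_endpoint_le hs hr
  refine ⟨K, hK, fun u C hu hb => ?_⟩
  obtain ⟨-, -, left_le, right_le⟩ := h u C hu hb
  have e : jacobi (s + 1) (r + 1) 0 = 1 := by simp [jacobi]
  simpa only [e, mul_one] using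
    And.intro (left_le 0 zero_mem_I1 le_rfl) (right_le 0 zero_mem_I1 le_rfl)

end Integrals

lemma tendsto_zero_of_abs_le_jacobi {p r C : ℝ} (hp : 0 < p) (hr : 0 < r) {y : ℝ → ℝ}
    (h : ∀ x ∈ I1, |y x| ≤ C * jacobi p r x) :
    Tendsto y (𝓝[>] (-1)) (𝓝 0) ∧ Tendsto y (𝓝[<] 1) (𝓝 0) := by
  have hc : Continuous (jacobi p r) :=
    Continuous.mul (Continuous.rpow_const (by fun_prop) fun _ => Or.inr hp.le)
      (Continuous.rpow_const (by fun_prop) fun _ => Or.inr hr.le)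
  have hlim (a : ℝ) (ha : jacobi p r a = 0) : Tendsto (fun x => C * jacobi p r x) (𝓝 a) (𝓝 0) := by
    simpa only [ha, mul_zero] using (hc.tendsto a).const_mul C
  refine ⟨squeeze_zero_norm' ?_ ((hlim (-1) (by simp [jacobi, hp.ne'])).mono_left
      nhdsWithin_le_nhds), squeeze_zero_norm' ?_ ((hlim 1 (by simp [jacobi, hr.ne'])).mono_left
      nhdsWithin_le_nhds)⟩
  · filter_upwards [Ioo_mem_nhdsGT (show (-1 : ℝ) < 1 by norm_num)] with x hx using h x hx
  · filter_upwards [Ioo_mem_nhdsLT (show (-1 : ℝ) < 1 by norm_num)] with x hx using h x hx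

/-! ### The linearized operators -/

/-- The affine function `q₁ (1 - x) - q₂ (1 + x)`. The extremal solution `U_θ^{c,γ}` is of this
form, with `m = 2 q₁` and `n = 2 q₂`. -/
def aff (q : ℝ × ℝ) (x : ℝ) : ℝ := q.1 * (1 - x) - q.2 * (1 + x)

lemma aff_add (q q' : ℝ × ℝ) (x : ℝ) : aff (q + q') x = aff q x + aff q' x := by
  simp only [aff, Prod.fst_add, Prod.snd_add]; ring

lemma aff_sub (q q' : ℝ × ℝ) (x : ℝ) : aff (q - q') x = aff q x - aff q' x := by
  simp only [aff, Prod.fst_sub, Prod.snd_sub]; ring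

lemma aff_smul (t : ℝ) (q : ℝ × ℝ) (x : ℝ) : aff (t • q) x = t * aff q x := by
  simp only [aff, Prod.smul_fst, Prod.smul_snd, smul_eq_mul]; ring

lemma hasDerivAt_aff (q : ℝ × ℝ) (x : ℝ) : HasDerivAt (aff q) (-(q.1 + q.2)) x :=
  ((((hasDerivAt_id' x).const_sub 1).const_mul q.1).sub
    (((hasDerivAt_id' x).const_add 1).const_mul q.2)).congr_deriv (by ring)

@[fun_prop]
lemma continuous_aff (q : ℝ × ℝ) : Continuous (aff q) := by unfold aff; fun_prop

lemma abs_aff_le (q : ℝ × ℝ) {x : ℝ} (hx : x ∈ I1) : |aff q x| ≤ 4 * ‖q‖ := by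
  have h1 : |q.1| ≤ ‖q‖ := norm_fst_le q
  have h2 : |q.2| ≤ ‖q‖ := norm_snd_le q
  have e1 : |1 - x| ≤ 2 := abs_le.2 ⟨by linarith [hx.2], by linarith [hx.1]⟩
  have e2 : |1 + x| ≤ 2 := abs_le.2 ⟨by linarith [hx.1], by linarith [hx.2]⟩
  calc |aff q x| ≤ |q.1 * (1 - x)| + |q.2 * (1 + x)| := abs_sub _ _
    _ ≤ ‖q‖ * 2 + ‖q‖ * 2 := by rw [abs_mul, abs_mul]; gcongr
    _ = _ := by ring

lemma hasDerivAt_jacobi_mul (a d : ℝ) {y : ℝ → ℝ} {y' x : ℝ} (hx : x ∈ I1)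
    (hy : HasDerivAt y y' x) : HasDerivAt (fun t => jacobi a d t * y t)
      (jacobi a d x * (y' + aff (a, d) x * y x / (1 - x ^ 2))) x := by
  refine ((hasDerivAt_jacobi a d hx).mul hy).congr_deriv ?_
  have h := jacobi_add (a - 1) (d - 1) 1 1 hx
  rw [sub_add_cancel, sub_add_cancel, jacobi_one] at h
  have hp := (one_sub_sq_pos hx).ne'
  rw [h, aff]
  field_simp
  ring

lemma abs_jacobi_mul_le {s r a d s' r' x u C : ℝ} (hs : s' = a + s) (hr : r' = d + r)
    (hx : x ∈ I1) (hu : |u| ≤ C * jacobi s r x) : |jacobi a d x * u| ≤ C * jacobi s' r' x := by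
  have hpos := jacobi_pos a d hx
  rw [hs, hr, jacobi_add _ _ _ _ hx, abs_mul, abs_of_pos hpos, mul_left_comm]
  gcongr

/-- The exponents `q = (m / 2, n / 2)` for which the function spaces with parameter `ε` are suited
to the linearization at `aff q`. -/
structure GoodExp (ε : ℝ) (q : ℝ × ℝ) : Prop where
  pos : 0 < ε
  lt_half : ε < 1 / 2
  one_le_fst : 1 ≤ q.1
  one_le_snd : 1 ≤ q.2
  fst_lt : q.1 < 1 + ε
  snd_lt : q.2 < 1 + ε

/-- The right-hand sides `h`, with derivatives `h1` and `h2` on `Ih`, of norm at most `C` for the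
operator `f ↦ (1 - x²) f' + (2x + aff q) f` on `M1 ε`. -/
structure ThetaData (ε C : ℝ) (h h1 h2 : ℝ → ℝ) : Prop where
  cont : ContinuousOn h I1
  deriv1 : ∀ x ∈ Ih, HasDerivAt h (h1 x) x
  deriv2 : ∀ x ∈ Ih, HasDerivAt h1 (h2 x) x
  cont2 : ContinuousOn h2 Ih
  bdd0 : ∀ x ∈ I1, |h x| ≤ C * wt (1 - 2 * ε) x
  bdd1 : ∀ x ∈ Ih, |h1 x| ≤ C
  bdd2 : ∀ x ∈ Ih, |h2 x| ≤ C

/-- The linearized `θ`-equation, solved modulo the multiples of `1 - x²`: the multiplier `l` is what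
makes `f` vanish at both endpoints. -/
def ThetaSol {ε : ℝ} (q : ℝ × ℝ) (f : M1 ε) (h : ℝ → ℝ) : Prop :=
  ∃ l : ℝ, ∀ x ∈ I1, (1 - x ^ 2) * deriv f.fn x + (2 * x + aff q x) * f.fn x = h x + l * (1 - x ^ 2)

/-- The linearized `φ`-equation `(1 - x²) G'' + aff q G' = r`. -/
def PhiSol {ε : ℝ} (q : ℝ × ℝ) (G : M2 ε) (r : ℝ → ℝ) : Prop :=
  ∀ x ∈ I1, (1 - x ^ 2) * iteratedDeriv 2 G.fn x + aff q x * deriv G.fn x = r x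

section ThetaEquation

lemma eq_zero_of_deriv_nonneg_of_tendsto {y y' : ℝ → ℝ} (hd : ∀ x ∈ I1, HasDerivAt y (y' x) x)
    (hy : ∀ x ∈ I1, 0 ≤ y' x) (h1 : Tendsto y (𝓝[>] (-1)) (𝓝 0))
    (h2 : Tendsto y (𝓝[<] 1) (𝓝 0)) {x : ℝ} (hx : x ∈ I1) : y x = 0 := by
  have hm : MonotoneOn y I1 := by
    refine monotoneOn_of_deriv_nonneg (convex_Ioo _ _)
      (fun x hx => (hd x hx).continuousAt.continuousWithinAt) ?_ ?_ <;> rw [interior_Ioo]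
    · exact fun x hx => (hd x hx).differentiableAt.differentiableWithinAt
    · exact fun x hx => (hd x hx).deriv ▸ hy x hx
  refine le_antisymm (ge_of_tendsto h2 ?_) (le_of_tendsto h1 ?_)
  · filter_upwards [Ioo_mem_nhdsLT hx.2] with t ht
    exact hm hx ⟨hx.1.trans ht.1, ht.2⟩ ht.1.le
  · filter_upwards [Ioo_mem_nhdsGT hx.1] with t ht
    exact hm ⟨ht.1, ht.2.trans hx.2⟩ hx ht.2.le

variable {ε : ℝ} {q : ℝ × ℝ}

lemma aff_sub_one (q : ℝ × ℝ) (x : ℝ) : aff (q.1 - 1, q.2 - 1) x = 2 * x + aff q x := by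
  simp only [aff]; ring

lemma ThetaSol.eq_zero (hq : GoodExp ε q) {f : M1 ε} (h : ThetaSol q f 0) : f = 0 := by
  obtain ⟨l, hl⟩ := h
  have hε := hq.lt_half
  have hq1 := hq.one_le_fst
  have hq2 := hq.one_le_snd
  set w := jacobi (q.1 - 1) (q.2 - 1)
  set y : ℝ → ℝ := fun x => w x * f.fn x
  have hw : ∀ x ∈ I1, 0 < w x := fun x => jacobi_pos _ _
  have y_deriv : ∀ x ∈ I1, HasDerivAt y (l * w x) x := fun x hx => by
    refine (hasDerivAt_jacobi_mul _ _ hx (f.hasDerivAt hx)).congr_deriv ?_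
    have hp := (one_sub_sq_pos hx).ne'
    have hlx := hl x hx
    simp only [Pi.zero_apply, zero_add] at hlx
    rw [aff_sub_one]
    field_simp
    linear_combination w x * hlx
  have y_bound : ∀ x ∈ I1, |y x| ≤ ‖f‖ * jacobi (q.1 - 2 * ε) (q.2 - 2 * ε) x := fun x hx => by
    have hf := (abs_le_mul_wt_neg hx).1 (f.abs_wt_mul_fn_le hx)
    rw [wt_eq_jacobi _ hx] at hf
    exact abs_jacobi_mul_le (by ring) (by ring) hx hf
  obtain ⟨t1, t2⟩ := tendsto_zero_of_abs_le_jacobi (by linarith) (by linarith) y_bound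
  have y_zero : ∀ x ∈ I1, y x = 0 := by
    rcases le_total 0 l with hl0 | hl0
    · exact fun x hx => eq_zero_of_deriv_nonneg_of_tendsto y_deriv
        (fun x hx => mul_nonneg hl0 (hw x hx).le) t1 t2 hx
    · refine fun x hx => neg_eq_zero.1 (eq_zero_of_deriv_nonneg_of_tendsto (y := fun x => -y x)
        (fun x hx => (y_deriv x hx).neg) (fun x hx => ?_) ?_ ?_ hx)
      · rw [← neg_mul]
        exact mul_nonneg (neg_nonneg.2 hl0) (hw x hx).le
      · simpa only [neg_zero] using t1.neg
      · simpa only [neg_zero] using t2.neg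
  exact M1.ext_on fun x hx => (mul_eq_zero.1 (y_zero x hx)).resolve_left (hw x hx).ne'

lemma exists_primitive_of_integral_eq_zero {s r : ℝ} (hs : -1 < s) (hr : -1 < r) :
    ∃ K : ℝ, 0 ≤ K ∧ ∀ (u : ℝ → ℝ) (C : ℝ), ContinuousOn u I1 →
      (∀ t ∈ I1, |u t| ≤ C * jacobi s r t) →
      (∫ t in (-1 : ℝ)..0, u t) + ∫ t in (0 : ℝ)..1, u t = 0 →
      ∃ y : ℝ → ℝ, (∀ x ∈ I1, HasDerivAt y (u x) x) ∧
        ∀ x ∈ I1, |y x| ≤ C * K * jacobi (s + 1) (r + 1) x := by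
  obtain ⟨K, hK, h⟩ := exists_abs_integral_endpoint_le hs hr
  refine ⟨K, hK, fun u C hu hb htot => ?_⟩
  obtain ⟨left_int, right_int, left_le, right_le⟩ := h u C hu hb
  refine ⟨fun x => ∫ t in (-1 : ℝ)..x, u t, fun x hx => hasDerivAt_integral hu left_int hx,
    fun x hx => ?_⟩
  rcases le_total x 0 with hx0 | hx0
  · exact left_le x hx hx0
  have i0 := intervalIntegrable_I1 hu zero_mem_I1 hx
  have flip : ∫ t in (-1 : ℝ)..x, u t = -∫ t in x..1, u t := by
    have h1 := intervalIntegral.integral_add_adjacent_intervals left_int i0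
    have h2 := intervalIntegral.integral_add_adjacent_intervals i0 (i0.symm.trans right_int)
    linarith
  simp only [flip, abs_neg]
  exact right_le x hx hx0

lemma exists_balancing_multiple {s r σ ρ : ℝ} (hs : -1 < s) (hr : -1 < r) (hsσ : s ≤ σ)
    (hrρ : r ≤ ρ) : ∃ K : ℝ, 0 ≤ K ∧ ∀ (m : ℝ → ℝ) (C : ℝ), ContinuousOn m I1 →
      (∀ t ∈ I1, |m t| ≤ C * jacobi s r t) → ∃ l : ℝ, |l| ≤ C * K ∧
      (∫ t in (-1 : ℝ)..0, (m t + l * jacobi σ ρ t)) +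
        ∫ t in (0 : ℝ)..1, (m t + l * jacobi σ ρ t) = 0 := by
  obtain ⟨K, hK, h⟩ := exists_abs_integral_half_le hs hr
  obtain ⟨_, -, hI⟩ := exists_abs_integral_endpoint_le hs hr
  obtain ⟨B, -, hB⟩ := jacobi_le_jacobi hsσ hrρ
  obtain ⟨left_int, right_int, -, -⟩ := hI _ B (continuousOn_jacobi σ ρ) fun t ht => by
    rw [abs_of_pos (jacobi_pos _ _ ht)]; exact hB t ht
  set M := (∫ t in (-1 : ℝ)..0, jacobi σ ρ t) + ∫ t in (0 : ℝ)..1, jacobi σ ρ t with hM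
  have hMpos : 0 < M := add_pos
    (intervalIntegral.intervalIntegral_pos_of_pos_on left_int
      (fun x hx => jacobi_pos _ _ ⟨hx.1, hx.2.trans one_pos⟩) (by norm_num))
    (intervalIntegral.intervalIntegral_pos_of_pos_on right_int
      (fun x hx => jacobi_pos _ _ ⟨by linarith [hx.1], hx.2⟩) (by norm_num))
  refine ⟨2 * K / M, by positivity, fun m C hm hb => ?_⟩
  obtain ⟨m_left, m_right, -, -⟩ := hI m C hm hb
  obtain ⟨left_le, right_le⟩ := h m C hm hb
  refine ⟨-((∫ t in (-1 : ℝ)..0, m t) + ∫ t in (0 : ℝ)..1, m t) / M, ?_, ?_⟩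
  · rw [abs_div, abs_neg, abs_of_pos hMpos, ← mul_div_assoc]
    refine div_le_div_of_nonneg_right ?_ hMpos.le
    linarith [abs_add_le (∫ t in (-1 : ℝ)..0, m t) (∫ t in (0 : ℝ)..1, m t)]
  · rw [intervalIntegral.integral_add m_left (left_int.const_mul _),
      intervalIntegral.integral_add m_right (right_int.const_mul _),
      intervalIntegral.integral_const_mul, intervalIntegral.integral_const_mul,
      add_add_add_comm, ← mul_add, ← hM, div_mul_cancel₀ _ hMpos.ne', add_neg_cancel]

lemma exists_balanced_primitive {s r σ ρ : ℝ} (hs : -1 < s) (hr : -1 < r) (hsσ : s ≤ σ)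
    (hrρ : r ≤ ρ) : ∃ K : ℝ, 0 ≤ K ∧ ∀ (m : ℝ → ℝ) (C : ℝ), ContinuousOn m I1 →
      (∀ t ∈ I1, |m t| ≤ C * jacobi s r t) → ∃ (l : ℝ) (y : ℝ → ℝ), |l| ≤ C * K ∧
        (∀ x ∈ I1, HasDerivAt y (m x + l * jacobi σ ρ x) x) ∧
        ∀ x ∈ I1, |y x| ≤ C * K * jacobi (s + 1) (r + 1) x := by
  obtain ⟨L, hL, hl⟩ := exists_balancing_multiple hs hr hsσ hrρ
  obtain ⟨K, hK, hy⟩ := exists_primitive_of_integral_eq_zero hs hr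
  obtain ⟨B, hB0, hB⟩ := jacobi_le_jacobi hsσ hrρ
  refine ⟨L + (1 + L * B) * K, by positivity, fun m C hm hb => ?_⟩
  have hC := nonneg_of_abs_le_jacobi hb
  obtain ⟨l, l_le, htot⟩ := hl m C hm hb
  have n_le : ∀ t ∈ I1, |m t + l * jacobi σ ρ t| ≤ C * (1 + L * B) * jacobi s r t := fun t ht => by
    calc |m t + l * jacobi σ ρ t| ≤ |m t| + |l| * |jacobi σ ρ t| :=
          (abs_add_le _ _).trans_eq (by rw [abs_mul])
      _ ≤ C * jacobi s r t + C * L * (B * jacobi s r t) := by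
          rw [abs_of_pos (jacobi_pos _ _ ht)]
          have := (jacobi_pos σ ρ ht).le
          gcongr
          exacts [hb t ht, hB t ht]
      _ = _ := by ring
  obtain ⟨y, y_deriv, y_le⟩ := hy _ _ (hm.add (continuousOn_const.mul (continuousOn_jacobi σ ρ)))
    n_le htot
  refine ⟨l, y, l_le.trans ?_, y_deriv, fun x hx => (y_le x hx).trans ?_⟩
  · gcongr
    exact le_add_of_nonneg_right (by positivity)
  · have := jacobi_pos (s + 1) (r + 1) hx
    rw [mul_assoc C]
    gcongr
    exact le_add_of_nonneg_left hL

/-- The first derivative of a solution `f` of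
`(1 - x²) f' + (2x + aff q) f = h + l (1 - x²)`, read off from the equation. -/
def thetaDeriv (q : ℝ × ℝ) (l : ℝ) (h f : ℝ → ℝ) (x : ℝ) : ℝ :=
  (h x + l * (1 - x ^ 2) - (2 * x + aff q x) * f x) / (1 - x ^ 2)

lemma exists_hasDerivAt_thetaDeriv (hq : GoodExp ε q) :
    ∃ K : ℝ, 0 ≤ K ∧ ∀ (C : ℝ) (h : ℝ → ℝ), ContinuousOn h I1 →
      (∀ x ∈ I1, |h x| ≤ C * wt (1 - 2 * ε) x) →
      ∃ (f : ℝ → ℝ) (l : ℝ), |l| ≤ K * C ∧ (∀ x ∈ I1, |f x| ≤ K * C * wt (1 - 2 * ε) x) ∧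
        ∀ x ∈ I1, HasDerivAt f (thetaDeriv q l h f x) x := by
  have hq1 := hq.one_le_fst
  have hq2 := hq.one_le_snd
  have hε := hq.lt_half
  have hε0 := hq.pos
  obtain ⟨K, hK, hex⟩ := exists_balanced_primitive (s := q.1 - 1 - 2 * ε) (r := q.2 - 1 - 2 * ε)
    (σ := q.1 - 1) (ρ := q.2 - 1) (by linarith) (by linarith) (by linarith) (by linarith)
  refine ⟨K, hK, fun C h hc hb => ?_⟩
  obtain ⟨l, y, l_le, y_deriv, y_le⟩ := hex (fun t => jacobi (q.1 - 2) (q.2 - 2) t * h t) C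
    ((continuousOn_jacobi _ _).mul hc) fun t ht => by
      have hbt := hb t ht
      rw [wt_eq_jacobi _ ht] at hbt
      exact abs_jacobi_mul_le (by ring) (by ring) ht hbt
  rw [mul_comm] at l_le
  refine ⟨fun x => jacobi (-(q.1 - 1)) (-(q.2 - 1)) x * y x, l, l_le, fun x hx => ?_,
    fun x hx => ?_⟩
  · rw [wt_eq_jacobi _ hx, mul_comm K]
    exact abs_jacobi_mul_le (by ring) (by ring) hx (y_le x hx)
  · refine (hasDerivAt_jacobi_mul _ _ hx (y_deriv x hx)).congr_deriv ?_
    have hp := (one_sub_sq_pos hx).ne'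
    have e : aff (-(q.1 - 1), -(q.2 - 1)) x = -(2 * x + aff q x) := by simp only [aff]; ring
    have inv := jacobi_add (-(q.1 - 1)) (-(q.2 - 1)) (q.1 - 1) (q.2 - 1) hx
    have split := jacobi_add (q.1 - 2) (q.2 - 2) 1 1 hx
    rw [neg_add_cancel, neg_add_cancel, jacobi_zero] at inv
    rw [show q.1 - 2 + 1 = q.1 - 1 by ring, show q.2 - 2 + 1 = q.2 - 1 by ring, jacobi_one] at split
    rw [e, thetaDeriv]
    rw [split] at inv ⊢
    field_simp
    linear_combination (-(h x) - l * (1 - x ^ 2)) * inv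

/-- The second derivative of a solution, obtained by differentiating `thetaDeriv`. -/
def thetaDeriv2 (q : ℝ × ℝ) (l : ℝ) (h h1 f : ℝ → ℝ) (x : ℝ) : ℝ :=
  (h1 x - 2 * l * x - aff q x * thetaDeriv q l h f x - (2 - (q.1 + q.2)) * f x) / (1 - x ^ 2)

/-- The third derivative of a solution, obtained by differentiating `thetaDeriv2`. -/
def thetaDeriv3 (q : ℝ × ℝ) (l : ℝ) (h h1 h2 f : ℝ → ℝ) (x : ℝ) : ℝ :=
  (h2 x - 2 * l - (aff q x - 2 * x) * thetaDeriv2 q l h h1 f x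
    - (2 - 2 * (q.1 + q.2)) * thetaDeriv q l h f x) / (1 - x ^ 2)

section Regularity

variable {l C : ℝ} {h h1 h2 f : ℝ → ℝ}

lemma hasDerivAt_div_one_sub_sq {N : ℝ → ℝ} {N' x : ℝ} (hx : x ∈ I1) (hN : HasDerivAt N N' x) :
    HasDerivAt (fun t => N t / (1 - t ^ 2))
      ((N' + 2 * x * (N x / (1 - x ^ 2))) / (1 - x ^ 2)) x := by
  have hp := (one_sub_sq_pos hx).ne'
  refine (hN.div ((hasDerivAt_pow 2 x).const_sub 1) hp).congr_deriv ?_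
  field_simp
  ring

lemma hasDerivAt_thetaDeriv (H : ThetaData ε C h h1 h2)
    (hf : ∀ x ∈ I1, HasDerivAt f (thetaDeriv q l h f x) x) {x : ℝ} (hx : x ∈ Ih) :
    HasDerivAt (thetaDeriv q l h f) (thetaDeriv2 q l h h1 f x) x := by
  have hx' := Ih_subset_I1 hx
  have hsq := ((hasDerivAt_pow 2 x).const_sub 1).const_mul l
  have hlin := ((hasDerivAt_id' x).const_mul 2).add (hasDerivAt_aff q x)
  refine (hasDerivAt_div_one_sub_sq hx' (((H.deriv1 x hx).add hsq).sub
    (hlin.mul (hf x hx')))).congr_deriv ?_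
  rw [thetaDeriv2]
  congr 1
  change _ + 2 * x * thetaDeriv q l h f x = _
  simp only [Pi.add_apply]
  ring

lemma hasDerivAt_thetaDeriv2 (H : ThetaData ε C h h1 h2)
    (hf : ∀ x ∈ I1, HasDerivAt f (thetaDeriv q l h f x) x) {x : ℝ} (hx : x ∈ Ih) :
    HasDerivAt (thetaDeriv2 q l h h1 f) (thetaDeriv3 q l h h1 h2 f x) x := by
  have hx' := Ih_subset_I1 hx
  refine (hasDerivAt_div_one_sub_sq hx' ((((H.deriv2 x hx).sub
    ((hasDerivAt_id' x).const_mul (2 * l))).sub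
    ((hasDerivAt_aff q x).mul (hasDerivAt_thetaDeriv H hf hx))).sub
    ((hf x hx').const_mul (2 - (q.1 + q.2))))).congr_deriv ?_
  rw [thetaDeriv3]
  congr 1
  change _ + 2 * x * thetaDeriv2 q l h h1 f x = _
  ring

lemma continuousOn_thetaDeriv (hh : ContinuousOn h I1) (hf : ContinuousOn f I1) :
    ContinuousOn (thetaDeriv q l h f) I1 :=
  .div ((hh.add (by fun_prop)).sub (.mul (by fun_prop) hf)) (by fun_prop) fun _ hx =>
    (one_sub_sq_pos hx).ne'

lemma continuousOn_thetaDeriv3 (H : ThetaData ε C h h1 h2)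
    (hf : ∀ x ∈ I1, HasDerivAt f (thetaDeriv q l h f x) x) :
    ContinuousOn (thetaDeriv3 q l h h1 h2 f) Ih := by
  have c1 : ContinuousOn (thetaDeriv q l h f) Ih := fun x hx =>
    (hasDerivAt_thetaDeriv H hf hx).continuousAt.continuousWithinAt
  have c2 : ContinuousOn (thetaDeriv2 q l h h1 f) Ih := fun x hx =>
    (hasDerivAt_thetaDeriv2 H hf hx).continuousAt.continuousWithinAt
  exact .div (((H.cont2.sub continuousOn_const).sub (.mul (by fun_prop) c2)).sub
    (continuousOn_const.mul c1)) (by fun_prop) fun x hx => (one_sub_sq_pos (Ih_subset_I1 hx)).ne'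

lemma abs_two_mul_le {x : ℝ} (hx : x ∈ I1) : |2 * x| ≤ 2 :=
  abs_le.2 ⟨by linarith [hx.1], by linarith [hx.2]⟩

lemma abs_fst_add_snd_le (q : ℝ × ℝ) : |q.1 + q.2| ≤ 2 * ‖q‖ := by
  have h1 : |q.1| ≤ ‖q‖ := norm_fst_le q
  have h2 : |q.2| ≤ ‖q‖ := norm_snd_le q
  linarith [abs_add_le q.1 q.2]

lemma abs_thetaDeriv_le (hε : 0 < ε) {D : ℝ} (hh : ∀ x ∈ I1, |h x| ≤ D * wt (1 - 2 * ε) x)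
    (hl : |l| ≤ D) (hf : ∀ x ∈ I1, |f x| ≤ D * wt (1 - 2 * ε) x) {x : ℝ} (hx : x ∈ I1) :
    |thetaDeriv q l h f x| ≤ (4 + 4 * ‖q‖) * D * wt (-(2 * ε)) x := by
  have hp := one_sub_sq_pos hx
  have hD := (abs_nonneg l).trans hl
  have split : wt (1 - 2 * ε) x = wt (-(2 * ε)) x * (1 - x ^ 2) := by
    rw [← wt_one, ← wt_add _ _ hx]; congr 1; ring
  have one_le : 1 ≤ wt (-(2 * ε)) x := by
    simpa [wt] using wt_anti (r := 0) (s := -(2 * ε)) (by linarith) hx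
  have coeff : |2 * x + aff q x| ≤ 2 + 4 * ‖q‖ :=
    (abs_add_le _ _).trans (add_le_add (abs_two_mul_le hx) (abs_aff_le q hx))
  rw [thetaDeriv, abs_div, abs_of_pos hp, div_le_iff₀ hp]
  calc |h x + l * (1 - x ^ 2) - (2 * x + aff q x) * f x|
      ≤ |h x| + |l| * (1 - x ^ 2) + |2 * x + aff q x| * |f x| := by
        refine (abs_sub _ _).trans ?_
        rw [abs_mul (2 * x + aff q x)]
        refine add_le_add_left ((abs_add_le _ _).trans_eq ?_) _
        rw [abs_mul l, abs_of_pos hp]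
    _ ≤ D * wt (1 - 2 * ε) x + D * (wt (-(2 * ε)) x * (1 - x ^ 2))
          + (2 + 4 * ‖q‖) * (D * wt (1 - 2 * ε) x) := by
        gcongr
        · exact hh x hx
        · exact le_mul_of_one_le_left hp.le one_le
        · exact hf x hx
    _ = _ := by rw [split]; ring

lemma abs_sub_sub_div_one_sub_sq_le {x a α u β v A Q B : ℝ} (hx : x ∈ Ih) (ha : |a| ≤ A)
    (hα : |α| ≤ Q) (hu : |u| ≤ B) (hβ : |β| ≤ Q) (hv : |v| ≤ B) :
    |(a - α * u - β * v) / (1 - x ^ 2)| ≤ 2 * (A + 2 * Q * B) := by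
  have half_le : 1 / 2 ≤ 1 - x ^ 2 := by nlinarith [hx.1, hx.2]
  have hQ := (abs_nonneg α).trans hα
  have hB := (abs_nonneg u).trans hu
  have hA := (abs_nonneg a).trans ha
  have num : |a - α * u - β * v| ≤ A + 2 * Q * B :=
    calc |a - α * u - β * v| ≤ |a| + |α| * |u| + |β| * |v| := by
          rw [← abs_mul, ← abs_mul]
          exact (abs_sub _ _).trans (add_le_add_left (abs_sub _ _) _)
      _ ≤ A + Q * B + Q * B := by gcongr
      _ = _ := by ring
  rw [abs_div, abs_of_pos (by linarith : 0 < 1 - x ^ 2), div_le_iff₀ (by linarith)]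
  have : 0 ≤ A + 2 * Q * B := by positivity
  nlinarith

lemma abs_thetaDeriv2_le {D x : ℝ} (hx : x ∈ Ih) (hl : |l| ≤ D) (h1_le : |h1 x| ≤ D)
    (hf : |f x| ≤ D) (hf1 : |thetaDeriv q l h f x| ≤ D) :
    |thetaDeriv2 q l h h1 f x| ≤ (14 + 16 * ‖q‖) * D := by
  have hx' := Ih_subset_I1 hx
  have data : |h1 x - 2 * l * x| ≤ 3 * D := by
    have : |2 * l * x| ≤ 2 * D := by
      rw [mul_right_comm, abs_mul]
      exact mul_le_mul (abs_two_mul_le hx') hl (abs_nonneg _) zero_le_two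
    linarith [abs_sub (h1 x) (2 * l * x)]
  have coeff : |2 - (q.1 + q.2)| ≤ 2 + 4 * ‖q‖ := by
    linarith [abs_sub 2 (q.1 + q.2), abs_two (α := ℝ), abs_fst_add_snd_le q, norm_nonneg q]
  exact (abs_sub_sub_div_one_sub_sq_le hx data (by linarith [abs_aff_le q hx']) hf1 coeff
    hf).trans_eq (by ring)

lemma abs_thetaDeriv3_le {D x : ℝ} (hx : x ∈ Ih) (hl : |l| ≤ D) (h2_le : |h2 x| ≤ D)
    (hf1 : |thetaDeriv q l h f x| ≤ D) (hf2 : |thetaDeriv2 q l h h1 f x| ≤ D) :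
    |thetaDeriv3 q l h h1 h2 f x| ≤ (14 + 16 * ‖q‖) * D := by
  have hx' := Ih_subset_I1 hx
  have data : |h2 x - 2 * l| ≤ 3 * D := by
    have : |2 * l| = 2 * |l| := by rw [abs_mul, abs_two]
    linarith [abs_sub (h2 x) (2 * l)]
  have coeff : |2 - 2 * (q.1 + q.2)| ≤ 2 + 4 * ‖q‖ := by
    have : |2 * (q.1 + q.2)| = 2 * |q.1 + q.2| := by rw [abs_mul, abs_two]
    linarith [abs_sub 2 (2 * (q.1 + q.2)), abs_two (α := ℝ), abs_fst_add_snd_le q]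
  have coeff' : |aff q x - 2 * x| ≤ 2 + 4 * ‖q‖ := by
    linarith [abs_sub (aff q x) (2 * x), abs_two_mul_le hx', abs_aff_le q hx']
  exact (abs_sub_sub_div_one_sub_sq_le hx data coeff' hf2 coeff hf1).trans_eq (by ring)

lemma abs_thetaDeriv_le_of_mem_Ih (hε : 0 < ε) (hε' : ε < 1 / 2) {D : ℝ}
    (hh : ∀ x ∈ I1, |h x| ≤ D * wt (1 - 2 * ε) x) (hl : |l| ≤ D)
    (hf : ∀ x ∈ I1, |f x| ≤ D * wt (1 - 2 * ε) x) {x : ℝ} (hx : x ∈ Ih) :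
    |thetaDeriv q l h f x| ≤ 2 * (4 + 4 * ‖q‖) * D := by
  have hD := (abs_nonneg l).trans hl
  have two_rpow : (2 : ℝ) ^ |-(2 * ε)| ≤ 2 := by
    rw [abs_neg, abs_of_pos (by linarith)]
    simpa using Real.rpow_le_rpow_of_exponent_le one_le_two (by linarith : 2 * ε ≤ 1)
  calc |thetaDeriv q l h f x| ≤ (4 + 4 * ‖q‖) * D * wt (-(2 * ε)) x :=
        abs_thetaDeriv_le hε hh hl hf (Ih_subset_I1 hx)
    _ ≤ (4 + 4 * ‖q‖) * D * 2 := by gcongr; exact (wt_mid _ hx).trans two_rpow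
    _ = _ := by ring

lemma abs_le_of_abs_le_mul_wt {p D u x : ℝ} (hp : 0 ≤ p) (hx : x ∈ I1) (h : |u| ≤ D * wt p x) :
    |u| ≤ D := by
  have hD : 0 ≤ D := nonneg_of_mul_nonneg_left ((abs_nonneg u).trans h) (wt_pos p x hx)
  exact h.trans (mul_le_of_le_one_right hD (by simpa [wt] using wt_anti hp hx))

lemma exists_M1_of_thetaDeriv (hε : 0 < ε) (hε' : ε < 1 / 2) {D : ℝ} (H : ThetaData ε D h h1 h2)
    (hl : |l| ≤ D) (hf : ∀ x ∈ I1, |f x| ≤ D * wt (1 - 2 * ε) x)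
    (f_deriv : ∀ x ∈ I1, HasDerivAt f (thetaDeriv q l h f x) x) :
    ∃ F : M1 ε, EqOn F.fn f I1 ∧ EqOn (deriv F.fn) (thetaDeriv q l h f) I1 ∧
      ‖F‖ ≤ (20 * (1 + ‖q‖)) ^ 3 * D := by
  set Q := 1 + ‖q‖ with hQ
  have hQ1 : 1 ≤ Q := by linarith [norm_nonneg q]
  have hD := (abs_nonneg l).trans hl
  have f1_le {x : ℝ} (hx : x ∈ Ih) : |thetaDeriv q l h f x| ≤ 8 * Q * D :=
    (abs_thetaDeriv_le_of_mem_Ih hε hε' H.bdd0 hl hf hx).trans_eq (by ring)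
  have D_le : D ≤ 8 * Q * D := le_mul_of_one_le_left hD (by linarith)
  have f2_le {x : ℝ} (hx : x ∈ Ih) : |thetaDeriv2 q l h h1 f x| ≤ 16 * Q * (8 * Q * D) :=
    (abs_thetaDeriv2_le hx (hl.trans D_le) ((H.bdd1 x hx).trans D_le)
      ((abs_le_of_abs_le_mul_wt (by linarith) (Ih_subset_I1 hx) (hf x (Ih_subset_I1 hx))).trans
        D_le) (f1_le hx)).trans (by gcongr; linarith)
  have le_QD : 8 * Q * D ≤ 16 * Q * (8 * Q * D) := le_mul_of_one_le_left (by positivity)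
    (by linarith)
  have f3_le {x : ℝ} (hx : x ∈ Ih) :
      |thetaDeriv3 q l h h1 h2 f x| ≤ 16 * Q * (16 * Q * (8 * Q * D)) :=
    (abs_thetaDeriv3_le hx (hl.trans (D_le.trans le_QD)) ((H.bdd2 x hx).trans (D_le.trans le_QD))
      ((f1_le hx).trans le_QD) (f2_le hx)).trans (by gcongr; linarith)
  obtain ⟨F, e0, e1, -, -, hF⟩ := M1.exists_of_hasDerivAt hε' f_deriv
    (continuousOn_thetaDeriv H.cont fun x hx => (f_deriv x hx).continuousAt.continuousWithinAt)
    (fun x => hasDerivAt_thetaDeriv H f_deriv) (fun x => hasDerivAt_thetaDeriv2 H f_deriv)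
    (continuousOn_thetaDeriv3 H f_deriv) (C₀ := D)
    (fun x hx => (abs_le_mul_wt_neg hx).2 ((hf x hx).trans_eq (by ring_nf)))
    (fun x hx => (abs_le_mul_wt_neg hx).2 (abs_thetaDeriv_le hε H.bdd0 hl hf hx))
    (fun x => f2_le) (fun x => f3_le)
  refine ⟨F, e0, e1, hF.trans ?_⟩
  have hQ3 : Q ≤ Q ^ 3 := le_self_pow₀ hQ1 (by norm_num)
  have hQ23 : Q ^ 2 ≤ Q ^ 3 := pow_le_pow_right₀ hQ1 (by norm_num)
  calc _ = (1 + 4 * Q + 128 * Q ^ 2 + 2048 * Q ^ 3) * D := by rw [hQ]; ring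
    _ ≤ (20 * Q) ^ 3 * D := by
        rw [mul_pow]
        gcongr
        linarith

end Regularity

lemma ThetaData.mono {C D : ℝ} {h h1 h2 : ℝ → ℝ} (H : ThetaData ε C h h1 h2) (hCD : C ≤ D) :
    ThetaData ε D h h1 h2 where
  cont := H.cont
  deriv1 := H.deriv1
  deriv2 := H.deriv2
  cont2 := H.cont2
  bdd0 x hx := (H.bdd0 x hx).trans (mul_le_mul_of_nonneg_right hCD (wt_pos _ x hx).le)
  bdd1 x hx := (H.bdd1 x hx).trans hCD
  bdd2 x hx := (H.bdd2 x hx).trans hCD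

lemma exists_thetaSol (hq : GoodExp ε q) :
    ∃ K : ℝ, 0 ≤ K ∧ ∀ (C : ℝ) (h h1 h2 : ℝ → ℝ), ThetaData ε C h h1 h2 →
      ∃ f : M1 ε, ThetaSol q f h ∧ ‖f‖ ≤ K * C := by
  obtain ⟨K, hK, hex⟩ := exists_hasDerivAt_thetaDeriv hq
  refine ⟨(20 * (1 + ‖q‖)) ^ 3 * (1 + K), by positivity, fun C h h1 h2 H => ?_⟩
  have hC : 0 ≤ C := (abs_nonneg _).trans (H.bdd1 0 zero_mem_Ih)
  obtain ⟨f, l, l_le, f_le, f_deriv⟩ := hex C h H.cont H.bdd0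
  have KC_le : K * C ≤ (1 + K) * C := by gcongr; linarith
  obtain ⟨F, e0, e1, hF⟩ := exists_M1_of_thetaDeriv hq.pos hq.lt_half
    (H.mono (le_mul_of_one_le_left hC (by linarith) : C ≤ (1 + K) * C)) (l_le.trans KC_le)
    (fun x hx => (f_le x hx).trans (mul_le_mul_of_nonneg_right KC_le (wt_pos _ x hx).le)) f_deriv
  refine ⟨F, ⟨l, fun x hx => ?_⟩, hF.trans_eq (by ring)⟩
  rw [e0 hx, e1 hx, thetaDeriv, mul_div_cancel₀ _ (one_sub_sq_pos hx).ne']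
  ring

end ThetaEquation

section PhiEquation

variable {ε : ℝ} {q : ℝ × ℝ}

lemma exists_M2_of_hasDerivAt (hε : 0 < ε) (q : ℝ × ℝ) :
    ∃ K : ℝ, 0 ≤ K ∧ ∀ (C : ℝ) (g r : ℝ → ℝ),
      (∀ x ∈ I1, HasDerivAt g ((r x - aff q x * g x) / (1 - x ^ 2)) x) → ContinuousOn r I1 →
      (∀ x ∈ I1, |g x| ≤ C * wt (-(1 + ε)) x) → (∀ x ∈ I1, |r x| ≤ C * wt (-(1 + ε)) x) →
      ∃ G : M2 ε, EqOn G.fn (fun x => ∫ t in (0 : ℝ)..x, g t) I1 ∧ EqOn (deriv G.fn) g I1 ∧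
        PhiSol q G r ∧ ‖G‖ ≤ K * C := by
  obtain ⟨K, hK, hI⟩ := exists_abs_integral_zero_le (s := -(1 + ε)) (r := -(1 + ε)) (by linarith)
    (by linarith)
  refine ⟨K + 1 + (1 + 4 * ‖q‖), by positivity, fun C g r g_deriv hr g_le r_le => ?_⟩
  have hg : ContinuousOn g I1 := fun x hx => (g_deriv x hx).continuousAt.continuousWithinAt
  have g_int_le : ∀ x ∈ I1, |∫ t in (0 : ℝ)..x, g t| ≤ C * K * wt (-ε) x := fun x hx => by
    rw [wt_eq_jacobi _ hx, show -ε = -(1 + ε) + 1 by ring]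
    exact hI g C (fun t ht => by rw [← wt_eq_jacobi _ ht]; exact g_le t ht) x hx
  have g'_le : ∀ x ∈ I1, |(r x - aff q x * g x) / (1 - x ^ 2)|
      ≤ (1 + 4 * ‖q‖) * C * wt (-(2 + ε)) x := fun x hx => by
    have hp := one_sub_sq_pos hx
    have split : wt (-(1 + ε)) x = wt (-(2 + ε)) x * (1 - x ^ 2) := by
      rw [← wt_one, ← wt_add _ _ hx]; congr 1; ring
    rw [abs_div, abs_of_pos hp, div_le_iff₀ hp, mul_assoc, ← split]
    calc |r x - aff q x * g x| ≤ |r x| + |aff q x| * |g x| := by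
          rw [← abs_mul]; exact abs_sub _ _
      _ ≤ C * wt (-(1 + ε)) x + 4 * ‖q‖ * (C * wt (-(1 + ε)) x) := by
          gcongr
          exacts [r_le x hx, abs_aff_le q hx, g_le x hx]
      _ = _ := by ring
  have hg' : ContinuousOn (fun x => (r x - aff q x * g x) / (1 - x ^ 2)) I1 :=
    .div (hr.sub (.mul (by fun_prop) hg)) (by fun_prop) fun x hx => (one_sub_sq_pos hx).ne'
  obtain ⟨G, f0, f1, f2, hG⟩ := M2.exists_of_hasDerivAt
    (fun x hx => hasDerivAt_integral (a := 0) hg (by simp) hx) g_deriv hg'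
    (fun x hx => (abs_le_mul_wt_neg hx).2 (g_int_le x hx))
    (fun x hx => (abs_le_mul_wt_neg hx).2 (g_le x hx))
    (fun x hx => (abs_le_mul_wt_neg hx).2 (g'_le x hx))
  refine ⟨G, f0, f1, fun x hx => ?_, hG.trans_eq (by ring)⟩
  rw [f1 hx, f2 hx, mul_div_cancel₀ _ (one_sub_sq_pos hx).ne', sub_add_cancel]

lemma hasDerivAt_jacobi_neg_mul (q : ℝ × ℝ) {Y : ℝ → ℝ} {y' x : ℝ} (hx : x ∈ I1)
    (hY : HasDerivAt Y y' x) : HasDerivAt (fun t => jacobi (-q.1) (-q.2) t * Y t)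
      ((jacobi (1 - q.1) (1 - q.2) x * y' - aff q x * (jacobi (-q.1) (-q.2) x * Y x))
        / (1 - x ^ 2)) x := by
  refine (hasDerivAt_jacobi_mul _ _ hx hY).congr_deriv ?_
  have h := jacobi_add (-q.1) (-q.2) 1 1 hx
  rw [jacobi_one, neg_add_eq_sub, neg_add_eq_sub] at h
  have e : aff (-q.1, -q.2) x = -aff q x := by simp only [aff]; ring
  have hp := (one_sub_sq_pos hx).ne'
  rw [h, e]
  field_simp
  ring

lemma exists_phiSol (hq : GoodExp ε q) :
    ∃ K : ℝ, 0 ≤ K ∧ ∀ (C : ℝ) (r : ℝ → ℝ), ContinuousOn r I1 →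
      (∀ x ∈ I1, |r x| ≤ C * wt (-(1 + ε)) x) →
      ∃ G : M2 ε, PhiSol q G r ∧ G.fn 0 = 0 ∧ deriv G.fn 0 = 0 ∧ ‖G‖ ≤ K * C := by
  obtain ⟨K, hK, hex⟩ := exists_M2_of_hasDerivAt hq.pos q
  obtain ⟨L, hL, hI⟩ := exists_abs_integral_zero_le (s := q.1 - 2 - ε) (r := q.2 - 2 - ε)
    (by linarith [hq.fst_lt]) (by linarith [hq.snd_lt])
  refine ⟨K * (1 + L), by positivity, fun C r hr r_le => ?_⟩
  set n : ℝ → ℝ := fun t => jacobi (q.1 - 1) (q.2 - 1) t * r t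
  have hn : ContinuousOn n I1 := (continuousOn_jacobi _ _).mul hr
  have n_le : ∀ x ∈ I1, |n x| ≤ C * jacobi (q.1 - 2 - ε) (q.2 - 2 - ε) x := fun x hx => by
    have h := r_le x hx
    rw [wt_eq_jacobi _ hx] at h
    exact abs_jacobi_mul_le (by ring) (by ring) hx h
  have hC := nonneg_of_abs_le_jacobi n_le
  have r_eq : ∀ x ∈ I1, jacobi (1 - q.1) (1 - q.2) x * n x = r x := fun x hx => by
    rw [← mul_assoc, ← jacobi_add _ _ _ _ hx, sub_add_sub_cancel, sub_add_sub_cancel, sub_self,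
      jacobi_zero, one_mul]
  obtain ⟨G, f0, f1, hG, hGn⟩ := hex (C * (1 + L))
    (fun x => jacobi (-q.1) (-q.2) x * ∫ t in (0 : ℝ)..x, n t) r
    (fun x hx => by
      have h := hasDerivAt_jacobi_neg_mul q hx (hasDerivAt_integral (a := 0) hn (by simp) hx)
      rwa [r_eq x hx] at h)
    hr
    (fun x hx => by
      rw [wt_eq_jacobi _ hx]
      refine (abs_jacobi_mul_le (s' := -(1 + ε)) (r' := -(1 + ε)) (by ring) (by ring) hx
        (hI n C n_le x hx)).trans ?_
      have := (jacobi_pos (-(1 + ε)) (-(1 + ε)) hx).le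
      gcongr
      linarith)
    (fun x hx => (r_le x hx).trans <| by
      have := (wt_pos (-(1 + ε)) x hx).le
      gcongr
      exact le_mul_of_one_le_right hC (by linarith))
  exact ⟨G, hG, by simp [f0 zero_mem_I1], by simp [f1 zero_mem_I1], hGn.trans_eq (by ring)⟩

lemma exists_phiSol_zero (hq : GoodExp ε q) :
    ∃ H : M2 ε, EqOn H.fn (fun x => ∫ t in (0 : ℝ)..x, jacobi (-q.1) (-q.2) t) I1 ∧
      PhiSol q H 0 ∧ H.fn 0 = 0 ∧ deriv H.fn 0 = 1 := by
  obtain ⟨K, -, hex⟩ := exists_M2_of_hasDerivAt hq.pos q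
  obtain ⟨L, hL, L_le⟩ := jacobi_le_jacobi (s := -q.1) (r := -q.2) (s' := -(1 + ε))
    (r' := -(1 + ε)) (by linarith [hq.fst_lt]) (by linarith [hq.snd_lt])
  obtain ⟨G, f0, f1, hG, -⟩ := hex L (jacobi (-q.1) (-q.2)) 0
    (fun x hx => by simpa using hasDerivAt_jacobi_neg_mul q hx (hasDerivAt_const x (1 : ℝ)))
    continuousOn_const
    (fun x hx => by
      rw [abs_of_pos (jacobi_pos _ _ hx), wt_eq_jacobi _ hx]
      exact L_le x hx)
    (fun x hx => by simpa using mul_nonneg hL.le (wt_pos (-(1 + ε)) x hx).le)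
  exact ⟨G, f0, hG, by simp [f0 zero_mem_I1], by simp [f1 zero_mem_I1, jacobi]⟩

lemma eq_of_hasDerivAt_zero {z : ℝ → ℝ} (hz : ∀ x ∈ I1, HasDerivAt z 0 x) {x : ℝ} (hx : x ∈ I1) :
    z x = z 0 :=
  isOpen_I1.is_const_of_deriv_eq_zero (convex_Ioo _ _).isPreconnected
    (fun y hy => (hz y hy).differentiableAt.differentiableWithinAt) (fun y hy => (hz y hy).deriv)
    hx zero_mem_I1

lemma PhiSol.eq_zero {G : M2 ε} (h : PhiSol q G 0) (h0 : G.fn 0 = 0) (h1 : deriv G.fn 0 = 0) :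
    G = 0 := by
  have deriv_mul : ∀ x ∈ I1, HasDerivAt (fun x => jacobi q.1 q.2 x * deriv G.fn x) 0 x :=
    fun x hx => by
      refine (hasDerivAt_jacobi_mul _ _ hx (G.hasDerivAt_deriv hx)).congr_deriv ?_
      have hp := (one_sub_sq_pos hx).ne'
      have hGx : _ = (0 : ℝ) := h x hx
      field_simp
      linear_combination jacobi q.1 q.2 x * hGx
  have deriv_zero : ∀ x ∈ I1, deriv G.fn x = 0 := fun x hx => by
    have := eq_of_hasDerivAt_zero deriv_mul hx
    rw [h1, mul_zero] at this
    exact (mul_eq_zero.1 this).resolve_left (jacobi_pos _ _ hx).ne'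
  refine M2.ext_on fun x hx => ?_
  rw [eq_of_hasDerivAt_zero (z := G.fn) (fun y hy => deriv_zero y hy ▸ G.hasDerivAt hy) hx, h0]
  rfl

end PhiEquation

/-! ### Iterated primitives -/

/-- The primitive of `u` vanishing at `0`. -/
def primitive (u : ℝ → ℝ) (x : ℝ) : ℝ := ∫ t in (0 : ℝ)..x, u t

/-- The function `F` minus the affine function with the same values at `±1`. The constants `ĉ₁`,
`ĉ₂` of the theorem absorb this affine function for `F = ψ[Ũ_φ]`. -/
def subChord (F : ℝ → ℝ) (x : ℝ) : ℝ := F x - (1 / 2) * F (-1) * (1 - x) - (1 / 2) * F 1 * (1 + x)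

section Primitive

variable {u v : ℝ → ℝ} {x : ℝ}

lemma mem_I1_of_mem_uIoo {t : ℝ} (hx : x ∈ Icc (-1 : ℝ) 1) (ht : t ∈ uIoo 0 x) : t ∈ I1 := by
  rcases le_total 0 x with h | h
  · rw [uIoo_of_le h] at ht; exact ⟨by linarith [ht.1], ht.2.trans_le hx.2⟩
  · rw [uIoo_of_ge h] at ht; exact ⟨hx.1.trans_lt ht.1, by linarith [ht.2]⟩

lemma I1_subset_Icc : I1 ⊆ Icc (-1 : ℝ) 1 := Ioo_subset_Icc_self

lemma eqOn_primitive (h : EqOn u v I1) : EqOn (primitive u) (primitive v) (Icc (-1) 1) :=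
  fun _ hx => intervalIntegral.integral_congr_uIoo fun _ ht => h (mem_I1_of_mem_uIoo hx ht)

lemma primitive_const_mul (c : ℝ) (u : ℝ → ℝ) :
    primitive (fun t => c * u t) = fun x => c * primitive u x :=
  funext fun _ => intervalIntegral.integral_const_mul c u

lemma hasDerivAt_primitive (hu : ContinuousOn u I1) (hx : x ∈ I1) :
    HasDerivAt (primitive u) (u x) x :=
  hasDerivAt_integral hu (by simp) hx

lemma continuousOn_primitive (hu : ContinuousOn u I1) : ContinuousOn (primitive u) I1 := fun _ hx =>
  (hasDerivAt_primitive hu hx).continuousAt.continuousWithinAt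

lemma eqOn_primitive_add (hu : ContinuousOn u I1) (hv : ContinuousOn v I1) :
    EqOn (primitive fun t => u t + v t) (fun x => primitive u x + primitive v x) I1 := fun _ hx =>
  intervalIntegral.integral_add (intervalIntegrable_I1 hu zero_mem_I1 hx)
    (intervalIntegrable_I1 hv zero_mem_I1 hx)

lemma eqOn_subChord {F G : ℝ → ℝ} (h : EqOn F G (Icc (-1) 1)) :
    EqOn (subChord F) (subChord G) (Icc (-1) 1) := fun x hx => by
  simp only [subChord, h hx, h (left_mem_Icc.2 (by norm_num : (-1 : ℝ) ≤ 1)),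
    h (right_mem_Icc.2 (by norm_num : (-1 : ℝ) ≤ 1))]

lemma subChord_add (F G : ℝ → ℝ) (x : ℝ) :
    subChord (fun t => F t + G t) x = subChord F x + subChord G x := by
  simp only [subChord]; ring

lemma subChord_const_mul (c : ℝ) (F : ℝ → ℝ) (x : ℝ) :
    subChord (fun t => c * F t) x = c * subChord F x := by
  simp only [subChord]; ring

lemma hasDerivAt_subChord {F : ℝ → ℝ} {F' : ℝ} (hF : HasDerivAt F F' x) :
    HasDerivAt (subChord F) (F' + (F (-1) - F 1) / 2) x :=
  ((hF.sub (((hasDerivAt_id' x).const_sub 1).const_mul _)).sub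
    (((hasDerivAt_id' x).const_add 1).const_mul _)).congr_deriv (by ring)

lemma abs_sub_half_mul_sub_le {a y s t A W : ℝ} (hy : 0 ≤ y) (hyW : y ≤ W) (ha : |a| ≤ A * W)
    (hs : |s| ≤ A) (ht : |t| ≤ A) : |a - y * ((s - t) / 2)| ≤ 2 * A * W := by
  have hW := hy.trans hyW
  have slope : |(s - t) / 2| ≤ A := by
    rw [abs_div, abs_two]
    linarith [abs_sub s t]
  calc |a - y * ((s - t) / 2)| ≤ |a| + y * |(s - t) / 2| := by
        rw [← abs_of_nonneg hy, ← abs_mul, abs_of_nonneg hy]; exact abs_sub _ _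
    _ ≤ A * W + W * A := by gcongr
    _ = _ := by ring

lemma abs_subChord_primitive_le {r A : ℝ} (hr : r ≤ 0) (hu : ContinuousOn u I1)
    (left_int : IntervalIntegrable u volume (-1) 0) (right_int : IntervalIntegrable u volume 0 1)
    (left_le : ∀ x ∈ I1, x ≤ 0 → |∫ t in (-1 : ℝ)..x, u t| ≤ A * wt (r + 1) x)
    (right_le : ∀ x ∈ I1, 0 ≤ x → |∫ t in x..1, u t| ≤ A * wt (r + 1) x)
    (F_left : |primitive u (-1)| ≤ A) (F_right : |primitive u 1| ≤ A) (hx : x ∈ I1) :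
    |subChord (primitive u) x| ≤ 2 * A * wt (r + 1) x := by
  have i0 := intervalIntegrable_I1 hu zero_mem_I1 hx
  have le_wt : 1 - x ^ 2 ≤ wt (r + 1) x := by
    rw [← wt_one]; exact wt_anti (by linarith) hx
  rcases le_total x 0 with hx0 | hx0
  · have add : -primitive u (-1) + primitive u x = ∫ t in (-1 : ℝ)..x, u t := by
      rw [primitive, ← intervalIntegral.integral_symm]
      exact intervalIntegral.integral_add_adjacent_intervals left_int i0
    have e : subChord (primitive u) x
        = (∫ t in (-1 : ℝ)..x, u t) - (1 + x) * ((primitive u 1 - primitive u (-1)) / 2) := by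
      rw [← add, subChord]; ring
    rw [e]
    exact abs_sub_half_mul_sub_le (one_add_pos hx).le (le_trans (by nlinarith [hx.1]) le_wt)
      (left_le x hx hx0) F_right F_left
  · have add : primitive u x + ∫ t in x..1, u t = primitive u 1 :=
      intervalIntegral.integral_add_adjacent_intervals i0 (i0.symm.trans right_int)
    have e : subChord (primitive u) x
        = -((∫ t in x..1, u t) - (1 - x) * ((primitive u 1 - primitive u (-1)) / 2)) := by
      rw [subChord, eq_sub_of_add_eq add]; ring
    rw [e, abs_neg]
    exact abs_sub_half_mul_sub_le (one_sub_pos hx).le (le_trans (by nlinarith [hx.2]) le_wt)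
      (right_le x hx hx0) F_right F_left

lemma exists_abs_subChord_primitive_le {r : ℝ} (hr : -1 < r) (hr0 : r ≤ 0) :
    ∃ K : ℝ, 0 ≤ K ∧ ∀ (u : ℝ → ℝ) (C : ℝ), ContinuousOn u I1 → (∀ x ∈ I1, |u x| ≤ C * wt r x) →
      IntervalIntegrable u volume (-1) 1 ∧ |primitive u (-1)| ≤ K * C ∧ |primitive u 1| ≤ K * C ∧
        ∀ x ∈ I1, |subChord (primitive u) x| ≤ 2 * (K * C) * wt (r + 1) x := by
  obtain ⟨K, hK, h⟩ := exists_abs_integral_endpoint_le hr hr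
  refine ⟨K, hK, fun u C hu u_le => ?_⟩
  obtain ⟨left_int, right_int, left_le, right_le⟩ := h u C hu fun x hx => by
    rw [← wt_eq_jacobi _ hx]; exact u_le x hx
  have left_le' : ∀ x ∈ I1, x ≤ 0 → |∫ t in (-1 : ℝ)..x, u t| ≤ K * C * wt (r + 1) x :=
    fun x hx hx0 => by rw [wt_eq_jacobi _ hx, mul_comm K]; exact left_le x hx hx0
  have right_le' : ∀ x ∈ I1, 0 ≤ x → |∫ t in x..1, u t| ≤ K * C * wt (r + 1) x :=
    fun x hx hx0 => by rw [wt_eq_jacobi _ hx, mul_comm K]; exact right_le x hx hx0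
  have wt_zero : wt (r + 1) 0 = 1 := by simp [wt]
  have F_left : |primitive u (-1)| ≤ K * C := by
    rw [primitive, intervalIntegral.integral_symm, abs_neg]
    exact (left_le' 0 zero_mem_I1 le_rfl).trans_eq (by rw [wt_zero, mul_one])
  have F_right : |primitive u 1| ≤ K * C :=
    (right_le' 0 zero_mem_I1 le_rfl).trans_eq (by rw [wt_zero, mul_one])
  exact ⟨left_int.trans right_int, F_left, F_right, fun x hx => abs_subChord_primitive_le hr0 hu
    left_int right_int left_le' right_le' F_left F_right hx⟩

end Primitive

section ThreefoldPrimitive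

variable {ε : ℝ}

lemma exists_abs_primitive_primitive_le (hε : 0 < ε) :
    ∃ K : ℝ, 0 ≤ K ∧ ∀ (u : ℝ → ℝ) (C : ℝ), (∀ x ∈ I1, |u x| ≤ C * wt (-(2 + 2 * ε)) x) →
      (∀ x ∈ I1, |primitive u x| ≤ K * C * wt (-(1 + 2 * ε)) x) ∧
        ∀ x ∈ I1, |primitive (primitive u) x| ≤ K * C * wt (-(2 * ε)) x := by
  obtain ⟨K, hK, h⟩ := exists_abs_integral_zero_le (s := -(2 + 2 * ε)) (r := -(2 + 2 * ε))
    (by linarith) (by linarith)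
  obtain ⟨L, hL, h'⟩ := exists_abs_integral_zero_le (s := -(1 + 2 * ε)) (r := -(1 + 2 * ε))
    (by linarith) (by linarith)
  rw [show -(2 + 2 * ε) + 1 = -(1 + 2 * ε) by ring] at h
  rw [show -(1 + 2 * ε) + 1 = -(2 * ε) by ring] at h'
  refine ⟨K + K * L, by positivity, fun u C hu => ?_⟩
  have hC : 0 ≤ C := nonneg_of_mul_nonneg_left ((abs_nonneg _).trans (hu 0 zero_mem_I1))
    (wt_pos _ 0 zero_mem_I1)
  have b1 := h u C fun x hx => by rw [← wt_eq_jacobi _ hx]; exact hu x hx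
  refine ⟨fun x hx => (b1 x hx).trans ?_, fun x hx => (h' _ _ b1 x hx).trans ?_⟩
  all_goals
    rw [wt_eq_jacobi _ hx]
    refine mul_le_mul_of_nonneg_right ?_ (jacobi_pos _ _ hx).le
  · nlinarith [mul_nonneg (mul_nonneg hK hL) hC]
  · nlinarith [mul_nonneg hK hC]

lemma intervalIntegrable_primitive_primitive (hε : 0 < ε) (hε' : ε < 1 / 2) {u : ℝ → ℝ} {C : ℝ}
    (hu : ContinuousOn u I1) (u_le : ∀ x ∈ I1, |u x| ≤ C * wt (-(2 + 2 * ε)) x) {x : ℝ}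
    (hx : x ∈ Icc (-1) 1) : IntervalIntegrable (primitive (primitive u)) volume 0 x := by
  obtain ⟨K, -, h⟩ := exists_abs_primitive_primitive_le hε
  obtain ⟨L, -, h'⟩ := exists_abs_subChord_primitive_le (r := -(2 * ε)) (by linarith) (by linarith)
  refine (h' _ _ (continuousOn_primitive (continuousOn_primitive hu))
    (h u C u_le).2).1.mono_set ?_
  rw [uIcc_of_le (by norm_num : (-1 : ℝ) ≤ 1)]
  exact uIcc_subset_Icc (by norm_num) hx

lemma eqOn_primitive_primitive_primitive_add (hε : 0 < ε) (hε' : ε < 1 / 2) {u v : ℝ → ℝ}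
    {C D : ℝ} (hu : ContinuousOn u I1) (u_le : ∀ x ∈ I1, |u x| ≤ C * wt (-(2 + 2 * ε)) x)
    (hv : ContinuousOn v I1) (v_le : ∀ x ∈ I1, |v x| ≤ D * wt (-(2 + 2 * ε)) x) :
    EqOn (primitive (primitive (primitive fun t => u t + v t)))
      (fun x => primitive (primitive (primitive u)) x + primitive (primitive (primitive v)) x)
      (Icc (-1) 1) := by
  have e1 := (eqOn_primitive (eqOn_primitive_add hu hv)).mono I1_subset_Icc
  have e2 := e1.trans (eqOn_primitive_add (continuousOn_primitive hu) (continuousOn_primitive hv))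
  exact (eqOn_primitive e2).trans fun x hx => intervalIntegral.integral_add
    (intervalIntegrable_primitive_primitive hε hε' hu u_le hx)
    (intervalIntegrable_primitive_primitive hε hε' hv v_le hx)

lemma wt_neg_le_two_rpow {p n : ℝ} (hp : 0 ≤ p) (hpn : p ≤ n) {x : ℝ} (hx : x ∈ Ih) :
    wt (-p) x ≤ 2 ^ n :=
  (wt_mid _ hx).trans <| by
    rw [abs_neg, abs_of_nonneg hp]
    exact Real.rpow_le_rpow_of_exponent_le one_le_two hpn

lemma exists_thetaData_subChord (hε : 0 < ε) (hε' : ε < 1 / 2) :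
    ∃ K : ℝ, 0 ≤ K ∧ ∀ (C : ℝ) (u : ℝ → ℝ), ContinuousOn u I1 →
      (∀ x ∈ I1, |u x| ≤ C * wt (-(2 + 2 * ε)) x) →
      ThetaData ε (K * C) (subChord (primitive (primitive (primitive u))))
        (fun x => primitive (primitive u) x + (primitive (primitive (primitive u)) (-1)
          - primitive (primitive (primitive u)) 1) / 2) (primitive u) := by
  obtain ⟨K, hK, h⟩ := exists_abs_primitive_primitive_le hε
  obtain ⟨L, hL, h'⟩ := exists_abs_subChord_primitive_le (r := -(2 * ε)) (by linarith) (by linarith)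
  refine ⟨2 * L * K + 2 * K + 4 * K, by positivity, fun C u hu u_le => ?_⟩
  have hC : 0 ≤ C := nonneg_of_mul_nonneg_left ((abs_nonneg _).trans (u_le 0 zero_mem_I1))
    (wt_pos _ 0 zero_mem_I1)
  have hKC := mul_nonneg hK hC
  have hLKC := mul_nonneg hL hKC
  have c1 := continuousOn_primitive hu
  have c2 := continuousOn_primitive c1
  obtain ⟨b1, b2⟩ := h u C u_le
  obtain ⟨-, F_left, F_right, b3⟩ := h' _ _ c2 b2
  refine ⟨fun x hx => (hasDerivAt_subChord (hasDerivAt_primitive c2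
      hx)).continuousAt.continuousWithinAt,
    fun x hx => hasDerivAt_subChord (hasDerivAt_primitive c2 (Ih_subset_I1 hx)),
    fun x hx => (hasDerivAt_primitive c1 (Ih_subset_I1 hx)).add_const _,
    c1.mono Ih_subset_I1, fun x hx => ?_, fun x hx => ?_, fun x hx => ?_⟩
  · have hw := wt_pos (1 - 2 * ε) x hx
    have := b3 x hx
    rw [neg_add_eq_sub] at this
    refine this.trans (mul_le_mul_of_nonneg_right ?_ hw.le)
    nlinarith
  · have k2 : |primitive (primitive u) x| ≤ K * C * 2 := (b2 x (Ih_subset_I1 hx)).trans <| by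
      gcongr
      simpa only [Real.rpow_one] using
        wt_neg_le_two_rpow (p := 2 * ε) (n := 1) (by linarith) (by linarith) hx
    have slope := abs_sub (primitive (primitive (primitive u)) (-1))
      (primitive (primitive (primitive u)) 1)
    refine (abs_add_le _ _).trans ?_
    rw [abs_div, abs_two]
    nlinarith
  · have k1 : |primitive u x| ≤ K * C * 4 := (b1 x (Ih_subset_I1 hx)).trans <| by
      gcongr
      refine (wt_neg_le_two_rpow (n := 2) (by linarith) (by linarith) hx).trans_eq ?_
      norm_num
    nlinarith

end ThreefoldPrimitive

section PsiIntegrand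

variable {ε : ℝ}

/-- The integrand of `ψ`, polarized. -/
def psiIntegrand (G H : M2 ε) (s : ℝ) : ℝ := 2 * G.fn s * deriv H.fn s / (1 - s ^ 2)

/-- The bilinear form whose quadratic form is `ψ`. -/
def psiForm (G H : M2 ε) : ℝ → ℝ := primitive (primitive (primitive (psiIntegrand G H)))

lemma psi_fn (G : M2 ε) : psi G.fn = psiForm G G := rfl

lemma continuousOn_psiIntegrand (G H : M2 ε) : ContinuousOn (psiIntegrand G H) I1 :=
  ((continuousOn_const.mul G.continuousOn).mul H.continuousOn_deriv).div (by fun_prop)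
    fun _ hx => (one_sub_sq_pos hx).ne'

lemma abs_psiIntegrand_le (G H : M2 ε) {x : ℝ} (hx : x ∈ I1) :
    |psiIntegrand G H x| ≤ 2 * ‖G‖ * ‖H‖ * wt (-(2 + 2 * ε)) x := by
  have hG := (abs_le_mul_wt_neg hx).1 (G.abs_wt_mul_fn_le hx)
  have hH := (abs_le_mul_wt_neg hx).1 (H.abs_wt_mul_deriv_le hx)
  have hp := one_sub_sq_pos hx
  have hw := (wt_pos (-ε) x hx).le
  have split : wt (-(2 + 2 * ε)) x * (1 - x ^ 2) = wt (-ε) x * wt (-(1 + ε)) x := by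
    rw [← wt_one, ← wt_add _ _ hx, ← wt_add _ _ hx]; congr 1; ring
  rw [psiIntegrand, abs_div, abs_of_pos hp, div_le_iff₀ hp, mul_assoc (2 * ‖G‖ * ‖H‖), split,
    abs_mul, abs_mul, abs_two]
  calc 2 * |G.fn x| * |deriv H.fn x| ≤ 2 * (‖G‖ * wt (-ε) x) * (‖H‖ * wt (-(1 + ε)) x) := by gcongr
    _ = _ := by ring

lemma subChord_psiForm_of_add (hε : 0 < ε) (hε' : ε < 1 / 2) {G H G₁ H₁ G₂ H₂ : M2 ε}
    (h : EqOn (psiIntegrand G H) (fun x => psiIntegrand G₁ H₁ x + psiIntegrand G₂ H₂ x) I1)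
    {x : ℝ} (hx : x ∈ I1) :
    subChord (psiForm G H) x = subChord (psiForm G₁ H₁) x + subChord (psiForm G₂ H₂) x := by
  have e1 := (eqOn_primitive h).mono I1_subset_Icc
  have e3 := eqOn_primitive ((eqOn_primitive e1).mono I1_subset_Icc)
  rw [← subChord_add]
  exact eqOn_subChord (e3.trans (eqOn_primitive_primitive_primitive_add hε hε'
    (continuousOn_psiIntegrand _ _) (fun _ => abs_psiIntegrand_le _ _)
    (continuousOn_psiIntegrand _ _) fun _ => abs_psiIntegrand_le _ _)) (I1_subset_Icc hx)

lemma subChord_psiForm_of_const_mul {c : ℝ} {G H G₁ H₁ : M2 ε}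
    (h : psiIntegrand G H = fun x => c * psiIntegrand G₁ H₁ x) (x : ℝ) :
    subChord (psiForm G H) x = c * subChord (psiForm G₁ H₁) x := by
  simp only [psiForm, h, primitive_const_mul, subChord_const_mul]

end PsiIntegrand

section Algebra

variable {ε : ℝ} {q : ℝ × ℝ}

lemma M1.fn_zero : (0 : M1 ε).fn = 0 := rfl

lemma M2.fn_zero : (0 : M2 ε).fn = 0 := rfl

lemma M1.deriv_add (f g : M1 ε) {x : ℝ} (hx : x ∈ I1) :
    deriv (f + g).fn x = deriv f.fn x + deriv g.fn x :=
  ((f.hasDerivAt hx).add (g.hasDerivAt hx)).deriv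

lemma M1.deriv_smul (t : ℝ) (f : M1 ε) (x : ℝ) : deriv (t • f).fn x = t * deriv f.fn x :=
  deriv_const_smul_field t f.fn

lemma M2.deriv_add (f g : M2 ε) {x : ℝ} (hx : x ∈ I1) :
    deriv (f + g).fn x = deriv f.fn x + deriv g.fn x :=
  ((f.hasDerivAt hx).add (g.hasDerivAt hx)).deriv

lemma M2.deriv_smul (t : ℝ) (f : M2 ε) (x : ℝ) : deriv (t • f).fn x = t * deriv f.fn x :=
  deriv_const_smul_field t f.fn

lemma M2.iteratedDeriv_two_add (f g : M2 ε) {x : ℝ} (hx : x ∈ I1) :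
    iteratedDeriv 2 (f + g).fn x = iteratedDeriv 2 f.fn x + iteratedDeriv 2 g.fn x :=
  iteratedDeriv_add (f.mem.cd le_rfl x hx) (g.mem.cd le_rfl x hx)

lemma M2.iteratedDeriv_two_smul (t : ℝ) (f : M2 ε) (x : ℝ) :
    iteratedDeriv 2 (t • f).fn x = t * iteratedDeriv 2 f.fn x := by
  rw [M2.fn_smul, iteratedDeriv_const_smul_field, smul_eq_mul]

lemma M2.abs_fn_zero_le (G : M2 ε) : |G.fn 0| ≤ ‖G‖ := by
  simpa [wt] using G.abs_wt_mul_fn_le zero_mem_I1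

lemma M2.abs_deriv_zero_le (G : M2 ε) : |deriv G.fn 0| ≤ ‖G‖ := by
  simpa [wt] using G.abs_wt_mul_deriv_le zero_mem_I1

/-- Evaluation at `0` on `M2 ε`. -/
def M2.evalZero (ε : ℝ) : M2 ε →L[ℝ] ℝ :=
  LinearMap.mkContinuous
    { toFun := fun G => G.fn 0, map_add' := fun _ _ => rfl, map_smul' := fun _ _ => rfl } 1
    fun G => by rw [one_mul]; exact G.abs_fn_zero_le

/-- The derivative at `0` on `M2 ε`. -/
def M2.derivZero (ε : ℝ) : M2 ε →L[ℝ] ℝ :=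
  LinearMap.mkContinuous
    { toFun := fun G => deriv G.fn 0
      map_add' := fun G G' => M2.deriv_add G G' zero_mem_I1
      map_smul' := fun t G => M2.deriv_smul t G 0 } 1
    fun G => by rw [one_mul]; exact G.abs_deriv_zero_le

lemma M2.evalZero_apply (G : M2 ε) : M2.evalZero ε G = G.fn 0 := rfl

lemma M2.derivZero_apply (G : M2 ε) : M2.derivZero ε G = deriv G.fn 0 := rfl

lemma M1.abs_fn_le_wt (f : M1 ε) {x : ℝ} (hx : x ∈ I1) : |f.fn x| ≤ ‖f‖ * wt (1 - 2 * ε) x := by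
  have := (abs_le_mul_wt_neg hx).1 (f.abs_wt_mul_fn_le hx)
  rwa [show -(-1 + 2 * ε) = 1 - 2 * ε by ring] at this

lemma M1.abs_fn_le (hε : ε < 1 / 2) (f : M1 ε) {x : ℝ} (hx : x ∈ I1) : |f.fn x| ≤ ‖f‖ :=
  abs_le_of_abs_le_mul_wt (by linarith) hx (f.abs_fn_le_wt hx)

namespace ThetaSol

variable {f f' : M1 ε} {h h' : ℝ → ℝ}

lemma congr (H : ThetaSol q f h) (e : EqOn h h' I1) : ThetaSol q f h' := by
  obtain ⟨l, hl⟩ := H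
  exact ⟨l, fun x hx => by rw [hl x hx, e hx]⟩

lemma add (H : ThetaSol q f h) (H' : ThetaSol q f' h') :
    ThetaSol q (f + f') (fun x => h x + h' x) := by
  obtain ⟨l, hl⟩ := H
  obtain ⟨l', hl'⟩ := H'
  refine ⟨l + l', fun x hx => ?_⟩
  rw [M1.deriv_add _ _ hx, M1.fn_add, Pi.add_apply]
  linear_combination hl x hx + hl' x hx

lemma smul (t : ℝ) (H : ThetaSol q f h) : ThetaSol q (t • f) (fun x => t * h x) := by
  obtain ⟨l, hl⟩ := H
  refine ⟨t * l, fun x hx => ?_⟩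
  rw [M1.deriv_smul, M1.fn_smul, Pi.smul_apply, smul_eq_mul]
  linear_combination t * hl x hx

lemma neg (H : ThetaSol q f h) : ThetaSol q (-f) (fun x => -h x) := by
  simpa only [neg_one_smul, neg_one_mul] using H.smul (-1)

lemma unique (hq : GoodExp ε q) (H : ThetaSol q f h) (H' : ThetaSol q f' h) : f = f' :=
  eq_of_sub_eq_zero <| ThetaSol.eq_zero hq <| by
    rw [sub_eq_add_neg]
    exact (H.add H'.neg).congr fun x _ => add_neg_cancel (h x)

lemma iff_eq (hq : GoodExp ε q) (H : ThetaSol q f' h) : ThetaSol q f h ↔ f = f' :=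
  ⟨fun H' => H'.unique hq H, fun e => e ▸ H⟩

end ThetaSol

namespace PhiSol

variable {G G' : M2 ε} {r r' : ℝ → ℝ}

lemma congr (H : PhiSol q G r) (e : EqOn r r' I1) : PhiSol q G r' := fun x hx => by
  rw [H x hx, e hx]

lemma add (H : PhiSol q G r) (H' : PhiSol q G' r') : PhiSol q (G + G') (fun x => r x + r' x) :=
  fun x hx => by
    rw [M2.iteratedDeriv_two_add _ _ hx, M2.deriv_add _ _ hx]
    linear_combination H x hx + H' x hx

lemma smul (t : ℝ) (H : PhiSol q G r) : PhiSol q (t • G) (fun x => t * r x) := fun x hx => by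
  rw [M2.iteratedDeriv_two_smul, M2.deriv_smul]
  linear_combination t * H x hx

lemma neg (H : PhiSol q G r) : PhiSol q (-G) (fun x => -r x) := by
  simpa only [neg_one_smul, neg_one_mul] using H.smul (-1)

lemma unique (H : PhiSol q G r) (H' : PhiSol q G' r) (h0 : M2.evalZero ε G = M2.evalZero ε G')
    (h1 : M2.derivZero ε G = M2.derivZero ε G') : G = G' := by
  refine eq_of_sub_eq_zero (PhiSol.eq_zero (q := q) ?_ ?_ ?_)
  · rw [sub_eq_add_neg]
    exact (H.add H'.neg).congr fun x _ => add_neg_cancel (r x)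
  · rw [← M2.evalZero_apply, map_sub, h0, sub_self]
  · rw [← M2.derivZero_apply, map_sub, h1, sub_self]

end PhiSol

end Algebra

/-! ### Bilinear solution operators -/

section Bilinear

variable {ε C A : ℝ} {q : ℝ × ℝ} {h h1 h2 a a1 a2 : ℝ → ℝ}

lemma ThetaData.mul_left (hε : ε < 1 / 2) (H : ThetaData ε C h h1 h2) (ha : ContinuousOn a I1)
    (ha1 : ∀ x ∈ Ih, HasDerivAt a (a1 x) x) (ha2 : ∀ x ∈ Ih, HasDerivAt a1 (a2 x) x)
    (ha2c : ContinuousOn a2 Ih) (a_le : ∀ x ∈ I1, |a x| ≤ A) (a1_le : ∀ x ∈ Ih, |a1 x| ≤ A)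
    (a2_le : ∀ x ∈ Ih, |a2 x| ≤ A) :
    ThetaData ε (4 * (A * C)) (fun x => a x * h x) (fun x => a1 x * h x + a x * h1 x)
      (fun x => a2 x * h x + a1 x * h1 x + (a1 x * h1 x + a x * h2 x)) := by
  have hA := (abs_nonneg _).trans (a_le 0 zero_mem_I1)
  have hC := (abs_nonneg _).trans (H.bdd1 0 zero_mem_Ih)
  have h_le : ∀ x ∈ Ih, |h x| ≤ C := fun x hx =>
    abs_le_of_abs_le_mul_wt (by linarith) (Ih_subset_I1 hx) (H.bdd0 x (Ih_subset_I1 hx))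
  have mul_le {y z D : ℝ} (hy : |y| ≤ A) (hz : |z| ≤ D) : |y * z| ≤ A * D := by
    rw [abs_mul]; gcongr
  have hAC := mul_nonneg hA hC
  refine ⟨ha.mul H.cont, fun x hx => (ha1 x hx).mul (H.deriv1 x hx),
    fun x hx => ((ha2 x hx).mul (H.deriv1 x hx)).add ((ha1 x hx).mul (H.deriv2 x hx)),
    ?_, fun x hx => ?_, fun x hx => ?_, fun x hx => ?_⟩
  · have c0 := H.cont.mono Ih_subset_I1
    have c1 : ContinuousOn h1 Ih := HasDerivAt.continuousOn H.deriv2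
    have c2 := H.cont2
    have d0 := ha.mono Ih_subset_I1
    have d1 : ContinuousOn a1 Ih := HasDerivAt.continuousOn ha2
    fun_prop
  · have hw := (wt_pos (1 - 2 * ε) x hx).le
    refine (mul_le (a_le x hx) (H.bdd0 x hx)).trans ?_
    nlinarith [mul_nonneg hAC hw]
  · refine (abs_add_le _ _).trans ?_
    linarith [mul_le (a1_le x hx) (h_le x hx), mul_le (a_le x (Ih_subset_I1 hx)) (H.bdd1 x hx)]
  · refine (abs_add_le _ _).trans
      ((add_le_add (abs_add_le _ _) (abs_add_le _ _)).trans ?_)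
    linarith [mul_le (a2_le x hx) (h_le x hx), mul_le (a1_le x hx) (H.bdd1 x hx),
      mul_le (a_le x (Ih_subset_I1 hx)) (H.bdd2 x hx)]

lemma M1.abs_deriv_le (hε : 0 < ε) (hε' : ε < 1 / 2) (f : M1 ε) {x : ℝ} (hx : x ∈ Ih) :
    |deriv f.fn x| ≤ 2 * ‖f‖ := by
  have two_rpow : wt (-(2 * ε)) x ≤ 2 := (wt_mid _ hx).trans <| by
    rw [abs_neg, abs_of_nonneg (by linarith)]
    simpa only [Real.rpow_one] using
      Real.rpow_le_rpow_of_exponent_le one_le_two (by linarith : 2 * ε ≤ 1)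
  calc |deriv f.fn x| ≤ ‖f‖ * wt (-(2 * ε)) x :=
        (abs_le_mul_wt_neg (Ih_subset_I1 hx)).1 (f.abs_wt_mul_deriv_le (Ih_subset_I1 hx))
    _ ≤ ‖f‖ * 2 := by gcongr
    _ = 2 * ‖f‖ := mul_comm _ _

lemma M1.thetaData (hε : 0 < ε) (hε' : ε < 1 / 2) (f : M1 ε) :
    ThetaData ε (2 * ‖f‖) f.fn (deriv f.fn) (iteratedDeriv 2 f.fn) where
  cont := f.continuousOn
  deriv1 _ hx := f.hasDerivAt (Ih_subset_I1 hx)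
  deriv2 _ hx := f.hasDerivAt_deriv hx
  cont2 := HasDerivAt.continuousOn fun _ hx => f.hasDerivAt_iteratedDeriv_two hx
  bdd0 x hx := (f.abs_fn_le_wt hx).trans <|
    mul_le_mul_of_nonneg_right (by linarith [norm_nonneg f]) (wt_pos _ x hx).le
  bdd1 _ hx := f.abs_deriv_le hε hε' hx
  bdd2 _ hx := (f.abs_iteratedDeriv_two_le hx).trans (by linarith [norm_nonneg f])

lemma exists_thetaData_mul (hε : 0 < ε) (hε' : ε < 1 / 2) (v : (ℝ × ℝ) × M1 ε) (f : M1 ε) :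
    ∃ h1 h2, ThetaData ε (40 * ‖v‖ * ‖f‖)
      (fun x => (aff v.1 x + (1 / 2) * v.2.fn x) * f.fn x) h1 h2 := by
  have hv1 : ‖v.1‖ ≤ ‖v‖ := norm_fst_le v
  have hv2 : ‖v.2‖ ≤ ‖v‖ := norm_snd_le v
  have hv := norm_nonneg v
  have abs_half (y : ℝ) : |1 / 2 * y| = 1 / 2 * |y| := by rw [abs_mul, abs_of_pos one_half_pos]
  have a_deriv : ∀ x ∈ I1, HasDerivAt (fun x => aff v.1 x + (1 / 2) * v.2.fn x)
      (-(v.1.1 + v.1.2) + (1 / 2) * deriv v.2.fn x) x := fun x hx =>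
    (hasDerivAt_aff v.1 x).add ((v.2.hasDerivAt hx).const_mul _)
  have H := (f.thetaData hε hε').mul_left hε' (HasDerivAt.continuousOn a_deriv) (A := 5 * ‖v‖)
    (fun x hx => a_deriv x (Ih_subset_I1 hx))
    (fun x hx => ((v.2.hasDerivAt_deriv hx).const_mul (1 / 2)).const_add (-(v.1.1 + v.1.2)))
    (continuousOn_const.mul <| HasDerivAt.continuousOn fun _ hx =>
      v.2.hasDerivAt_iteratedDeriv_two hx)
    (fun x hx => (abs_add_le _ _).trans <| by
      rw [abs_half]; linarith [abs_aff_le v.1 hx, v.2.abs_fn_le hε' hx])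
    (fun x hx => (abs_add_le _ _).trans <| by
      rw [abs_half, abs_neg]
      linarith [abs_fst_add_snd_le v.1, v.2.abs_deriv_le hε hε' hx])
    (fun x hx => by rw [abs_half]; linarith [v.2.abs_iteratedDeriv_two_le hx])
  exact ⟨_, _, H.mono (le_of_eq (by ring))⟩

lemma exists_bilinear_thetaSol_mul (hq : GoodExp ε q) :
    ∃ T : ((ℝ × ℝ) × M1 ε) →L[ℝ] M1 ε →L[ℝ] M1 ε, ∀ v f g,
      ThetaSol q g (fun x => (aff v.1 x + (1 / 2) * v.2.fn x) * f.fn x) ↔ g = T v f := by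
  obtain ⟨K, -, hex⟩ := exists_thetaSol hq
  refine exists_bilinear_of_relation _ (K * 40) (fun v f => ?_)
    (fun h h' => h.unique hq h') (fun h h' => (h.add h').congr fun x _ => ?_)
    (fun t _ _ _ h => (h.smul t).congr fun x _ => ?_)
    (fun h h' => (h.add h').congr fun x _ => ?_)
    (fun t _ _ _ h => (h.smul t).congr fun x _ => ?_)
  · obtain ⟨h1, h2, H⟩ := exists_thetaData_mul hq.pos hq.lt_half v f
    obtain ⟨g, hg, hgn⟩ := hex _ _ _ _ H
    exact ⟨g, hg, hgn.trans_eq (by ring)⟩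
  · simp only [Prod.fst_add, Prod.snd_add, aff_add, M1.fn_add, Pi.add_apply]; ring
  · simp only [Prod.smul_fst, Prod.smul_snd, aff_smul, M1.fn_smul, Pi.smul_apply, smul_eq_mul]; ring
  · simp only [M1.fn_add, Pi.add_apply]; ring
  · simp only [M1.fn_smul, Pi.smul_apply, smul_eq_mul]; ring

lemma exists_thetaData_psiForm (hε : 0 < ε) (hε' : ε < 1 / 2) :
    ∃ K : ℝ, ∀ G H : M2 ε, ∃ h1, ThetaData ε (K * ‖G‖ * ‖H‖) (subChord (psiForm G H)) h1
      (primitive (psiIntegrand G H)) := by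
  obtain ⟨K, -, h⟩ := exists_thetaData_subChord hε hε'
  refine ⟨K * 2, fun G H => ⟨_, (h _ _ (continuousOn_psiIntegrand G H)
    fun x hx => abs_psiIntegrand_le G H hx).mono (le_of_eq (by ring))⟩⟩

lemma exists_bilinear_thetaSol_psiForm (hq : GoodExp ε q) :
    ∃ T : M2 ε →L[ℝ] M2 ε →L[ℝ] M1 ε, ∀ G H g,
      ThetaSol q g (subChord (psiForm G H)) ↔ g = T G H := by
  obtain ⟨K, -, hex⟩ := exists_thetaSol hq
  obtain ⟨L, hL⟩ := exists_thetaData_psiForm hq.pos hq.lt_half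
  have add_eq {G H G₁ H₁ G₂ H₂ : M2 ε} := subChord_psiForm_of_add hq.pos hq.lt_half
    (G := G) (H := H) (G₁ := G₁) (H₁ := H₁) (G₂ := G₂) (H₂ := H₂)
  refine exists_bilinear_of_relation _ (K * L) (fun G H => ?_)
    (fun h h' => h.unique hq h')
    (fun h h' => (h.add h').congr fun x hx => (add_eq (fun y _ => ?_) hx).symm)
    (fun t _ _ _ h => (h.smul t).congr fun x _ =>
      (subChord_psiForm_of_const_mul (funext fun y => ?_) x).symm)
    (fun h h' => (h.add h').congr fun x hx => (add_eq (fun y hy => ?_) hx).symm)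
    (fun t _ _ _ h => (h.smul t).congr fun x _ =>
      (subChord_psiForm_of_const_mul (funext fun y => ?_) x).symm)
  · obtain ⟨h1, H⟩ := hL G H
    obtain ⟨g, hg, hn⟩ := hex _ _ _ _ H
    exact ⟨g, hg, hn.trans_eq (by ring)⟩
  · simp only [psiIntegrand, M2.fn_add, Pi.add_apply]; ring
  · simp only [psiIntegrand, M2.fn_smul, Pi.smul_apply, smul_eq_mul]; ring
  · simp only [psiIntegrand, M2.deriv_add _ _ hy]; ring
  · simp only [psiIntegrand, M2.deriv_smul]; ring

lemma exists_bilinear_phiSol_mul (hq : GoodExp ε q) :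
    ∃ T : ((ℝ × ℝ) × M1 ε) →L[ℝ] M2 ε →L[ℝ] M2 ε, ∀ v G H,
      (PhiSol q H (fun x => (aff v.1 x + v.2.fn x) * deriv G.fn x) ∧ M2.evalZero ε H = 0
        ∧ M2.derivZero ε H = 0) ↔ H = T v G := by
  obtain ⟨K, -, hex⟩ := exists_phiSol hq
  refine exists_bilinear_of_relation _ (K * 5) (fun v G => ?_)
    (fun ⟨h, h0, h1⟩ ⟨h', h0', h1'⟩ => h.unique h' (h0.trans h0'.symm) (h1.trans h1'.symm))
    (fun ⟨h, h0, h1⟩ ⟨h', h0', h1'⟩ => ⟨(h.add h').congr fun x _ => ?_,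
      by rw [map_add, h0, h0', add_zero], by rw [map_add, h1, h1', add_zero]⟩)
    (fun t _ _ _ ⟨h, h0, h1⟩ => ⟨(h.smul t).congr fun x _ => ?_,
      by rw [map_smul, h0, smul_zero], by rw [map_smul, h1, smul_zero]⟩)
    (fun ⟨h, h0, h1⟩ ⟨h', h0', h1'⟩ => ⟨(h.add h').congr fun x hx => ?_,
      by rw [map_add, h0, h0', add_zero], by rw [map_add, h1, h1', add_zero]⟩)
    (fun t _ _ _ ⟨h, h0, h1⟩ => ⟨(h.smul t).congr fun x _ => ?_,
      by rw [map_smul, h0, smul_zero], by rw [map_smul, h1, smul_zero]⟩)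
  · have hv1 : ‖v.1‖ ≤ ‖v‖ := norm_fst_le v
    have hv2 : ‖v.2‖ ≤ ‖v‖ := norm_snd_le v
    have a_le : ∀ x ∈ I1, |aff v.1 x + v.2.fn x| ≤ 5 * ‖v‖ := fun x hx =>
      (abs_add_le _ _).trans (by linarith [abs_aff_le v.1 hx, v.2.abs_fn_le hq.lt_half hx])
    obtain ⟨H, hH, h0, h1, hn⟩ := hex (5 * ‖v‖ * ‖G‖)
      (fun x => (aff v.1 x + v.2.fn x) * deriv G.fn x)
      (((continuous_aff v.1).continuousOn.add v.2.continuousOn).mul G.continuousOn_deriv)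
      (fun x hx => by
        rw [abs_mul, mul_assoc]
        exact mul_le_mul (a_le x hx) ((abs_le_mul_wt_neg hx).1 (G.abs_wt_mul_deriv_le hx))
          (abs_nonneg _) (by positivity))
    exact ⟨H, ⟨hH, h0, h1⟩, hn.trans_eq (by ring)⟩
  · simp only [Prod.fst_add, Prod.snd_add, aff_add, M1.fn_add, Pi.add_apply]; ring
  · simp only [Prod.smul_fst, Prod.smul_snd, aff_smul, M1.fn_smul, Pi.smul_apply, smul_eq_mul]; ring
  · simp only [M2.deriv_add _ _ hx]; ring
  · simp only [M2.deriv_smul]; ring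

end Bilinear

/-! ### The nonlinear equations -/

section Nonlinear

variable {ε : ℝ} {q : ℝ × ℝ}

lemma exists_eqOn_one (hε : 0 < ε) : ∃ J : M2 ε, EqOn J.fn 1 I1 ∧ EqOn (deriv J.fn) 0 I1 ∧
    EqOn (iteratedDeriv 2 J.fn) 0 I1 := by
  obtain ⟨J, h0, h1, h2, -⟩ := M2.exists_of_hasDerivAt (ε := ε) (C₀ := 1) (C₁ := 0) (C₂ := 0)
    (fun x _ => hasDerivAt_const x (1 : ℝ)) (fun x _ => hasDerivAt_const x (0 : ℝ))
    continuousOn_const (fun x hx => by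
      rw [mul_one, abs_of_pos (wt_pos ε x hx)]
      simpa [wt] using wt_anti (r := ε) (s := 0) hε.le hx) (by simp) (by simp)
  exact ⟨J, h0, h1, h2⟩

/-- `H` and `J` are the solutions of `(1 - x²) G'' + aff q G' = 0` with `H(0) = 0`, `H'(0) = 1` and
`J(0) = 1`, `J'(0) = 0`. -/
structure IsFundamentalSystem (q : ℝ × ℝ) (H J : M2 ε) : Prop where
  phiSol_fst : PhiSol q H 0
  phiSol_snd : PhiSol q J 0
  evalZero_fst : M2.evalZero ε H = 0
  derivZero_fst : M2.derivZero ε H = 1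
  evalZero_snd : M2.evalZero ε J = 1
  derivZero_snd : M2.derivZero ε J = 0

lemma exists_isFundamentalSystem (hq : GoodExp ε q) : ∃ H J : M2 ε, IsFundamentalSystem q H J ∧
    EqOn H.fn (fun x => ∫ t in (0 : ℝ)..x, jacobi (-q.1) (-q.2) t) I1 ∧ EqOn J.fn 1 I1 := by
  obtain ⟨H, hHfn, hH, hH0, hH1⟩ := exists_phiSol_zero hq
  obtain ⟨J, hJ, hJ1, hJ2⟩ := exists_eqOn_one hq.pos
  refine ⟨H, J, ⟨hH, fun x hx => ?_, hH0, hH1, hJ zero_mem_I1, hJ1 zero_mem_I1⟩, hHfn, hJ⟩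
  simp only [hJ1 hx, hJ2 hx, Pi.zero_apply, mul_zero, add_zero]

lemma IsFundamentalSystem.phiSol_iff {H J G₀ : M2 ε} (hHJ : IsFundamentalSystem q H J)
    {r : ℝ → ℝ} (h : PhiSol q G₀ r) (h0 : M2.evalZero ε G₀ = 0) (h1 : M2.derivZero ε G₀ = 0)
    (s t : ℝ) (G : M2 ε) :
    PhiSol q G r ∧ M2.derivZero ε G = s ∧ M2.evalZero ε G = t ↔ G = s • H + t • J + G₀ := by
  have sol : PhiSol q (s • H + t • J + G₀) r :=
    (((hHJ.phiSol_fst.smul s).add (hHJ.phiSol_snd.smul t)).add h).congr fun x _ => by simp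
  have deriv_eq : M2.derivZero ε (s • H + t • J + G₀) = s := by
    simp [hHJ.derivZero_fst, hHJ.derivZero_snd, h1]
  have eval_eq : M2.evalZero ε (s • H + t • J + G₀) = t := by
    simp [hHJ.evalZero_fst, hHJ.evalZero_snd, h0]
  refine ⟨fun ⟨hG, hs, ht⟩ => hG.unique sol (ht.trans eval_eq.symm) (hs.trans deriv_eq.symm), ?_⟩
  rintro rfl
  exact ⟨sol, deriv_eq, eval_eq⟩

/-- The equations for the deviation `z = (f, G)` from the no-swirl solution `aff e.1`, up to the
choice of the constants `ĉ`, together with the values `e.2` of `G'` and `G` at `0`. -/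
structure IsDeviation (e : (ℝ × ℝ) × Beta) (z : M1 ε × M2 ε) : Prop where
  theta_eq : ThetaSol e.1 z.1 fun x => -((1 / 2) * z.1.fn x ^ 2 + subChord (psiForm z.2 z.2) x)
  phi_eq : PhiSol e.1 z.2 fun x => -(z.1.fn x * deriv z.2.fn x)
  derivZero_eq : M2.derivZero ε z.2 = e.2 0
  evalZero_eq : M2.evalZero ε z.2 = e.2 1

lemma isDeviation_iff {p : ℝ × ℝ} {β : Beta} {f : M1 ε} {G : M2 ε} :
    IsDeviation (p, β) (f, G) ↔
      ThetaSol p f (fun x => -((1 / 2) * f.fn x ^ 2 + subChord (psiForm G G) x)) ∧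
      PhiSol p G (fun x => -(f.fn x * deriv G.fn x)) ∧
      M2.derivZero ε G = β 0 ∧ M2.evalZero ε G = β 1 :=
  ⟨fun ⟨h, h', h1, h0⟩ => ⟨h, h', h1, h0⟩, fun ⟨h, h', h1, h0⟩ => ⟨h, h', h1, h0⟩⟩

lemma isDeviation_zero (q : ℝ × ℝ) : IsDeviation (q, 0) (0 : M1 ε × M2 ε) where
  theta_eq := ⟨0, fun x _ => by
    have psiForm_zero : psiForm (0 : M2 ε) 0 = 0 := by
      ext; simp [psiForm, primitive, psiIntegrand, M2.fn_zero]
    simp [psiForm_zero, subChord, M1.fn_zero]⟩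
  phi_eq x _ := by simp [M2.fn_zero]
  derivZero_eq := map_zero _
  evalZero_eq := map_zero _

lemma thetaSol_iff_shift (p q : ℝ × ℝ) (f : M1 ε) (h : ℝ → ℝ) :
    ThetaSol p f h ↔ ThetaSol q f fun x => h x - aff (p - q) x * f.fn x :=
  exists_congr fun l => forall₂_congr fun x _ => by
    simp only [aff_sub]
    constructor <;> intro h <;> linear_combination h

lemma phiSol_iff_shift (p q : ℝ × ℝ) (G : M2 ε) (r : ℝ → ℝ) :
    PhiSol p G r ↔ PhiSol q G fun x => r x - aff (p - q) x * deriv G.fn x :=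
  forall₂_congr fun x _ => by
    simp only [aff_sub]
    constructor <;> intro h <;> linear_combination h

lemma hasFDerivAt_bilinear_of_zero {A B C D : Type*} [NormedAddCommGroup A] [NormedSpace ℝ A]
    [NormedAddCommGroup B] [NormedSpace ℝ B] [NormedAddCommGroup C] [NormedSpace ℝ C]
    [NormedAddCommGroup D] [NormedSpace ℝ D] (T : A →L[ℝ] B →L[ℝ] C) {u : D → A} {v : D → B} {z : D}
    (hu : DifferentiableAt ℝ u z) (hv : DifferentiableAt ℝ v z) (hu0 : u z = 0) (hv0 : v z = 0) :
    HasFDerivAt (fun y => T (u y) (v y)) (0 : D →L[ℝ] C) z := by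
  refine (T.hasFDerivAt_of_bilinear hu.hasFDerivAt hv.hasFDerivAt).congr_fderiv ?_
  ext y
  simp [hu0, hv0]

/-- The linear part `β ↦ (0, β₃ H + β₄ J)` of the branch of deviations. -/
def linPart (H J : M2 ε) : Beta →L[ℝ] M1 ε × M2 ε :=
  .prod 0 ((EuclideanSpace.proj 0).smulRight H + (EuclideanSpace.proj 1).smulRight J)

lemma linPart_apply (H J : M2 ε) (β : Beta) : linPart H J β = (0, β 0 • H + β 1 • J) := rfl

/-- The quadratic terms, including the action of `aff (e.1 - q)` on the deviation, are moved to the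
right-hand side and the linearized equations at `aff q` are solved. -/
lemma exists_fixedPointMap (hq : GoodExp ε q) {H J : M2 ε} (hHJ : IsFundamentalSystem q H J) :
    ∃ N : ((ℝ × ℝ) × Beta) × (M1 ε × M2 ε) → M1 ε × M2 ε, ContDiff ℝ ω N ∧
      HasFDerivAt N ((linPart H J ∘L .snd ℝ (ℝ × ℝ) Beta) ∘L .fst ℝ _ _) ((q, 0), 0) ∧
      ∀ e z, IsDeviation e z ↔ z = N (e, z) := by
  obtain ⟨T₁, hT₁⟩ := exists_bilinear_thetaSol_mul hq
  obtain ⟨T₂, hT₂⟩ := exists_bilinear_phiSol_mul hq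
  obtain ⟨T₃, hT₃⟩ := exists_bilinear_thetaSol_psiForm hq
  set A : ((ℝ × ℝ) × Beta) × (M1 ε × M2 ε) → (ℝ × ℝ) × M1 ε := fun y => (y.1.1 - q, y.2.1) with hA
  refine ⟨fun y => linPart H J y.1.2 +
    (-(T₁ (A y) y.2.1 + T₃ y.2.2 y.2.2), -(T₂ (A y) y.2.2)), ?_, ?_, ?_⟩
  · fun_prop
  · have hA0 : A ((q, 0), 0) = 0 := by simp [hA]
    have d₁ := hasFDerivAt_bilinear_of_zero T₁ (u := A) (v := fun y => y.2.1) (z := ((q, 0), 0))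
      (by fun_prop) (by fun_prop) hA0 rfl
    have d₂ := hasFDerivAt_bilinear_of_zero T₂ (u := A) (v := fun y => y.2.2) (z := ((q, 0), 0))
      (by fun_prop) (by fun_prop) hA0 rfl
    have d₃ := hasFDerivAt_bilinear_of_zero T₃ (D := ((ℝ × ℝ) × Beta) × (M1 ε × M2 ε))
      (u := fun y => y.2.2) (v := fun y => y.2.2) (z := ((q, 0), 0))
      (by fun_prop) (by fun_prop) rfl rfl
    refine (((linPart H J ∘L .snd ℝ (ℝ × ℝ) Beta) ∘L .fst ℝ _ _).hasFDerivAt.add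
      ((d₁.add d₃).neg.prodMk d₂.neg)).congr_fderiv ?_
    ext y <;> simp
  · rintro ⟨p, β⟩ ⟨f, G⟩
    have theta := (((hT₁ (p - q, f) f _).2 rfl).add ((hT₃ G G _).2 rfl)).neg
    obtain ⟨phi, eval_eq, deriv_eq⟩ := (hT₂ (p - q, f) G _).2 rfl
    have theta_iff := theta.iff_eq hq (f := f)
    have phi_iff := hHJ.phiSol_iff phi.neg (by rw [map_neg, eval_eq, neg_zero])
      (by rw [map_neg, deriv_eq, neg_zero]) (β 0) (β 1) G
    rw [isDeviation_iff, thetaSol_iff_shift p q, phiSol_iff_shift p q]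
    simp only [hA, linPart_apply, Prod.mk_add_mk, zero_add, Prod.mk.injEq, ← theta_iff, ← phi_iff]
    refine and_congr (iff_of_eq ?_) (and_congr_left' (iff_of_eq ?_)) <;> congr 1 <;> ext x <;> ring

lemma exists_isBranchOn_isDeviation (hε : ε < 1 / 2) {Q : Set (ℝ × ℝ)} (hQ : IsCompact Q)
    (hgood : ∀ q ∈ Q, GoodExp ε q) :
    ∃ r > 0, ∃ δ > 0, ∃ (O : Set (ℝ × ℝ)) (w : (ℝ × ℝ) × Beta → M1 ε × M2 ε), Q ⊆ O ∧ IsOpen O ∧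
      IsBranchOn IsDeviation r (O ×ˢ ball 0 δ) w := by
  have := M1.completeSpace hε
  obtain ⟨r, hr, S, w, hQS, hw⟩ := exists_isBranchOn_of_isCompact
    (Sol := IsDeviation (ε := ε)) (hQ.prod (isCompact_singleton (x := (0 : Beta))))
    (by rintro ⟨q, _⟩ ⟨-, rfl⟩; exact isDeviation_zero q)
    (by
      rintro ⟨q, _⟩ ⟨hq, rfl⟩
      obtain ⟨H, J, hHJ, -⟩ := exists_isFundamentalSystem (hgood q hq)
      obtain ⟨N, hN, hN', hiff⟩ := exists_fixedPointMap (hgood q hq) hHJ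
      have hsol : IsDeviation = fun e z => z = N (e, z) := by ext e z; exact hiff e z
      rw [hsol]
      exact exists_isBranchOn_fixedPoint hN ((hiff _ _).1 (isDeviation_zero q)).symm
        (by rw [hN'.fderiv]; ext <;> simp))
  obtain ⟨O, B, hO, hB, hQO, hB0, hOB⟩ :=
    generalized_tube_lemma hQ isCompact_singleton hw.isOpen hQS
  obtain ⟨δ, hδ, hδB⟩ := Metric.isOpen_iff.1 hB 0 (hB0 rfl)
  exact ⟨r, hr, δ, hδ, O, w, hQO, hO,
    hw.mono (hO.prod isOpen_ball) ((prod_mono_right hδB).trans hOB)⟩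

lemma IsBranchOn.hasFDerivAt_isDeviation {r : ℝ} {U : Set ((ℝ × ℝ) × Beta)}
    {w : (ℝ × ℝ) × Beta → M1 ε × M2 ε} (hw : IsBranchOn IsDeviation r U w) (hq : GoodExp ε q)
    (hqU : (q, 0) ∈ U) {H J : M2 ε} (hHJ : IsFundamentalSystem q H J) :
    HasFDerivAt w (linPart H J ∘L .snd ℝ (ℝ × ℝ) Beta) (q, 0) := by
  obtain ⟨N, -, hN', hiff⟩ := exists_fixedPointMap hq hHJ
  refine hw.hasFDerivAt hiff hqU ?_
  rwa [hw.eq_zero hqU (isDeviation_zero q)]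

end Nonlinear

/-! ### The no-swirl solutions with `c₃ = c̄₃(c₁, c₂)` -/

section Riccati

variable {Y F : ℝ → ℝ} {κ : ℝ}

lemma nonpos_of_riccati (hκ : 0 < κ) (hF : ∀ s, κ ≤ F s)
    (hY : ∀ s, HasDerivAt Y (-(1 / 2) * Y s ^ 2 * F s) s) (s₀ : ℝ) : Y s₀ ≤ 0 := by
  by_contra! hpos
  have hanti : Antitone Y := antitone_of_hasDerivAt_nonpos hY fun s => by
    have : 0 ≤ Y s ^ 2 * F s := mul_nonneg (sq_nonneg _) (hκ.le.trans (hF s))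
    simp only [Pi.zero_apply]
    linarith
  have hp : ∀ s ≤ s₀, 0 < Y s := fun s hs => hpos.trans_le (hanti hs)
  -- `1 / Y` grows at rate at least `κ / 2`, so it would reach `0` at a finite time before `s₀`.
  have hd : ∀ s ≤ s₀, HasDerivAt (fun s => (Y s)⁻¹ - κ / 2 * s) (F s / 2 - κ / 2) s := by
    intro s hs
    have hn := (hp s hs).ne'
    refine (((hY s).inv hn).sub ((hasDerivAt_id' s).const_mul (κ / 2))).congr_deriv ?_
    field_simp
  have hmono : MonotoneOn (fun s => (Y s)⁻¹ - κ / 2 * s) (Iic s₀) := by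
    refine monotoneOn_of_deriv_nonneg (convex_Iic _)
      (fun s hs => (hd s hs).continuousAt.continuousWithinAt) ?_ ?_ <;> rw [interior_Iic]
    · exact fun s hs => (hd s (le_of_lt hs)).differentiableAt.differentiableWithinAt
    · exact fun s hs => by rw [(hd s (le_of_lt hs)).deriv]; linarith [hF s]
  set s₁ := s₀ - 2 * (Y s₀)⁻¹ / κ with hs₁
  have hle : s₁ ≤ s₀ := by
    have : 0 < (Y s₀)⁻¹ := inv_pos.2 hpos
    exact sub_le_self _ (by positivity)
  have hgrowth : (Y s₁)⁻¹ - κ / 2 * s₁ ≤ (Y s₀)⁻¹ - κ / 2 * s₀ := hmono hle self_mem_Iic hle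
  have hs₁' : κ / 2 * s₁ = κ / 2 * s₀ - (Y s₀)⁻¹ := by rw [hs₁]; field_simp
  linarith [inv_pos.2 (hp s₁ hle)]

lemma eq_zero_of_riccati (hκ : 0 < κ) (hF : ∀ s, κ ≤ F s)
    (hY : ∀ s, HasDerivAt Y (-(1 / 2) * Y s ^ 2 * F s) s) (s₀ : ℝ) : Y s₀ = 0 := by
  refine le_antisymm (nonpos_of_riccati hκ hF hY s₀) ?_
  have h := nonpos_of_riccati (Y := fun s => -Y (-s)) (F := fun s => F (-s)) hκ (fun s => hF (-s))
    (fun s => (((hY (-s)).comp s (hasDerivAt_neg s)).neg).congr_deriv (by ring)) (-s₀)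
  simpa only [neg_neg, Left.neg_nonpos_iff] using h

end Riccati

lemma hasDerivAt_tanh (s : ℝ) : HasDerivAt Real.tanh (1 - Real.tanh s ^ 2) s := by
  have hc := (Real.cosh_pos s).ne'
  refine (((Real.hasDerivAt_sinh s).fun_div (Real.hasDerivAt_cosh s) hc).congr_of_eventuallyEq
    (Eventually.of_forall Real.tanh_eq_sinh_div_cosh)).congr_deriv ?_
  rw [Real.tanh_eq_sinh_div_cosh]
  field_simp

lemma tanh_mem_I1 (s : ℝ) : Real.tanh s ∈ I1 := ⟨Real.neg_one_lt_tanh s, Real.tanh_lt_one s⟩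

section NoSwirl

variable {c : Fin 3 → ℝ} {q : ℝ × ℝ} {u : ℝ → ℝ}

lemma IsNoSwirl.hasDerivAt (hu : IsNoSwirl c u) {x : ℝ} (hx : x ∈ I1) :
    HasDerivAt u (deriv u x) x :=
  ((hu.smooth.contDiffAt (isOpen_I1.mem_nhds hx)).differentiableAt (by simp)).hasDerivAt

lemma contDiff_aff (q : ℝ × ℝ) {n : ℕ∞ω} : ContDiff ℝ n (aff q) := by
  unfold aff; fun_prop

lemma isNoSwirl_aff (h₁ : c 0 = (q.1 - 1) ^ 2 - 1) (h₂ : c 1 = (q.2 - 1) ^ 2 - 1)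
    (h₃ : c 2 = -(1 / 2) * (q.1 + q.2 - 2) * (q.1 + q.2)) : IsNoSwirl c (aff q) where
  smooth := (contDiff_aff q).contDiffOn
  eq x _ := by
    rw [(hasDerivAt_aff q x).deriv, P, h₁, h₂, h₃, aff]
    ring

-- The integrating factor removes the linear part of the equation for the difference `u - aff q`.
lemma IsNoSwirl.hasDerivAt_jacobi_mul_sub (hq : IsNoSwirl c (aff q)) (hu : IsNoSwirl c u) {x : ℝ}
    (hx : x ∈ I1) :
    HasDerivAt (fun x => jacobi (q.1 - 1) (q.2 - 1) x * (u x - aff q x))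
      (-(1 / 2) * (jacobi (q.1 - 1) (q.2 - 1) x * (u x - aff q x)) ^ 2
        * jacobi (-q.1) (-q.2) x) x := by
  refine (hasDerivAt_jacobi_mul (q.1 - 1) (q.2 - 1) hx
    ((hu.hasDerivAt hx).sub (hq.hasDerivAt hx))).congr_deriv ?_
  have hp := (one_sub_sq_pos hx).ne'
  have hw : jacobi (q.1 - 1) (q.2 - 1) x * jacobi (-q.1) (-q.2) x = (1 - x ^ 2)⁻¹ := by
    rw [← jacobi_add _ _ _ _ hx, ← jacobi_one, ← jacobi_neg _ _ hx]
    congr 1 <;> ring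
  rw [aff_sub_one, mul_pow, sq (jacobi _ _ x)]
  calc _ = jacobi (q.1 - 1) (q.2 - 1) x * (-(1 / 2) * (u x - aff q x) ^ 2 * (1 - x ^ 2)⁻¹) := by
        rw [Pi.sub_apply]
        field_simp
        linear_combination 2 * jacobi (q.1 - 1) (q.2 - 1) x * (hu.eq x hx - hq.eq x hx)
    _ = _ := by rw [← hw]; ring

lemma IsNoSwirl.eqOn_aff (hq : IsNoSwirl c (aff q)) (h1 : 1 ≤ q.1) (h2 : 1 ≤ q.2)
    (hu : IsNoSwirl c u) : EqOn u (aff q) I1 := by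
  obtain ⟨K, hK, hw⟩ := jacobi_le_jacobi (s := 0) (r := 0) (s' := 1 - q.1) (r' := 1 - q.2)
    (by linarith) (by linarith)
  set y : ℝ → ℝ := fun x => jacobi (q.1 - 1) (q.2 - 1) x * (u x - aff q x)
  have hcomp : ∀ s, HasDerivAt (fun s => y (Real.tanh s))
      (-(1 / 2) * y (Real.tanh s) ^ 2 * jacobi (1 - q.1) (1 - q.2) (Real.tanh s)) s := fun s => by
    refine ((hq.hasDerivAt_jacobi_mul_sub hu (tanh_mem_I1 s)).comp s
      (hasDerivAt_tanh s)).congr_deriv ?_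
    rw [← jacobi_one, mul_assoc, ← jacobi_add _ _ _ _ (tanh_mem_I1 s), neg_add_eq_sub,
      neg_add_eq_sub]
  have hlower : ∀ s, K⁻¹ ≤ jacobi (1 - q.1) (1 - q.2) (Real.tanh s) := fun s => by
    rw [inv_le_iff_one_le_mul₀' hK]
    simpa only [jacobi_zero] using hw _ (tanh_mem_I1 s)
  intro x hx
  have hyx : y x = 0 := by
    simpa only [Real.tanh_artanh hx] using
      eq_zero_of_riccati (inv_pos.2 hK) hlower hcomp (Real.artanh x)
  exact sub_eq_zero.1 ((mul_eq_zero.1 hyx).resolve_left (jacobi_pos _ _ hx).ne')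

lemma IsNoSwirl.gammaPlus_eq (hq : IsNoSwirl c (aff q)) (h1 : 1 ≤ q.1) (h2 : 1 ≤ q.2) :
    gammaPlus c = aff q 0 := by
  have : {γ | ∃ u, IsNoSwirl c u ∧ u 0 = γ} = {aff q 0} := by
    ext γ
    constructor
    · rintro ⟨u, hu, rfl⟩
      exact hq.eqOn_aff h1 h2 hu zero_mem_I1
    · rintro rfl
      exact ⟨_, hq, rfl⟩
  rw [gammaPlus, this, csSup_singleton]

end NoSwirl

/-- The no-swirl solution with parameter `p` is `q.1 (1 - x) - q.2 (1 + x)`, with `1 ≤ q.1` and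
`1 ≤ q.2`; its boundary values are `2 q.1` at `-1` and `-2 q.2` at `1`. -/
structure HasExponents (p : Param) (q : ℝ × ℝ) : Prop where
  isNoSwirl : IsNoSwirl p.1 (aff q)
  one_le_fst : 1 ≤ q.1
  one_le_snd : 1 ≤ q.2
  snd_eq : p.2 = aff q 0

namespace HasExponents

variable {p : Param} {q : ℝ × ℝ}

lemma ubar_eqOn (h : HasExponents p q) : EqOn (Ubar p) (aff q) I1 := by
  have hex : ∃ u, IsNoSwirl p.1 u ∧ u 0 = p.2 := ⟨_, h.isNoSwirl, h.snd_eq.symm⟩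
  rw [Ubar, dif_pos hex]
  exact h.isNoSwirl.eqOn_aff h.one_le_fst h.one_le_snd hex.choose_spec.1

lemma ubarLeft_eq (h : HasExponents p q) : UbarLeft p = 2 * q.1 := by
  refine Tendsto.limUnder_eq (Tendsto.congr' (f₁ := aff q) ?_ ?_)
  · filter_upwards [Ioo_mem_nhdsGT (show (-1 : ℝ) < 1 by norm_num)] with x hx
      using (h.ubar_eqOn hx).symm
  · rw [show 2 * q.1 = aff q (-1) by simp only [aff]; ring]
    exact (continuous_aff q).continuousWithinAt

lemma ubarRight_eq (h : HasExponents p q) : UbarRight p = -(2 * q.2) := by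
  refine Tendsto.limUnder_eq (Tendsto.congr' (f₁ := aff q) ?_ ?_)
  · filter_upwards [Ioo_mem_nhdsLT (show (-1 : ℝ) < 1 by norm_num)] with x hx
      using (h.ubar_eqOn hx).symm
  · rw [show -(2 * q.2) = aff q 1 by simp only [aff]; ring]
    exact (continuous_aff q).continuousWithinAt

lemma goodExp {K : Set Param} {ε : ℝ} (h : HasExponents p q) (hε : Admissible K ε) (hp : p ∈ K) :
    GoodExp ε q := by
  have h1 := h.one_le_fst
  have h2 := h.one_le_snd
  have hl := hε.left_ge p hp
  have hr := hε.right_le p hp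
  rw [h.ubarLeft_eq] at hl
  rw [h.ubarRight_eq] at hr
  exact ⟨hε.pos, hε.lt_half, h1, h2, by linarith [hl (by linarith)],
    by linarith [hr (by linarith)]⟩

lemma exp_neg_b (h : HasExponents p q) {x : ℝ} (hx : x ∈ I1) :
    Real.exp (-b p x) = jacobi (-q.1) (-q.2) x := by
  have hb : b p x = Real.log (jacobi q.1 q.2 x) := by
    have hint : b p x = ∫ s in (0 : ℝ)..x, aff q s / (1 - s ^ 2) :=
      intervalIntegral.integral_congr fun s hs => by
        simp only [h.ubar_eqOn (uIcc_subset_I1 zero_mem_I1 hx hs)]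
    have hlog : ∀ s ∈ uIcc 0 x,
        HasDerivAt (fun s => Real.log (jacobi q.1 q.2 s)) (aff q s / (1 - s ^ 2)) s := by
      intro s hs
      have hs' := uIcc_subset_I1 zero_mem_I1 hx hs
      have hw := (jacobi_pos q.1 q.2 hs').ne'
      have hd := hasDerivAt_jacobi_mul q.1 q.2 hs' (hasDerivAt_const s (1 : ℝ))
      simp only [mul_one, zero_add] at hd
      exact (hd.log hw).congr_deriv (mul_div_cancel_left₀ _ hw)
    have hlog0 : Real.log (jacobi q.1 q.2 0) = 0 := by simp [jacobi]
    rw [hint, intervalIntegral.integral_eq_sub_of_hasDerivAt hlog, hlog0, sub_zero]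
    exact intervalIntegrable_I1 ((continuous_aff q).continuousOn.div (by fun_prop)
      fun s hs => (one_sub_sq_pos hs).ne') zero_mem_I1 hx
  rw [hb, Real.exp_neg, Real.exp_log (jacobi_pos _ _ hx), jacobi_neg _ _ hx]

lemma V3_eqOn (h : HasExponents p q) :
    EqOn (V3 p).2 (fun x => ∫ t in (0 : ℝ)..x, jacobi (-q.1) (-q.2) t) I1 := fun _ hx =>
  intervalIntegral.integral_congr fun _ ht => h.exp_neg_b (uIcc_subset_I1 zero_mem_I1 hx ht)

end HasExponents

/-- The parameters `(c, γ⁺(c))` with `c₁, c₂ ≥ -1` and `c₃ = c̄₃(c₁, c₂)`, that is, with `c` in one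
of the `J_k`, `5 ≤ k ≤ 8`. -/
def criticalSet : Set Param :=
  {p | -1 ≤ p.1 0 ∧ -1 ≤ p.1 1 ∧ p.1 2 = c3bar (p.1 0) (p.1 1) ∧ p.2 = gammaPlus p.1}

lemma Ik_subset_criticalSet (k : ℕ) : Ik k ⊆ criticalSet := by
  rintro p ⟨hJ, hγ, -⟩
  unfold J at hJ
  split at hJ
  · exact ⟨hJ.1.le, hJ.2.1.le, hJ.2.2, hγ⟩
  · exact ⟨hJ.1.ge, hJ.2.1.le, hJ.2.2, hγ⟩
  · exact ⟨hJ.1.le, hJ.2.1.ge, hJ.2.2, hγ⟩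
  · exact ⟨hJ.1.ge, hJ.2.1.ge, hJ.2.2, hγ⟩
  · exact hJ.elim

/-- On `criticalSet` these are the exponents `(1 + √(1 + c₁), 1 + √(1 + c₂))` of the no-swirl
solution. Written in terms of `c₃` and `γ` they are smooth also where `c₁ = -1` or `c₂ = -1`. -/
def exponents (p : Param) : ℝ × ℝ :=
  (1 + (√(1 - 2 * p.1 2) - 1 + p.2) / 2, 1 + (√(1 - 2 * p.1 2) - 1 - p.2) / 2)

lemma continuous_exponents : Continuous exponents := by
  unfold exponents
  fun_prop

lemma isOpen_thd_lt_half : IsOpen {p : Param | p.1 2 < 1 / 2} :=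
  isOpen_lt (by fun_prop) continuous_const

lemma contDiffOn_exponents : ContDiffOn ℝ ∞ exponents {p | p.1 2 < 1 / 2} := by
  have hsqrt : ContDiffOn ℝ ∞ (fun p : Param => √(1 - 2 * p.1 2)) {p | p.1 2 < 1 / 2} :=
    ContDiffOn.sqrt (by fun_prop) fun p (hp : p.1 2 < 1 / 2) => by linarith
  unfold exponents
  fun_prop

lemma c3bar_nonpos (c₁ c₂ : ℝ) : c3bar c₁ c₂ ≤ 0 := by
  have h : 0 ≤ (√(1 + c₁) + √(1 + c₂)) * (√(1 + c₁) + √(1 + c₂) + 2) := by positivity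
  rw [c3bar]
  linarith

lemma criticalSet_subset_thd_lt_half : criticalSet ⊆ {p | p.1 2 < 1 / 2} :=
  fun p ⟨_, _, h₃, _⟩ => show p.1 2 < 1 / 2 by linarith [c3bar_nonpos (p.1 0) (p.1 1)]

lemma hasExponents_exponents {p : Param} (hp : p ∈ criticalSet) :
    HasExponents p (exponents p) := by
  obtain ⟨h₁, h₂, h₃, hγ⟩ := hp
  set q : ℝ × ℝ := (1 + √(1 + p.1 0), 1 + √(1 + p.1 1)) with hq
  have hq1 : 1 ≤ q.1 := le_add_of_nonneg_right (Real.sqrt_nonneg _)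
  have hq2 : 1 ≤ q.2 := le_add_of_nonneg_right (Real.sqrt_nonneg _)
  have hns : IsNoSwirl p.1 (aff q) := by
    refine isNoSwirl_aff ?_ ?_ (by rw [h₃, c3bar, hq]; ring) <;>
      rw [add_sub_cancel_left, Real.sq_sqrt (by linarith), add_sub_cancel_left]
  have hp2 : p.2 = aff q 0 := hγ.trans (hns.gammaPlus_eq hq1 hq2)
  have hsqrt : √(1 - 2 * p.1 2) = q.1 + q.2 - 1 := by
    rw [h₃, c3bar, show ∀ s : ℝ, 1 - 2 * (-(1 / 2) * s * (s + 2)) = (s + 1) ^ 2 by intro s; ring,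
      Real.sqrt_sq (by positivity), hq]
    ring
  have hexp : exponents p = q := by
    ext <;> simp only [exponents, hsqrt, hp2, aff] <;> ring
  rw [hexp]
  exact ⟨hns, hq1, hq2, hp2⟩

/-! ### Deviations and solutions of the equations -/

lemma deriv_eqOn_I1 {u v : ℝ → ℝ} (h : EqOn u v I1) : EqOn (deriv u) (deriv v) I1 := by
  simpa only [iteratedDeriv_one] using iteratedDeriv_eqOn (n := 1) isOpen_I1 h

lemma psi_eqOn {u v : ℝ → ℝ} (h : EqOn u v I1) : EqOn (psi u) (psi v) (Icc (-1) 1) :=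
  eqOn_primitive <| (eqOn_primitive <| (eqOn_primitive fun s hs => by
    simp only [h hs, deriv_eqOn_I1 h hs]).mono I1_subset_Icc).mono I1_subset_Icc

namespace Agree

variable {U U' U'' : Pair}

lemma symm (h : Agree U U') : Agree U' U := ⟨h.1.symm, h.2.symm⟩

lemma trans (h : Agree U U') (h' : Agree U' U'') : Agree U U'' :=
  ⟨EqOn.trans h.1 h'.1, EqOn.trans h.2 h'.2⟩

lemma sub_iff {V : Pair} : Agree (U - V) U' ↔ Agree U (V + U') := by
  simp only [Agree, EqOn, Prod.fst_sub, Prod.snd_sub, Prod.fst_add, Prod.snd_add, Pi.sub_apply,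
    Pi.add_apply, sub_eq_iff_eq_add']

lemma solvesNSE {c : Fin 3 → ℝ} (h : Agree U' U) (hU : SolvesNSE U c) : SolvesNSE U' c where
  smooth_theta := hU.smooth_theta.congr h.1
  smooth_phi := hU.smooth_phi.congr h.2
  eq_theta x hx := by
    rw [deriv_eqOn_I1 h.1 hx, h.1 hx, psi_eqOn h.2 (I1_subset_Icc hx)]
    exact hU.eq_theta x hx
  eq_phi x hx := by
    rw [iteratedDeriv_eqOn isOpen_I1 h.2 hx, deriv_eqOn_I1 h.2 hx, h.1 hx]
    exact hU.eq_phi x hx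

lemma cHat_eq (h : Agree U U') (p : Param) : cHat p U = cHat p U' := by
  have hφ : EqOn (phi p U.1) (phi p U'.1) I1 := fun x hx => by
    simp only [phi, deriv_eqOn_I1 h.1 hx, h.1 hx]
  rw [cHat, cHat, psi_eqOn h.2 (left_mem_Icc.2 (by norm_num)),
    psi_eqOn h.2 (right_mem_Icc.2 (by norm_num)), iteratedDeriv_eqOn isOpen_I1 hφ zero_mem_I1]

end Agree

lemma eq_zero_endpoints_of_abs_le_jacobi {p r C : ℝ} (hp : 0 < p) (hr : 0 < r) {y : ℝ → ℝ}
    (hy : Continuous y) (h : ∀ x ∈ I1, |y x| ≤ C * jacobi p r x) : y (-1) = 0 ∧ y 1 = 0 :=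
  have lim := tendsto_zero_of_abs_le_jacobi hp hr h
  ⟨tendsto_nhds_unique (hy.continuousWithinAt (s := Ioi (-1))) lim.1,
    tendsto_nhds_unique (hy.continuousWithinAt (s := Iio 1)) lim.2⟩

section Equivalence

variable {ε : ℝ} {p : Param} {q : ℝ × ℝ}

lemma HasExponents.phi_eq (h : HasExponents p q) (u : ℝ → ℝ) {x : ℝ} (hx : x ∈ I1) :
    phi p u x = (1 - x ^ 2) * deriv u x + (2 * x + aff q x) * u x + (1 / 2) * u x ^ 2 := by
  rw [phi, h.ubar_eqOn hx]

lemma HasExponents.theta_aff_add (h : HasExponents p q) (f : M1 ε) {x : ℝ} (hx : x ∈ I1) :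
    (1 - x ^ 2) * deriv (aff q + f.fn) x + 2 * x * (aff q + f.fn) x
      + (1 / 2) * (aff q + f.fn) x ^ 2 = P p.1 x + phi p f.fn x := by
  rw [h.phi_eq f.fn hx, ← h.isNoSwirl.eq x hx, (hasDerivAt_aff q x).deriv,
    ((hasDerivAt_aff q x).add (f.hasDerivAt hx)).deriv, Pi.add_apply]
  ring

lemma HasExponents.thetaSol_iff (h : HasExponents p q) (f : M1 ε) (G : M2 ε) :
    ThetaSol q f (fun x => -((1 / 2) * f.fn x ^ 2 + subChord (psiForm G G) x)) ↔
      ∃ l : ℝ, ∀ x ∈ I1, phi p f.fn x + subChord (psi G.fn) x = l * (1 - x ^ 2) := by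
  refine exists_congr fun l => forall₂_congr fun x hx => ?_
  rw [h.phi_eq f.fn hx, psi_fn]
  constructor <;> intro heq <;> linear_combination heq

lemma phiSol_iff_eq_zero {f : M1 ε} {G : M2 ε} :
    PhiSol q G (fun x => -(f.fn x * deriv G.fn x)) ↔
      ∀ x ∈ I1, (1 - x ^ 2) * iteratedDeriv 2 G.fn x + (aff q + f.fn) x * deriv G.fn x = 0 :=
  forall₂_congr fun x _ => by
    rw [Pi.add_apply]
    constructor <;> intro heq <;> linear_combination heq

lemma HasExponents.exists_abs_phi_le (h : HasExponents p q) (hε : ε < 1 / 2) (f : M1 ε) :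
    ∃ C : ℝ, ∀ x ∈ I1, |phi p f.fn x| ≤ C * wt (1 - 2 * ε) x := by
  refine ⟨‖f‖ + (2 + 4 * ‖q‖ + (1 / 2) * ‖f‖) * ‖f‖, fun x hx => ?_⟩
  have hf := f.abs_fn_le_wt hx
  have first_order : |(1 - x ^ 2) * deriv f.fn x| ≤ ‖f‖ * wt (1 - 2 * ε) x := by
    have hp := one_sub_sq_pos hx
    rw [abs_mul, abs_of_pos hp, sub_eq_add_neg 1 (2 * ε), wt_add _ _ hx, wt_one, mul_left_comm]
    exact mul_le_mul_of_nonneg_left ((abs_le_mul_wt_neg hx).1 (f.abs_wt_mul_deriv_le hx)) hp.le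
  have coeff : |2 * x + aff q x + (1 / 2) * f.fn x| ≤ 2 + 4 * ‖q‖ + (1 / 2) * ‖f‖ := by
    refine (abs_add_three _ _ _).trans
      (add_le_add (add_le_add (abs_le.2 ⟨?_, ?_⟩) (abs_aff_le q hx)) ?_)
    · linarith [hx.1]
    · linarith [hx.2]
    · rw [abs_mul, abs_of_pos one_half_pos]
      linarith [f.abs_fn_le hε hx]
  calc |phi p f.fn x|
      = |(1 - x ^ 2) * deriv f.fn x + (2 * x + aff q x + (1 / 2) * f.fn x) * f.fn x| := by
        rw [h.phi_eq f.fn hx]; ring_nf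
    _ ≤ ‖f‖ * wt (1 - 2 * ε) x + (2 + 4 * ‖q‖ + (1 / 2) * ‖f‖) * (‖f‖ * wt (1 - 2 * ε) x) := by
        refine (abs_add_le _ _).trans (add_le_add first_order ?_)
        rw [abs_mul]
        exact mul_le_mul coeff hf (abs_nonneg _) (by positivity)
    _ = _ := by ring

/-- Since `ψ[G]''(0) = 0`, the multiplier `l` can be read off from `φ[f]''(0)`. -/
lemma iteratedDeriv_two_phi_zero (hε : 0 < ε) (hε' : ε < 1 / 2) {f : M1 ε} {G : M2 ε} {l : ℝ}
    (hl : ∀ x ∈ I1, phi p f.fn x + subChord (psi G.fn) x = l * (1 - x ^ 2)) :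
    iteratedDeriv 2 (phi p f.fn) 0 = -(2 * l) := by
  obtain ⟨K, hK⟩ := exists_thetaData_psiForm hε hε'
  obtain ⟨h1, H⟩ := hK G G
  have quad_deriv (x : ℝ) : HasDerivAt (fun x : ℝ => l * (1 - x ^ 2)) (l * -(2 * x)) x := by
    simpa using ((hasDerivAt_pow 2 x).const_sub 1).const_mul l
  have lin_deriv (x : ℝ) : HasDerivAt (fun x : ℝ => l * -(2 * x)) (-(2 * l)) x :=
    ((((hasDerivAt_id' x).const_mul 2).neg).const_mul l).congr_deriv (by ring)
  have phi_eqOn : EqOn (phi p f.fn) (fun x => l * (1 - x ^ 2) - subChord (psiForm G G) x) Ih :=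
    fun x hx => eq_sub_of_add_eq (hl x (Ih_subset_I1 hx))
  have second_deriv : EqOn (iteratedDeriv 2 fun x => l * (1 - x ^ 2) - subChord (psiForm G G) x)
      (fun x => -(2 * l) - primitive (psiIntegrand G G) x) Ih :=
    iteratedDeriv_succ_eqOn isOpen_Ih (fun x hx => (quad_deriv x).sub (H.deriv1 x hx))
      (iteratedDeriv_succ_eqOn isOpen_Ih (fun x hx => (lin_deriv x).sub (H.deriv2 x hx))
        (by simp [EqOn]))
  rw [iteratedDeriv_eqOn isOpen_Ih phi_eqOn zero_mem_Ih, second_deriv zero_mem_Ih]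
  simp [primitive]

lemma IsDeviation.solvesNSE (hε : 0 < ε) (hε' : ε < 1 / 2) (hpq : HasExponents p q) {β : Beta}
    {z : M1 ε × M2 ε} (h : IsDeviation (q, β) z) :
    SolvesNSE (aff q + z.1.fn, z.2.fn) (cHat p (z.1.fn, z.2.fn)) where
  smooth_theta := (contDiff_aff q).contDiffOn.add z.1.mem.smooth
  smooth_phi := z.2.mem.smooth
  eq_theta x hx := by
    obtain ⟨l, hl⟩ := (hpq.thetaSol_iff z.1 z.2).1 h.theta_eq
    have hlx := hl x hx
    rw [subChord] at hlx
    simp only [hpq.theta_aff_add z.1 hx, cHat, P, iteratedDeriv_two_phi_zero hε hε' hl,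
      Matrix.cons_val_zero, Matrix.cons_val_one, Matrix.cons_val]
    linear_combination hlx
  eq_phi := phiSol_iff_eq_zero.1 h.phi_eq

lemma isDeviation_of_solvesNSE (hε : 0 < ε) (hε' : ε < 1 / 2) (hpq : HasExponents p q)
    {c : Fin 3 → ℝ} {f : M1 ε} {G : M2 ε} (h : SolvesNSE (aff q + f.fn, G.fn) c) :
    IsDeviation (q, !₂[deriv G.fn 0, G.fn 0]) (f, G) := by
  set A := c 0 - p.1 0 - (1 / 2) * psi G.fn (-1) with hA
  set B := c 1 - p.1 1 - (1 / 2) * psi G.fn 1 with hB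
  set l := c 2 - p.1 2 with hl
  have eq_quad : ∀ x ∈ I1, phi p f.fn x + subChord (psi G.fn) x
      = A * (1 - x) + B * (1 + x) + l * (1 - x ^ 2) := fun x hx => by
    have heq := h.eq_theta x hx
    rw [hpq.theta_aff_add f hx, P, P] at heq
    rw [subChord, hA, hB, hl]
    linear_combination heq
  obtain ⟨C, hC⟩ := hpq.exists_abs_phi_le hε' f
  obtain ⟨K, hK⟩ := exists_thetaData_psiForm hε hε'
  obtain ⟨h1, H⟩ := hK G G
  -- The left-hand side of `eq_quad` vanishes at `±1`, which determines `c 0` and `c 1`.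
  have endpoints := eq_zero_endpoints_of_abs_le_jacobi (p := 1 - 2 * ε) (r := 1 - 2 * ε)
    (C := C + K * ‖G‖ * ‖G‖) (y := fun x => A * (1 - x) + B * (1 + x) + l * (1 - x ^ 2))
    (by linarith) (by linarith) (by fun_prop) fun x hx => by
      rw [← eq_quad x hx, ← wt_eq_jacobi _ hx, add_mul]
      exact (abs_add_le _ _).trans (add_le_add (hC x hx) (H.bdd0 x hx))
  have hA0 : A = 0 := by linarith [endpoints.1]
  have hB0 : B = 0 := by linarith [endpoints.2]
  refine ⟨(hpq.thetaSol_iff f G).2 ⟨l, fun x hx => ?_⟩, phiSol_iff_eq_zero.2 h.eq_phi, rfl, rfl⟩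
  rw [eq_quad x hx, hA0, hB0, zero_mul, zero_mul, zero_add, zero_add]

end Equivalence

/-- `T` sends `(f, G)` to itself if `G(0) = G'(0) = 0`; it is used to regard such pairs as elements
of the subspace `X3 ε`. -/
def IsX3Projection {ε : ℝ} (T : M1 ε × M2 ε →L[ℝ] X3 ε) : Prop :=
  ∀ f G, M2.evalZero ε G = 0 → M2.derivZero ε G = 0 →
    (T (f, G) : X ε).fst = f ∧ (T (f, G) : X ε).snd = G

lemma IsFundamentalSystem.exists_isX3Projection {ε : ℝ} {q : ℝ × ℝ} {H J : M2 ε}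
    (hHJ : IsFundamentalSystem q H J) : ∃ T : M1 ε × M2 ε →L[ℝ] X3 ε, IsX3Projection T := by
  let S : M2 ε →L[ℝ] M2 ε :=
    .id ℝ _ - (M2.derivZero ε).smulRight H - (M2.evalZero ε).smulRight J
  let R : M1 ε × M2 ε →L[ℝ] X ε :=
    ((WithLp.prodContinuousLinearEquiv 1 ℝ (M1 ε) (M2 ε)).symm : M1 ε × M2 ε →L[ℝ] X ε) ∘L
      (ContinuousLinearMap.prodMap (.id ℝ (M1 ε)) S)
  have derivZero_S (G) : M2.derivZero ε (S G) = 0 := by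
    simp [S, hHJ.derivZero_fst, hHJ.derivZero_snd]
  have evalZero_S (G) : M2.evalZero ε (S G) = 0 := by
    simp [S, hHJ.evalZero_fst, hHJ.evalZero_snd]
  refine ⟨R.codRestrict (X3 ε) fun z => ⟨derivZero_S z.2, evalZero_S z.2⟩,
    fun f G h0 h1 => ⟨rfl, ?_⟩⟩
  change S G = G
  simp [S, h0, h1]

/-! ### The remainder of the solution branch -/

section Remainder

variable {ε : ℝ}

/-- The part of `w(q, β)` which is of second order in `β`, as an element of `X3 ε`. -/
def remainder (T : M1 ε × M2 ε →L[ℝ] X3 ε) (w : (ℝ × ℝ) × Beta → M1 ε × M2 ε) (q : ℝ × ℝ)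
    (β : Beta) : X3 ε :=
  T (w (q, β) - fderiv ℝ w (q, 0) (0, β))

variable {T : M1 ε × M2 ε →L[ℝ] X3 ε} {w : (ℝ × ℝ) × Beta → M1 ε × M2 ε} {O : Set (ℝ × ℝ)}
  {r δ : ℝ} {p : Param} {q : ℝ × ℝ} {β : Beta}

lemma contDiffOn_remainder (hδ : 0 < δ) (hw : IsBranchOn IsDeviation r (O ×ˢ ball 0 δ) w) :
    ContDiffOn ℝ ∞ (fun e : (ℝ × ℝ) × Beta => remainder T w e.1 e.2) (O ×ˢ ball 0 δ) := by
  have lin : ContDiffOn ℝ ∞ (fun e : (ℝ × ℝ) × Beta => fderiv ℝ w (e.1, 0)) (O ×ˢ ball 0 δ) :=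
    (hw.contDiffOn.fderiv_of_isOpen hw.isOpen (m := ∞) (by simp)).comp
      (by fun_prop) fun e he => ⟨he.1, mem_ball_self hδ⟩
  exact T.contDiff.comp_contDiffOn (hw.contDiffOn.sub (lin.clm_apply (by fun_prop)))

lemma remainder_zero (hδ : 0 < δ) (hw : IsBranchOn IsDeviation r (O ×ˢ ball 0 δ) w) (hq : q ∈ O) :
    remainder T w q 0 = 0 := by
  rw [remainder, hw.eq_zero ⟨hq, mem_ball_self hδ⟩ (isDeviation_zero q), ← Prod.zero_eq_mk,
    map_zero, sub_zero, map_zero]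

lemma hasFDerivAt_remainder (hδ : 0 < δ) (hw : IsBranchOn IsDeviation r (O ×ˢ ball 0 δ) w)
    (hq : q ∈ O) : HasFDerivAt (remainder T w q) (0 : Beta →L[ℝ] X3 ε) 0 := by
  have hw' : HasFDerivAt w (fderiv ℝ w (q, 0)) (q, 0) :=
    ((hw.contDiffOn.contDiffAt (hw.isOpen.mem_nhds ⟨hq, mem_ball_self hδ⟩)).differentiableAt
      (by simp)).hasFDerivAt
  have hsub := (hw'.comp (0 : Beta) (hasFDerivAt_prodMk_right q 0)).sub
    (fderiv ℝ w (q, 0) ∘L .inr ℝ (ℝ × ℝ) Beta).hasFDerivAt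
  rw [sub_self] at hsub
  exact (T.hasFDerivAt.comp (0 : Beta) hsub).congr_fderiv (ContinuousLinearMap.comp_zero _)

lemma agree_ansatz_remainder (hT : IsX3Projection T) (hδ : 0 < δ)
    (hw : IsBranchOn IsDeviation r (O ×ˢ ball 0 δ) w) (hpq : HasExponents p q)
    (hgood : GoodExp ε q) (hq : q ∈ O) (hβ : β ∈ ball 0 δ) :
    Agree (ansatz p β (remainder T w q β : X ε))
      (Ucg p + ((w (q, β)).1.fn, (w (q, β)).2.fn)) := by
  obtain ⟨H, J, hHJ, hH, hJ⟩ := exists_isFundamentalSystem hgood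
  have hdev := hw.sol (e := (q, β)) ⟨hq, hβ⟩
  have remainder_eq : remainder T w q β =
      T ((w (q, β)).1, (w (q, β)).2 - (β 0 • H + β 1 • J)) := by
    rw [remainder, (hw.hasFDerivAt_isDeviation hgood ⟨hq, mem_ball_self hδ⟩ hHJ).fderiv]
    congr 1
    ext1 <;> simp [linPart_apply]
  obtain ⟨fst_eq, snd_eq⟩ := hT (w (q, β)).1 ((w (q, β)).2 - (β 0 • H + β 1 • J))
    (by simp [hdev.evalZero_eq, hHJ.evalZero_fst, hHJ.evalZero_snd])
    (by simp [hdev.derivZero_eq, hHJ.derivZero_fst, hHJ.derivZero_snd])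
  rw [← remainder_eq] at fst_eq snd_eq
  refine ⟨fun x _ => ?_, fun x hx => ?_⟩
  · simp [ansatz, toPair, V3, V4, fst_eq]
  · simp [ansatz, toPair, Ucg, V4, snd_eq, M2.fn_sub, M2.fn_add, M2.fn_smul,
      hpq.V3_eqOn hx, hH hx, hJ hx]

lemma HasExponents.agree_Ucg_add (hpq : HasExponents p q) (u v : ℝ → ℝ) :
    Agree (Ucg p + (u, v)) (aff q + u, v) :=
  ⟨fun x hx => by simp [Ucg, hpq.ubar_eqOn hx], fun x _ => by simp [Ucg]⟩

lemma solvesNSE_ansatz_remainder (hε : 0 < ε) (hε' : ε < 1 / 2) (hT : IsX3Projection T)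
    (hδ : 0 < δ) (hw : IsBranchOn IsDeviation r (O ×ˢ ball 0 δ) w) (hpq : HasExponents p q)
    (hgood : GoodExp ε q) (hq : q ∈ O) (hβ : β ∈ ball 0 δ) :
    SolvesNSE (ansatz p β (remainder T w q β : X ε))
      (cHat p (ansatz p β (remainder T w q β : X ε) - Ucg p)) := by
  have hag := agree_ansatz_remainder hT hδ hw hpq hgood hq hβ
  rw [(Agree.sub_iff.2 hag).cHat_eq]
  exact (hag.trans (hpq.agree_Ucg_add _ _)).solvesNSE
    ((hw.sol (e := (q, β)) ⟨hq, hβ⟩).solvesNSE hε hε' hpq)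

lemma jet_mem_ball {G : M2 ε} (hδ : 0 < δ) (hG : ‖G‖ < δ / 2) :
    (!₂[deriv G.fn 0, G.fn 0] : Beta) ∈ ball 0 δ := by
  rw [mem_ball_zero_iff, EuclideanSpace.norm_eq, Real.sqrt_lt' hδ, Fin.sum_univ_two]
  have hderiv := pow_le_pow_left₀ (abs_nonneg _) G.abs_deriv_zero_le 2
  have heval := pow_le_pow_left₀ (abs_nonneg _) G.abs_fn_zero_le 2
  have hnorm := pow_lt_pow_left₀ hG (norm_nonneg G) two_ne_zero
  simp only [Matrix.cons_val_zero, Matrix.cons_val_one, Real.norm_eq_abs]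
  nlinarith

lemma exists_agree_ansatz_remainder (hε : 0 < ε) (hε' : ε < 1 / 2) (hT : IsX3Projection T)
    (hδ : 0 < δ) (hw : IsBranchOn IsDeviation r (O ×ˢ ball 0 δ) w) (hpq : HasExponents p q)
    (hgood : GoodExp ε q) (hq : q ∈ O) {U : Pair} {W : X ε} {c : Fin 3 → ℝ}
    (hUW : Agree (U - Ucg p) (toPair W)) (hW : ‖W‖ < min r (δ / 2)) (hU : SolvesNSE U c) :
    ∃ β ∈ ball (0 : Beta) δ, Agree U (ansatz p β (remainder T w q β : X ε)) := by
  have hag := Agree.sub_iff.1 hUW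
  have hdev := isDeviation_of_solvesNSE hε hε' hpq
    ((hag.trans (hpq.agree_Ucg_add _ _)).symm.solvesNSE hU)
  have hnorm : ‖W‖ = ‖W.fst‖ + ‖W.snd‖ := WithLp.prod_norm_eq_of_L1 W
  have fst_le : ‖W.fst‖ ≤ ‖W‖ := hnorm ▸ le_add_of_nonneg_right (norm_nonneg _)
  have snd_le : ‖W.snd‖ ≤ ‖W‖ := hnorm ▸ le_add_of_nonneg_left (norm_nonneg _)
  obtain ⟨hWr, hWδ⟩ := lt_min_iff.1 hW
  have hβ := jet_mem_ball hδ (snd_le.trans_lt hWδ)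
  have heq := (hw.sol_iff (q, _) ⟨hq, hβ⟩ (W.fst, W.snd)
    (max_lt (fst_le.trans_lt hWr) (snd_le.trans_lt hWr))).1 hdev
  have hans := agree_ansatz_remainder hT hδ hw hpq hgood hq hβ
  rw [← heq] at hans
  exact ⟨_, hβ, hag.trans hans.symm⟩

end Remainder

end HomNS

end

theorem theorem3p3_general (K : Set HomNS.Param) (hK : IsCompact K) (hKc : K ⊆ HomNS.criticalSet)
    (ε : ℝ) (hε : HomNS.Admissible K ε) :
    ∃ δ : ℝ, 0 < δ ∧ ∃ V : HomNS.Param → HomNS.Beta → HomNS.X3 ε,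
      (∃ O : Set HomNS.Param, IsOpen O ∧ K ⊆ O ∧
        ContDiffOn ℝ ∞ (fun q : HomNS.Param × HomNS.Beta => V q.1 q.2) (O ×ˢ ball 0 δ)) ∧
      (∀ p ∈ K, V p 0 = 0) ∧
      (∀ p ∈ K, HasFDerivAt (V p) (0 : HomNS.Beta →L[ℝ] HomNS.X3 ε) 0) ∧
      (∀ p ∈ K, ∀ β ∈ ball (0 : HomNS.Beta) δ,
        HomNS.SolvesNSE (HomNS.ansatz p β (V p β : HomNS.X ε))
          (HomNS.cHat p (HomNS.ansatz p β (V p β : HomNS.X ε) - HomNS.Ucg p))) ∧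
      ∃ δ' : ℝ, 0 < δ' ∧ ∀ p ∈ K, ∀ (U : HomNS.Pair) (W : HomNS.X ε),
        HomNS.Agree (U - HomNS.Ucg p) (HomNS.toPair W) → ‖W‖ < δ' →
        (∃ chat : Fin 3 → ℝ, HomNS.SolvesNSE U chat) →
        ∃ β ∈ ball (0 : HomNS.Beta) δ,
          HomNS.Agree U (HomNS.ansatz p β (V p β : HomNS.X ε)) := by
  open HomNS in
  have hε0 := hε.pos
  have hε1 := hε.lt_half
  have hexp (p) (hp : p ∈ K) : HasExponents p (exponents p) := hasExponents_exponents (hKc hp)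
  have hgood (p) (hp : p ∈ K) : GoodExp ε (exponents p) := (hexp p hp).goodExp hε hp
  obtain ⟨r, hr, δ, hδ, O, w, hQO, hO, hw⟩ := exists_isBranchOn_isDeviation hε1
    (hK.image continuous_exponents) (forall_mem_image.2 hgood)
  have hKO (p) (hp : p ∈ K) : exponents p ∈ O := hQO (mem_image_of_mem _ hp)
  obtain ⟨H, J, hHJ, -⟩ := exists_isFundamentalSystem (ε := ε) (q := (1, 1))
    ⟨hε0, hε1, le_rfl, le_rfl, by linarith, by linarith⟩
  obtain ⟨T, hT⟩ := hHJ.exists_isX3Projection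
  refine ⟨δ, hδ, fun p => remainder T w (exponents p),
    ⟨{p | p.1 2 < 1 / 2} ∩ exponents ⁻¹' O, isOpen_thd_lt_half.inter (hO.preimage
      continuous_exponents), fun p hp => ⟨criticalSet_subset_thd_lt_half (hKc hp), hKO p hp⟩, ?_⟩,
    fun p hp => remainder_zero hδ hw (hKO p hp), fun p hp => hasFDerivAt_remainder hδ hw (hKO p hp),
    fun p hp β => solvesNSE_ansatz_remainder hε0 hε1 hT hδ hw (hexp p hp) (hgood p hp) (hKO p hp),
    min r (δ / 2), lt_min hr (half_pos hδ), fun p hp U W hUW hW ⟨c, hU⟩ =>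
      exists_agree_ansatz_remainder hε0 hε1 hT hδ hw (hexp p hp) (hgood p hp) (hKO p hp) hUW hW hU⟩
  exact (contDiffOn_remainder hδ hw).comp
    ((contDiffOn_exponents.comp contDiffOn_fst fun e he => he.1.1).prodMk contDiffOn_snd)
    fun e he => ⟨he.1.2, he.2⟩
theorem theorem3p3 (k : ℕ) (hk5 : 5 ≤ k) (hk8 : k ≤ 8)
    (K : Set HomNS.Param) (hK : IsCompact K) (hKI : K ⊆ HomNS.Ik k)
    (ε : ℝ) (hε : HomNS.Admissible K ε) :
    ∃ δ : ℝ, 0 < δ ∧ ∃ V : HomNS.Param → HomNS.Beta → HomNS.X3 ε,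
      (∃ O : Set HomNS.Param, IsOpen O ∧ K ⊆ O ∧
        ContDiffOn ℝ ∞ (fun q : HomNS.Param × HomNS.Beta => V q.1 q.2) (O ×ˢ ball 0 δ)) ∧
      (∀ p ∈ K, V p 0 = 0) ∧
      (∀ p ∈ K, HasFDerivAt (V p) (0 : HomNS.Beta →L[ℝ] HomNS.X3 ε) 0) ∧
      (∀ p ∈ K, ∀ β ∈ ball (0 : HomNS.Beta) δ,
        HomNS.SolvesNSE (HomNS.ansatz p β (V p β : HomNS.X ε))
          (HomNS.cHat p (HomNS.ansatz p β (V p β : HomNS.X ε) - HomNS.Ucg p))) ∧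
      ∃ δ' : ℝ, 0 < δ' ∧ ∀ p ∈ K, ∀ (U : HomNS.Pair) (W : HomNS.X ε),
        HomNS.Agree (U - HomNS.Ucg p) (HomNS.toPair W) → ‖W‖ < δ' →
        (∃ chat : Fin 3 → ℝ, HomNS.SolvesNSE U chat) →
        ∃ β ∈ ball (0 : HomNS.Beta) δ,
          HomNS.Agree U (HomNS.ansatz p β (V p β : HomNS.X ε)) := by
  exact theorem3p3_general K hK (hKI.trans (HomNS.Ik_subset_criticalSet k)) ε hε
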